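/- Let $\mathbb{H}^d$ ($d\ge 1$) be $d$-dimensional hyperbolic space in the half-space model, i.e. the set of pairs $(x,z)$ with $x\in\mathbb{R}^{d-1}$, $z>0$, with distance $$\operatorname{dist}((x,z),(x',z'))=2\operatorname{arsinh}\Big(\tfrac12\sqrt{\tfrac{\|x-x'\|^2+(z-z')^2}{zz'}}\Big).$$ For finite $P\subset\mathbb{H}^d$, a pair $p\ne p'$ of points of $P$ is a $c$-approximate closest pair of $P$ if $\operatorname{dist}(p,p')\le c\cdot\operatorname{dist}(a,a')$ for all $a\ne a'$ in $P$; a point $p\in P$ is a $c$-approximate nearest neighbour of $q\in\mathbb{H}^d$ in $P$ if $\operatorname{dist}(q,p)\le c\cdot\operatorname{dist}(q,a)$ for all $a\in P$. Algorithms are programs, uniform in $d$ and $n$, of a real RAM with unit-cost arithmetic, comparisons, floor, base-2 logarithm, power of two and bitwise logical operations (on binary expansions of real numbers); points are given by their coordinates. All constants in $O(\cdot)$ are absolute, and $\log$ is the base-2 logarithm. **Theorem.** Let $P\subset\mathbb{H}^d$ be a given set of $n$ points. 1. If $n\ge 2$, an $O(d\sqrt d)$-approximate closest pair of $P$ can be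 found in $O(d^2 n\log n)$ time. 2. One can construct in $O(d^2 n\log n)$ time a data structure that uses $O(d^2 n)$ space, answers queries for an $O(d\sqrt d)$-approximate nearest neighbour in $P$ (for non-empty $P$ and an arbitrary query point $q\in\mathbb{H}^d$) in $O(d^2\log n)$ time, and performs updates (insertion or removal of a point) in $O(d^2\log n)$ time each. After any sequence of operations these bounds hold with $n$ the current number of points. In part 2 the bounds $n$, $\log n$ are read as $n+1$, $\log(n+2)$, so that they make sense for $n\in\{0,1\}$. -/

import Mathlib

/-! ## Hyperbolic space in the half-space model -/

/-- A point of `d`-dimensional hyperbolic space (`d ≥ 1`) in the half-space model: the pair `(x, z)`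
with `x ∈ ℝ^(d-1)` and `z > 0`. -/
@[ext]
structure HPoint (d : ℕ) where
  x : EuclideanSpace ℝ (Fin (d - 1))
  z : ℝ
  z_pos : 0 < z

noncomputable instance instDecidableEqHPoint (d : ℕ) : DecidableEq (HPoint d) :=
  Classical.decEq _

/-- The hyperbolic distance (sectional curvature `-1`). -/
noncomputable def hdist {d : ℕ} (p q : HPoint d) : ℝ :=
  2 * Real.arsinh (1 / 2 * Real.sqrt ((‖p.x - q.x‖ ^ 2 + (p.z - q.z) ^ 2) / (p.z * q.z)))

/-- `p` is a `c`-approximate nearest neighbour of `q` in `S`. -/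
def IsApproxNearest {d : ℕ} (c : ℝ) (S : Finset (HPoint d)) (q p : HPoint d) : Prop :=
  p ∈ S ∧ ∀ a ∈ S, hdist q p ≤ c * hdist q a

/-- `p, p'` is a `c`-approximate closest pair of `S`. -/
def IsApproxClosestPair {d : ℕ} (c : ℝ) (S : Finset (HPoint d)) (p p' : HPoint d) : Prop :=
  p ∈ S ∧ p' ∈ S ∧ p ≠ p' ∧ ∀ a ∈ S, ∀ a' ∈ S, a ≠ a' → hdist p p' ≤ c * hdist a a'

/-! ## Bitwise operations on real numbers -/

/-- The digit of weight `2 ^ k` in the binary expansion of `|a|`. -/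
noncomputable def binDigit (a : ℝ) (k : ℤ) : Bool :=
  Int.bodd ⌊|a| / (2 : ℝ) ^ k⌋

/-- Digit-by-digit application of a Boolean operation `f` (with `f false false = false`) to the
binary expansions of `|a|` and `|b|`. -/
noncomputable def bitwiseReal (f : Bool → Bool → Bool) (a b : ℝ) : ℝ :=
  ∑' k : ℤ, if f (binDigit a k) (binDigit b k) = true then (2 : ℝ) ^ k else 0

/-! ## A real RAM with a step count

A program is a finite syntactic object. It acts on finitely many real registers (addressed by
constants), a random access memory of real numbers, a read-only input array and an output array.
Every arithmetic operation, floor, base-2 logarithm, power of two, bitwise logical operation,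
comparison, memory access and assignment costs one step. -/

/-- Contents of the registers, the memory, the input array and the output array. -/
structure Store where
  reg : ℕ → ℝ
  mem : ℕ → ℝ
  inp : ℕ → ℝ
  out : ℕ → ℝ

inductive UnOp
  | floor
  | log
  | pow2

inductive BinOp
  | add
  | sub
  | mul
  | div
  | band
  | bor
  | bxor

/-- The conventions outside the natural domains are `a / 0 = 0`, `log 0 = 0`,
`log (-a) = log a`. -/
noncomputable def UnOp.eval : UnOp → ℝ → ℝ
  | .floor, a => (⌊a⌋ : ℝ)
  | .log, a => Real.logb 2 a
  | .pow2, a => (2 : ℝ) ^ a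

noncomputable def BinOp.eval : BinOp → ℝ → ℝ → ℝ
  | .add, a, b => a + b
  | .sub, a, b => a - b
  | .mul, a, b => a * b
  | .div, a, b => a / b
  | .band, a, b => bitwiseReal Bool.and a b
  | .bor, a, b => bitwiseReal Bool.or a b
  | .bxor, a, b => bitwiseReal Bool.xor a b

/-- Terms: integer constants, registers, indirect reads of the memory and of the input,
and operations. -/
inductive Term
  | const (k : ℤ)
  | reg (i : ℕ)
  | mem (a : Term)
  | inp (a : Term)
  | un (o : UnOp) (e : Term)
  | bin (o : BinOp) (e f : Term)

/-- The value of a term; an address is rounded down to a natural number. -/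
noncomputable def Term.eval (s : Store) : Term → ℝ
  | .const k => (k : ℝ)
  | .reg i => s.reg i
  | .mem a => s.mem ⌊a.eval s⌋₊
  | .inp a => s.inp ⌊a.eval s⌋₊
  | .un o e => o.eval (e.eval s)
  | .bin o e f => o.eval (e.eval s) (f.eval s)

/-- The number of steps needed to evaluate a term. -/
def Term.cost : Term → ℕ
  | .const _ => 1
  | .reg _ => 1
  | .mem a => a.cost + 1
  | .inp a => a.cost + 1
  | .un _ e => e.cost + 1
  | .bin _ e f => e.cost + f.cost + 1

/-- Evaluating the term in the store `s` reads memory cells with addresses below `M` only. -/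
def Term.Fits (M : ℕ) (s : Store) : Term → Prop
  | .const _ => True
  | .reg _ => True
  | .mem a => a.Fits M s ∧ ⌊a.eval s⌋₊ < M
  | .inp a => a.Fits M s
  | .un _ e => e.Fits M s
  | .bin _ e f => e.Fits M s ∧ f.Fits M s

/-- Comparisons. -/
inductive Test
  | lt (e f : Term)
  | le (e f : Term)
  | eq (e f : Term)
  | ne (e f : Term)

def Test.Holds (s : Store) : Test → Prop
  | .lt e f => e.eval s < f.eval s
  | .le e f => e.eval s ≤ f.eval s
  | .eq e f => e.eval s = f.eval s
  | .ne e f => e.eval s ≠ f.eval s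

def Test.cost : Test → ℕ
  | .lt e f => e.cost + f.cost + 1
  | .le e f => e.cost + f.cost + 1
  | .eq e f => e.cost + f.cost + 1
  | .ne e f => e.cost + f.cost + 1

def Test.Fits (M : ℕ) (s : Store) : Test → Prop
  | .lt e f => e.Fits M s ∧ f.Fits M s
  | .le e f => e.Fits M s ∧ f.Fits M s
  | .eq e f => e.Fits M s ∧ f.Fits M s
  | .ne e f => e.Fits M s ∧ f.Fits M s

/-- Programs. -/
inductive Prog
  | skip
  | set (i : ℕ) (e : Term)
  | store (a e : Term)
  | output (a e : Term)
  | seq (p q : Prog)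
  | ite (b : Test) (p q : Prog)
  | loop (b : Test) (p : Prog)

/-- `Exec M p s t s'`: started in the store `s`, the program `p` halts in the store `s'` after exactly
`t` steps, and it accesses only memory cells with addresses below `M`. -/
inductive Exec (M : ℕ) : Prog → Store → ℕ → Store → Prop
  | skip (s : Store) : Exec M .skip s 1 s
  | set (s : Store) (i : ℕ) (e : Term) (he : e.Fits M s) :
      Exec M (.set i e) s (e.cost + 1) { s with reg := Function.update s.reg i (e.eval s) }
  | store (s : Store) (a e : Term) (ha : a.Fits M s) (he : e.Fits M s) (hM : ⌊a.eval s⌋₊ < M) :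
      Exec M (.store a e) s (a.cost + e.cost + 1)
        { s with mem := Function.update s.mem ⌊a.eval s⌋₊ (e.eval s) }
  | output (s : Store) (a e : Term) (ha : a.Fits M s) (he : e.Fits M s) :
      Exec M (.output a e) s (a.cost + e.cost + 1)
        { s with out := Function.update s.out ⌊a.eval s⌋₊ (e.eval s) }
  | seq {s s' s'' : Store} {p q : Prog} {t u : ℕ} (hp : Exec M p s t s')
      (hq : Exec M q s' u s'') : Exec M (.seq p q) s (t + u) s''
  | ite_true {s s' : Store} {b : Test} {p q : Prog} {t : ℕ} (hf : b.Fits M s) (hb : b.Holds s)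
      (hp : Exec M p s t s') : Exec M (.ite b p q) s (b.cost + t + 1) s'
  | ite_false {s s' : Store} {b : Test} {p q : Prog} {t : ℕ} (hf : b.Fits M s) (hb : ¬ b.Holds s)
      (hq : Exec M q s t s') : Exec M (.ite b p q) s (b.cost + t + 1) s'
  | loop_stop {s : Store} {b : Test} {p : Prog} (hf : b.Fits M s) (hb : ¬ b.Holds s) :
      Exec M (.loop b p) s (b.cost + 1) s
  | loop_step {s s' s'' : Store} {b : Test} {p : Prog} {t u : ℕ} (hf : b.Fits M s)
      (hb : b.Holds s) (hp : Exec M p s t s') (hl : Exec M (.loop b p) s' u s'') :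
      Exec M (.loop b p) s (b.cost + t + u + 1) s''

/-! ## Input, output and data structures -/

/-- The half-space coordinates `x_0, …, x_(d-2), z` of a point, as an array. -/
noncomputable def HPoint.coord {d : ℕ} (p : HPoint d) (j : ℕ) : ℝ :=
  if h : j < d - 1 then p.x ⟨j, h⟩ else if j = d - 1 then p.z else 0

/-- The coordinates of a sequence of points, written one point after the other. -/
noncomputable def encodePoints {d n : ℕ} (P : Fin n → HPoint d) (a : ℕ) : ℝ :=
  if h : a / d < n then (P ⟨a / d, h⟩).coord (a % d) else 0

/-- The store in which a program is started, on memory contents `mem` and input points `P`: the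
registers `0` and `1` hold the dimension and the number of input points, all other registers and the
output array are zero. -/
noncomputable def startStore {d n : ℕ} (mem : ℕ → ℝ) (P : Fin n → HPoint d) : Store where
  reg := fun i => if i = 0 then (d : ℝ) else if i = 1 then (n : ℝ) else 0
  mem := mem
  inp := encodePoints P
  out := fun _ => 0

/-- The finite set of the points of a sequence. -/
noncomputable def pointSet {d n : ℕ} (P : Fin n → HPoint d) : Finset (HPoint d) :=
  Finset.univ.image P

/-- The output array holds the coordinates of `p`. -/
def OutputsPoint {d : ℕ} (s : Store) (p : HPoint d) : Prop :=
  ∀ j < d, s.out j = p.coord j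

/-- The four programs of a dynamic data structure. Between operations only the memory persists. -/
structure DynProgs where
  build : Prog
  query : Prog
  insert : Prog
  delete : Prog

/-- `Reach D d S mem`: the memory contents `mem` arise by building the structure `D` (on a memory
filled with zeros) for some finite set of points of `ℍ^d` and then performing some finite sequence of
queries, insertions and deletions, and `S` is the current set of points. -/
inductive Reach (D : DynProgs) (d : ℕ) : Finset (HPoint d) → (ℕ → ℝ) → Prop
  | build {n : ℕ} (P : Fin n → HPoint d) (hP : Function.Injective P) {M t : ℕ} {s : Store}
      (h : Exec M D.build (startStore (fun _ => 0) P) t s) : Reach D d (pointSet P) s.mem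
  | query {S : Finset (HPoint d)} {mem : ℕ → ℝ} (hS : Reach D d S mem) (hne : S.Nonempty)
      (q : HPoint d) {M t : ℕ} {s : Store}
      (h : Exec M D.query (startStore mem ![q]) t s) : Reach D d S s.mem
  | insert {S : Finset (HPoint d)} {mem : ℕ → ℝ} (hS : Reach D d S mem)
      (p : HPoint d) {M t : ℕ} {s : Store}
      (h : Exec M D.insert (startStore mem ![p]) t s) : Reach D d (Insert.insert p S) s.mem
  | delete {S : Finset (HPoint d)} {mem : ℕ → ℝ} (hS : Reach D d S mem)
      (p : HPoint d) {M t : ℕ} {s : Store}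
      (h : Exec M D.delete (startStore mem ![p]) t s) : Reach D d (S.erase p) s.mem

/-!
Points of `ℍ^d` are sorted along `d + 1` space-filling orders, and approximate neighbours are found
among the neighbours in these orders.

**Cells.** Write a point as its horizontal coordinates together with the logarithm `log₂ z` of its
height. A cell of level `l ∈ ℤ` restricts the logarithmic height to an interval of length `2 ^ l` of
a dyadic grid and the horizontal coordinates to intervals of dyadic grids of a scale `cellScale`,
which is exponential in the height of the top of the cell. The cells are nested, and a cell of level
`l` has diameter `O(√d 2 ^ l)` (`SameCell.hdist_le`). The dyadic grids come in shifted versions,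
displaced by multiples of `1 / (2 ^ e - 1)` with `2 ^ e = Θ(d)`, such that grids of consecutive
scales stay nested. A short interval is cut by at most one of the shifts (`eq_of_gridIdx_ne`), so each
of the `d` coordinates of a pair of points spoils at most one of `d + 1` shifts, and one of them
has a cell of level `log₂ (d r) + O(1)` that contains both points, where `r` is their distance
(`exists_sameCell`). All points of this cell are within `O(d √d r)` of each other (`exists_shift`).

**Orders.** Each shifted hierarchy defines a Z-order `HLt i` in which every cell is an interval
(`SameCell.of_between`). Hence, for any pair of points, in one of the orders everything between them
is within `O(d √d)` times their distance. For a query point `q` the better of its two neighbours in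
each order, taken over all orders, is an approximate nearest neighbour
(`exists_hdist_le_of_hBetween`), and the best pair of consecutive points is an approximate closest
pair (`exists_adjacent_hdist_le`). The comparison of two points in an order takes `O(d)` steps: the
largest scale at which a shifted grid separates two numbers is read off from the leading digit of a
bitwise exclusive or (`sepLevel_spec`).

**Data structure.** Each order is stored as the sorted list of the numbers of the points, packed as
digits in base `2 ^ b` into one real number. Binary search takes `O(d log n)` steps; inserting or
removing a digit takes `O(1)` operations. When `b` bits no longer suffice, all digits of a list are
widened at once by a multiplication and a bitwise conjunction (`Nat.ofDigits_widen`). So updates and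
queries take `O(d² log n)` steps, and the memory holds `O(d n)` numbers (`Represents`).

Programs are verified with a Hoare logic with step counts (`Runs`).
-/

/-! ### Reasoning about programs -/

namespace Store

/-- The store with register `i` overwritten. -/
def setReg (s : Store) (i : ℕ) (v : ℝ) : Store := { s with reg := Function.update s.reg i v }

/-- The store with memory cell `a` overwritten. -/
def setMem (s : Store) (a : ℕ) (v : ℝ) : Store := { s with mem := Function.update s.mem a v }

/-- The store with output cell `a` overwritten. -/
def setOut (s : Store) (a : ℕ) (v : ℝ) : Store := { s with out := Function.update s.out a v }

@[simp] theorem setReg_reg (s : Store) (i : ℕ) (v : ℝ) (j : ℕ) :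
    (s.setReg i v).reg j = if j = i then v else s.reg j := by
  simp [setReg, Function.update_apply]
@[simp] theorem setReg_mem (s : Store) (i : ℕ) (v : ℝ) : (s.setReg i v).mem = s.mem := rfl
@[simp] theorem setReg_inp (s : Store) (i : ℕ) (v : ℝ) : (s.setReg i v).inp = s.inp := rfl
@[simp] theorem setReg_out (s : Store) (i : ℕ) (v : ℝ) : (s.setReg i v).out = s.out := rfl
@[simp] theorem setMem_reg (s : Store) (i : ℕ) (v : ℝ) : (s.setMem i v).reg = s.reg := rfl
@[simp] theorem setMem_inp (s : Store) (i : ℕ) (v : ℝ) : (s.setMem i v).inp = s.inp := rfl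
@[simp] theorem setOut_out (s : Store) (i : ℕ) (v : ℝ) (j : ℕ) :
    (s.setOut i v).out j = if j = i then v else s.out j := by
  simp [setOut, Function.update_apply]
@[simp] theorem setOut_reg (s : Store) (i : ℕ) (v : ℝ) : (s.setOut i v).reg = s.reg := rfl
@[simp] theorem setOut_mem (s : Store) (i : ℕ) (v : ℝ) : (s.setOut i v).mem = s.mem := rfl

end Store

/-- The machine is deterministic; the address bound plays no role in the outcome. -/
theorem Exec.det {M M' : ℕ} {p : Prog} {s s' s'' : Store} {t t' : ℕ} (h : Exec M p s t s')
    (h' : Exec M' p s t' s'') : t = t' ∧ s' = s'' := by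
  induction h generalizing t' s'' with
  | skip | set | store | output => cases h'; exact ⟨rfl, rfl⟩
  | seq hp hq ihp ihq =>
    cases h' with
    | seq hp' hq' =>
      obtain ⟨rfl, rfl⟩ := ihp hp'
      obtain ⟨rfl, rfl⟩ := ihq hq'
      exact ⟨rfl, rfl⟩
  | ite_true hf hb hp ih =>
    cases h' with
    | ite_true _ _ hp' => obtain ⟨rfl, rfl⟩ := ih hp'; exact ⟨rfl, rfl⟩
    | ite_false _ hb' _ => exact absurd hb hb'
  | ite_false hf hb hp ih =>
    cases h' with
    | ite_true _ hb' _ => exact absurd hb' hb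
    | ite_false _ _ hp' => obtain ⟨rfl, rfl⟩ := ih hp'; exact ⟨rfl, rfl⟩
  | loop_stop hf hb =>
    cases h' with
    | loop_stop => exact ⟨rfl, rfl⟩
    | loop_step _ hb' => exact absurd hb' hb
  | loop_step hf hb hp hl ihp ihl =>
    cases h' with
    | loop_stop _ hb' => exact absurd hb hb'
    | loop_step _ _ hp' hl' =>
      obtain ⟨rfl, rfl⟩ := ihp hp'
      obtain ⟨rfl, rfl⟩ := ihl hl'
      exact ⟨rfl, rfl⟩

/-- Total correctness with resource bounds: started in `s`, the program `p` halts after at most `T`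
steps in a store that satisfies `Q`, and it only touches memory cells with addresses below `M`. -/
def Runs (M : ℕ) (p : Prog) (s : Store) (T : ℕ) (Q : Store → Prop) : Prop :=
  ∃ t s', Exec M p s t s' ∧ t ≤ T ∧ Q s'

namespace Runs

variable {M : ℕ} {p q : Prog} {s : Store} {T T₁ T₂ : ℕ} {Q R : Store → Prop}

theorem mono (h : Runs M p s T R) (hT : T ≤ T₁) (hQ : ∀ s', R s' → Q s') : Runs M p s T₁ Q := by
  obtain ⟨t, s', he, ht, hs⟩ := h
  exact ⟨t, s', he, ht.trans hT, hQ _ hs⟩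

theorem skip (hT : 1 ≤ T) (h : Q s) : Runs M .skip s T Q := ⟨1, s, .skip s, hT, h⟩

theorem set {i : ℕ} {e : Term} (he : e.Fits M s) (hT : e.cost + 1 ≤ T)
    (h : Q (s.setReg i (e.eval s))) : Runs M (.set i e) s T Q :=
  ⟨_, _, .set s i e he, hT, h⟩

theorem store {a e : Term} {k : ℕ} {v : ℝ} (ha : a.Fits M s) (he : e.Fits M s)
    (hk : a.eval s = k) (hv : e.eval s = v) (hM : k < M) (hT : a.cost + e.cost + 1 ≤ T)
    (h : Q (s.setMem k v)) : Runs M (.store a e) s T Q := by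
  refine ⟨_, _, .store s a e ha he ?_, hT, ?_⟩
  · rwa [hk, Nat.floor_natCast]
  · rw [hk, hv, Nat.floor_natCast]; exact h

theorem output {a e : Term} {k : ℕ} {v : ℝ} (ha : a.Fits M s) (he : e.Fits M s)
    (hk : a.eval s = k) (hv : e.eval s = v) (hT : a.cost + e.cost + 1 ≤ T)
    (h : Q (s.setOut k v)) : Runs M (.output a e) s T Q := by
  refine ⟨_, _, .output s a e ha he, hT, ?_⟩
  rw [hk, hv, Nat.floor_natCast]; exact h

theorem seq (hp : Runs M p s T₁ R) (hq : ∀ s', R s' → Runs M q s' T₂ Q) (hT : T₁ + T₂ ≤ T) :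
    Runs M (.seq p q) s T Q := by
  obtain ⟨t, s', he, ht, hs⟩ := hp
  obtain ⟨u, s'', he', hu, hs'⟩ := hq s' hs
  exact ⟨_, _, .seq he he', by omega, hs'⟩

/-- An assignment followed by a program. -/
theorem set_seq {i : ℕ} {e : Term} {v : ℝ} (he : e.Fits M s) (hv : e.eval s = v)
    (hq : Runs M q (s.setReg i v) T₂ Q) (hT : e.cost + 1 + T₂ ≤ T) :
    Runs M (.seq (.set i e) q) s T Q :=
  seq (set (Q := fun s' => s' = s.setReg i v) he le_rfl (by rw [hv])) (by rintro _ rfl; exact hq) hT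

theorem store_seq {a e : Term} {k : ℕ} {v : ℝ} (ha : a.Fits M s) (he : e.Fits M s)
    (hk : a.eval s = k) (hv : e.eval s = v) (hM : k < M)
    (hq : Runs M q (s.setMem k v) T₂ Q) (hT : a.cost + e.cost + 1 + T₂ ≤ T) :
    Runs M (.seq (.store a e) q) s T Q :=
  seq (store (Q := fun s' => s' = s.setMem k v) ha he hk hv hM le_rfl rfl)
    (by rintro _ rfl; exact hq) hT

theorem ite {b : Test} (hf : b.Fits M s) (hp : b.Holds s → Runs M p s T₁ Q)
    (hq : ¬ b.Holds s → Runs M q s T₁ Q) (hT : b.cost + T₁ + 1 ≤ T) :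
    Runs M (.ite b p q) s T Q := by
  by_cases hb : b.Holds s
  · obtain ⟨t, s', he, ht, hs⟩ := hp hb
    exact ⟨_, _, .ite_true hf hb he, by omega, hs⟩
  · obtain ⟨t, s', he, ht, hs⟩ := hq hb
    exact ⟨_, _, .ite_false hf hb he, by omega, hs⟩

/-- A loop with invariant `Inv` indexed by a bound on the number of remaining rounds. -/
theorem loop {b : Test} {Inv : ℕ → Store → Prop} (hf : ∀ k s, Inv k s → b.Fits M s)
    (hstep : ∀ k s, Inv k s → b.Holds s → ∃ k', k = k' + 1 ∧ Runs M p s T (Inv k'))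
    (k : ℕ) (h : Inv k s) :
    Runs M (.loop b p) s (k * (T + b.cost + 1) + b.cost + 1)
      (fun s' => ∃ k', Inv k' s' ∧ ¬ b.Holds s') := by
  induction k generalizing s with
  | zero =>
    have hb : ¬ b.Holds s := fun hb => by obtain ⟨k', hk', -⟩ := hstep _ _ h hb; omega
    exact ⟨_, _, Exec.loop_stop (hf _ _ h) hb, by omega, 0, h, hb⟩
  | succ k ih =>
    by_cases hb : b.Holds s
    · obtain ⟨k', hk', t, s', he, ht, hs⟩ := hstep _ _ h hb
      obtain rfl : k = k' := by omega
      obtain ⟨u, s'', he', hu, hs'⟩ := ih hs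
      exact ⟨_, _, .loop_step (hf _ _ h) hb he he', by nlinarith, hs'⟩
    · exact ⟨_, _, Exec.loop_stop (hf _ _ h) hb, by nlinarith, k + 1, h, hb⟩

end Runs

/-- `for r < bound do body`, starting from the current value of register `r`. -/
def forLoop (r : ℕ) (bound : Term) (body : Prog) : Prog :=
  .loop (.lt (.reg r) bound) (.seq body (.set r (.bin .add (.reg r) (.const 1))))

theorem Runs.forLoop {M : ℕ} {s : Store} {r : ℕ} {bound : Term} {body : Prog} {T a N : ℕ}
    (Inv : ℕ → Store → Prop)
    (hreg : ∀ k s, Inv k s → s.reg r = k ∧ bound.Fits M s ∧ bound.eval s = N)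
    (hbody : ∀ k s, k < N → Inv k s →
      Runs M body s T (fun s' => s'.reg r = k ∧ Inv (k + 1) (s'.setReg r (k + 1 : ℕ))))
    (h : Inv a s) (ha : a ≤ N) :
    Runs M (forLoop r bound body) s ((N - a) * (T + bound.cost + 7) + bound.cost + 3)
      (Inv N) := by
  have key := Runs.loop (M := M) (s := s) (b := .lt (.reg r) bound) (T := T + 4)
    (p := .seq body (.set r (.bin .add (.reg r) (.const 1))))
    (Inv := fun k s => k ≤ N ∧ Inv (N - k) s)
    (fun k s hk => ⟨trivial, (hreg _ _ hk.2).2.1⟩)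
    (fun k s hk hb => by
      obtain ⟨h1, -, h3⟩ := hreg _ _ hk.2
      have hlt : N - k < N := by
        have : s.reg r < bound.eval s := hb
        rw [h1, h3] at this
        exact_mod_cast this
      refine ⟨k - 1, by omega, ?_⟩
      refine Runs.seq (hbody _ _ hlt hk.2) (fun s' hs' => ?_) (T₂ := 4) le_rfl
      refine Runs.set ⟨trivial, trivial⟩ (by simp [Term.cost]) ⟨by omega, ?_⟩
      have e1 : N - (k - 1) = N - k + 1 := by omega
      have e2 : (Term.bin .add (.reg r) (.const 1)).eval s' = ((N - k + 1 : ℕ) : ℝ) := by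
        simp [Term.eval, BinOp.eval, hs'.1]
      rw [e1, e2]
      exact hs'.2)
    (N - a) ⟨by omega, by rwa [show N - (N - a) = a by omega]⟩
  refine key.mono ?_ ?_
  · simp only [Test.cost, Term.cost]
    ring_nf
    omega
  · rintro s' ⟨k, ⟨hk, hI⟩, hb⟩
    obtain ⟨h1, -, h3⟩ := hreg _ _ hI
    have : ¬ s'.reg r < bound.eval s' := hb
    rw [h1, h3, Nat.cast_lt] at this
    have : N - k = N := by omega
    rwa [this] at hI

/-! ### Bitwise operations on natural numbers -/

theorem binDigit_natCast (m k : ℕ) : binDigit (m : ℝ) (k : ℤ) = m.testBit k := by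
  have h : ⌊(m : ℝ) / 2 ^ k⌋ = ((m / 2 ^ k : ℕ) : ℤ) := by
    have := Int.floor_div_natCast (m : ℝ) (2 ^ k)
    push_cast at this
    simpa using this
  rw [binDigit, abs_of_nonneg (Nat.cast_nonneg m), zpow_natCast, h, Int.bodd_coe,
    Nat.testBit_eq_decide_div_mod_eq, Nat.mod_two_of_bodd]
  cases (m / 2 ^ k).bodd <;> simp

theorem binDigit_natCast_of_neg (m : ℕ) {k : ℤ} (hk : k < 0) : binDigit (m : ℝ) k = false := by
  obtain ⟨j, rfl⟩ : ∃ j : ℕ, k = -((j : ℤ) + 1) := ⟨(-k - 1).toNat, by omega⟩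
  have h : (m : ℝ) / (2 : ℝ) ^ (-((j : ℤ) + 1)) = ((2 * (m * 2 ^ j) : ℤ) : ℝ) := by
    rw [zpow_neg, div_inv_eq_mul, zpow_add_one₀ two_ne_zero, zpow_natCast]
    push_cast
    ring
  rw [binDigit, abs_of_nonneg (Nat.cast_nonneg m), h, Int.floor_intCast, Int.bodd_mul]
  rfl

theorem Nat.sum_testBit_two_pow (w N : ℕ) :
    ∑ k ∈ Finset.range N, (if w.testBit k = true then 2 ^ k else 0) = w % 2 ^ N := by
  induction N with
  | zero => simp [Nat.mod_one]
  | succ N ih =>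
    rw [Finset.sum_range_succ, ih, Nat.mod_pow_succ, Nat.testBit_eq_decide_div_mod_eq]
    rcases Nat.mod_two_eq_zero_or_one (w / 2 ^ N) with h | h <;> simp [h]

/-- On natural numbers the digitwise operation on reals is the usual bitwise operation. -/
theorem bitwiseReal_natCast {f : Bool → Bool → Bool} (hf : f false false = false) (m n : ℕ) :
    bitwiseReal f m n = (Nat.bitwise f m n : ℕ) := by
  set w := Nat.bitwise f m n with hw
  have hbit : ∀ k : ℕ, f (m.testBit k) (n.testBit k) = w.testBit k := fun k =>
    (Nat.testBit_bitwise hf m n k).symm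
  have hlt : w < 2 ^ w := Nat.lt_two_pow_self
  rw [bitwiseReal, tsum_eq_sum (s := (Finset.range w).map Nat.castEmbedding), Finset.sum_map]
  · have := Nat.sum_testBit_two_pow w w
    rw [Nat.mod_eq_of_lt hlt] at this
    conv_rhs => rw [← this]
    push_cast
    refine Finset.sum_congr rfl fun k _ => ?_
    simp only [Nat.castEmbedding_apply, binDigit_natCast, hbit, zpow_natCast]
  · intro k hk
    rcases lt_or_ge k 0 with h | h
    · simp [binDigit_natCast_of_neg _ h, hf]
    · lift k to ℕ using h
      have hk' : w ≤ k := by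
        by_contra hlt'
        exact hk (Finset.mem_map.2 ⟨k, Finset.mem_range.2 (by omega), rfl⟩)
      have : w.testBit k = false :=
        Nat.testBit_lt_two_pow (hlt.trans_le (Nat.pow_le_pow_right two_pos hk'))
      simp [binDigit_natCast, hbit, this]

theorem bitwiseReal_xor_natCast (m n : ℕ) :
    bitwiseReal Bool.xor m n = ((m ^^^ n : ℕ) : ℝ) :=
  bitwiseReal_natCast rfl m n

theorem bitwiseReal_and_natCast (m n : ℕ) :
    bitwiseReal Bool.and m n = ((m &&& n : ℕ) : ℝ) :=
  bitwiseReal_natCast rfl m n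

/-- The leading digit of `m xor n` is the last position at which `m` and `n` differ. -/
theorem Nat.div_two_pow_eq_iff_xor_lt (m n k : ℕ) : m / 2 ^ k = n / 2 ^ k ↔ m ^^^ n < 2 ^ k := by
  rw [← Nat.shiftRight_eq_div_pow, ← Nat.shiftRight_eq_div_pow, ← Nat.xor_eq_zero_iff,
    ← Nat.shiftRight_xor_distrib, Nat.shiftRight_eq_div_pow, Nat.div_eq_zero_iff]
  simp

/-! ### Lists packed into natural numbers -/

theorem Nat.ofDigits_getD {B : ℕ} {l : List ℕ} (hl : ∀ x ∈ l, x < B) (k : ℕ) :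
    Nat.ofDigits B l / B ^ k % B = l.getD k 0 := by
  rcases Nat.eq_zero_or_pos B with rfl | hB
  · have : l = [] := List.eq_nil_iff_forall_not_mem.2 fun x hx => by simpa using hl x hx
    simp [this]
  rw [Nat.ofDigits_div_pow_eq_ofDigits_drop k hB l hl]
  rcases lt_or_ge k l.length with h | h
  · rw [List.drop_eq_getElem_cons h, List.getD_eq_getElem _ _ h, Nat.ofDigits_cons,
      Nat.add_mul_mod_self_left]
    exact Nat.mod_eq_of_lt (hl _ (List.getElem_mem h))
  · rw [List.drop_eq_nil_of_le h, List.getD_eq_default _ _ h]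
    simp

theorem Nat.testBit_ofDigits_two_pow {c : ℕ} (hc : 0 < c) {l : List ℕ}
    (hl : ∀ x ∈ l, x < 2 ^ c) (t : ℕ) :
    (Nat.ofDigits (2 ^ c) l).testBit t = (l.getD (t / c) 0).testBit (t % c) := by
  induction l generalizing t with
  | nil => simp
  | cons x l ih =>
    rw [Nat.ofDigits_cons, add_comm, Nat.testBit_two_pow_mul_add _ (hl x (by simp))]
    split_ifs with h
    · rw [Nat.div_eq_of_lt h, Nat.mod_eq_of_lt h]; rfl
    · rw [ih fun y hy => hl y (by simp [hy])]
      obtain ⟨u, rfl⟩ : ∃ u, t = u + c := ⟨t - c, by omega⟩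
      simp [Nat.add_div_right _ hc]

theorem Nat.mul_ofDigits_replicate_one (a X n : ℕ) :
    a * Nat.ofDigits X (List.replicate n 1) = Nat.ofDigits X (List.replicate n a) := by
  induction n with
  | zero => simp
  | succ n ih => rw [List.replicate_succ, List.replicate_succ, Nat.ofDigits_cons,
      Nat.ofDigits_cons, ← ih]; ring

theorem Nat.cast_ofDigits_replicate_one {X : ℕ} (hX : 1 < X) (n : ℕ) :
    ((Nat.ofDigits X (List.replicate n 1) : ℕ) : ℝ) = ((X : ℝ) ^ n - 1) / (X - 1) := by
  have h : (X : ℝ) - 1 ≠ 0 := by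
    have : (1 : ℝ) < X := by exact_mod_cast hX
    linarith
  rw [eq_div_iff h]
  induction n with
  | zero => simp
  | succ n ih =>
    rw [List.replicate_succ, Nat.ofDigits_cons]
    push_cast at ih ⊢
    linear_combination (X : ℝ) * ih

/-- Widening all digits at once: the product consists of `n` copies of the packed list, the `k`-th
copy shifted so that its `k`-th digit lies at the place of the `k`-th digit of the wide list, and
the mask selects these digits. -/
theorem Nat.ofDigits_widen {b : ℕ} (hb : 0 < b) {l : List ℕ} (hl : ∀ x ∈ l, x < 2 ^ b)
    (hl0 : 0 < l.length) :
    (Nat.ofDigits (2 ^ b) l * Nat.ofDigits (2 ^ (l.length * b)) (List.replicate l.length 1)) &&&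
      ((2 ^ b - 1) * Nat.ofDigits (2 ^ ((l.length + 1) * b)) (List.replicate l.length 1)) =
    Nat.ofDigits (2 ^ ((l.length + 1) * b)) l := by
  set n := l.length with hn
  have hnb : 0 < n * b := Nat.mul_pos hl0 hb
  have hc : 0 < (n + 1) * b := Nat.mul_pos (by omega) hb
  have hL : Nat.ofDigits (2 ^ b) l < 2 ^ (n * b) := by
    have := Nat.ofDigits_lt_base_pow_length (Nat.one_lt_two_pow hb.ne') hl
    rwa [← pow_mul, mul_comm] at this
  have hbc : 2 ^ b ≤ 2 ^ ((n + 1) * b) := Nat.pow_le_pow_right two_pos (by nlinarith)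
  rw [Nat.mul_ofDigits_replicate_one, Nat.mul_ofDigits_replicate_one]
  refine Nat.eq_of_testBit_eq fun t => ?_
  rw [Nat.testBit_and,
    Nat.testBit_ofDigits_two_pow hnb (fun x hx => by rw [List.eq_of_mem_replicate hx]; exact hL),
    Nat.testBit_ofDigits_two_pow hc (fun x hx => by
      rw [List.eq_of_mem_replicate hx]
      have := Nat.two_pow_pos b
      omega),
    Nat.testBit_ofDigits_two_pow hc (fun x hx => (hl x hx).trans_le hbc)]
  set k := t / ((n + 1) * b) with hk
  set r := t % ((n + 1) * b) with hr
  have ht : t = k * ((n + 1) * b) + r := by rw [hk, hr, Nat.div_add_mod']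
  rcases lt_or_ge k n with hkn | hkn
  swap
  · rw [List.getD_eq_default l _ (by omega),
      List.getD_eq_default (List.replicate n (2 ^ b - 1)) _ (by simpa using hkn)]
    simp
  have hx := hl _ (List.getElem_mem (l := l) (n := k) hkn)
  rw [List.getD_eq_getElem (List.replicate n (2 ^ b - 1)) _ (by simpa using hkn),
    List.getElem_replicate, Nat.testBit_two_pow_sub_one, List.getD_eq_getElem l _ hkn]
  rcases lt_or_ge r b with hrb | hrb
  · have hlt : k * b + r < n * b := by nlinarith
    have e : t = (k * b + r) + n * b * k := by rw [ht]; ring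
    have e1 : t / (n * b) = k := by rw [e, Nat.add_mul_div_left _ _ hnb, Nat.div_eq_of_lt hlt]; simp
    have e2 : t % (n * b) = k * b + r := by rw [e, Nat.add_mul_mod_self_left, Nat.mod_eq_of_lt hlt]
    rw [e1, e2, List.getD_eq_getElem _ _ (by simpa using hkn), List.getElem_replicate,
      Nat.testBit_ofDigits_two_pow hb hl]
    have e3 : (k * b + r) / b = k := by
      rw [add_comm, Nat.add_mul_div_right _ _ hb, Nat.div_eq_of_lt hrb, zero_add]
    have e4 : (k * b + r) % b = r := by
      rw [add_comm, Nat.add_mul_mod_self_right, Nat.mod_eq_of_lt hrb]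
    rw [e3, e4, List.getD_eq_getElem _ _ hkn]
    simp [hrb]
  · rw [Nat.testBit_lt_two_pow (hx.trans_le (Nat.pow_le_pow_right two_pos hrb))]
    simp [hrb]

/-! ### Shifted dyadic grids -/

/-- The displacement of the grid of scale `2 ^ k`, in units of `2 ^ k`. It is a multiple of
`1 / (2 ^ e - 1)` that depends on `k` modulo `e` only; this is what nests the grids of all scales
`k ∈ ℤ`, because `2 ^ e ≡ 1` modulo `2 ^ e - 1`. -/
noncomputable def gridShift (e i : ℕ) (k : ℤ) : ℝ := i * (2 : ℝ) ^ (-k % (e : ℤ)) / (2 ^ e - 1)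

/-- The index of the interval of the `i`-th shifted grid of scale `2 ^ k` that contains `x`. -/
noncomputable def gridIdx (e i : ℕ) (k : ℤ) (x : ℝ) : ℤ := ⌊x / (2 : ℝ) ^ k + gridShift e i k⌋

section Grid

variable {e i : ℕ}

/-- The grids of all scales `2 ^ k` with `k ≤ m e` arise from the unshifted ones by one common
displacement `i 2 ^ (m e) / (2 ^ e - 1)`, up to renumbering the intervals. -/
theorem gridShift_eq_add_int (he : 1 ≤ e) (i m : ℕ) {k : ℤ} (hk : k ≤ (m * e : ℕ)) :
    ∃ c : ℤ, (i : ℝ) * 2 ^ (((m * e : ℕ) : ℤ) - k) / (2 ^ e - 1) = gridShift e i k + c := by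
  obtain ⟨n, hn⟩ : ∃ n : ℕ, ((m * e : ℕ) : ℤ) - k = n := ⟨(((m * e : ℕ) : ℤ) - k).toNat, by omega⟩
  have hr : -k % (e : ℤ) = ((n % e : ℕ) : ℤ) := by
    rw [Int.natCast_mod, ← hn]
    push_cast
    rw [sub_eq_add_neg, add_comm, Int.add_mul_emod_self_right]
  have hD : (2 : ℝ) ^ e - 1 ≠ 0 := by
    have : (1 : ℝ) < 2 ^ e := one_lt_pow₀ one_lt_two (by omega)
    linarith
  have hdvd : (2 ^ e - 1 : ℤ) ∣ (2 ^ (e * (n / e)) - 1) := by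
    rw [pow_mul]
    simpa using sub_dvd_pow_sub_pow ((2 : ℤ) ^ e) 1 (n / e)
  obtain ⟨c, hc⟩ := hdvd
  refine ⟨i * 2 ^ (n % e) * c, ?_⟩
  have hc' : (2 : ℝ) ^ (e * (n / e)) - 1 = (2 ^ e - 1) * c := by exact_mod_cast hc
  have hp : (2 : ℝ) ^ n = 2 ^ (e * (n / e)) * 2 ^ (n % e) := by rw [← pow_add, Nat.div_add_mod]
  rw [gridShift, hr, hn, zpow_natCast, zpow_natCast, hp]
  push_cast
  field_simp
  linear_combination (i : ℝ) * hc'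

/-- Consecutive grids are nested. -/
theorem two_mul_gridShift_succ (he : 1 ≤ e) (i : ℕ) (k : ℤ) :
    ∃ c : ℤ, 2 * gridShift e i (k + 1) = gridShift e i k + c := by
  have hm : k + 1 ≤ (((k + 1).toNat * e : ℕ) : ℤ) := by
    have : (k + 1).toNat ≤ (k + 1).toNat * e := Nat.le_mul_of_pos_right _ he
    omega
  obtain ⟨c₁, h₁⟩ := gridShift_eq_add_int he i _ hm
  obtain ⟨c₂, h₂⟩ := gridShift_eq_add_int he i (k + 1).toNat (k := k) (by omega)
  refine ⟨c₂ - 2 * c₁, ?_⟩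
  have : (2 : ℝ) ^ ((((k + 1).toNat * e : ℕ) : ℤ) - k)
      = 2 * 2 ^ ((((k + 1).toNat * e : ℕ) : ℤ) - (k + 1)) := by
    rw [← zpow_one_add₀ two_ne_zero]; congr 1; ring
  rw [this] at h₂
  push_cast
  linear_combination h₂ - 2 * h₁

theorem gridIdx_succ (he : 1 ≤ e) (i : ℕ) (k : ℤ) :
    ∃ c : ℤ, 2 * gridShift e i (k + 1) = gridShift e i k + c ∧
      ∀ x, gridIdx e i (k + 1) x = (gridIdx e i k x + c) / 2 := by
  obtain ⟨c, hc⟩ := two_mul_gridShift_succ he i k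
  refine ⟨c, hc, fun x => ?_⟩
  have h : x / (2 : ℝ) ^ (k + 1) + gridShift e i (k + 1)
      = (x / 2 ^ k + gridShift e i k + c) / (2 : ℕ) := by
    rw [zpow_add_one₀ two_ne_zero]
    push_cast
    field_simp
    linear_combination 2 ^ k * hc
  rw [gridIdx, h, Int.floor_div_natCast, Int.floor_add_intCast]
  rfl

theorem gridIdx_mono (e i : ℕ) (k : ℤ) : Monotone (gridIdx e i k) := fun x y h => by
  unfold gridIdx
  gcongr

theorem gridIdx_eq_of_le (he : 1 ≤ e) {k l : ℤ} (hkl : k ≤ l) {x y : ℝ}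
    (h : gridIdx e i k x = gridIdx e i k y) : gridIdx e i l x = gridIdx e i l y := by
  induction l, hkl using Int.leInduction with
  | base => exact h
  | succ l _ ih =>
    obtain ⟨c, -, hc⟩ := gridIdx_succ he i l
    rw [hc, hc, ih]

theorem gridIdx_eq_of_between {k : ℤ} {x y z : ℝ} (hxy : x ≤ y) (hyz : y ≤ z)
    (h : gridIdx e i k x = gridIdx e i k z) : gridIdx e i k x = gridIdx e i k y :=
  le_antisymm (gridIdx_mono e i k hxy) (h ▸ gridIdx_mono e i k hyz)

theorem abs_sub_lt_of_gridIdx_eq {k : ℤ} {x y : ℝ} (h : gridIdx e i k x = gridIdx e i k y) :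
    |x - y| < 2 ^ k := by
  have hp : (0 : ℝ) < 2 ^ k := by positivity
  have := Int.abs_sub_lt_one_of_floor_eq_floor h
  rw [add_sub_add_right_eq_sub, ← sub_div, abs_div, abs_of_pos hp, div_lt_one hp] at this
  exact this

/-- An interval shorter than `2 ^ k / (2 ^ e - 1)` is cut by at most one of the shifted grids of
scale `2 ^ k`. -/
theorem eq_of_gridIdx_ne (he : 1 ≤ e) {i i' : ℕ} (hi : i < 2 ^ e - 1) (hi' : i' < 2 ^ e - 1)
    {k : ℤ} {x y : ℝ} (hxy : x ≤ y) (hlt : y - x < 2 ^ k / (2 ^ e - 1))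
    (h : gridIdx e i k x ≠ gridIdx e i k y) (h' : gridIdx e i' k x ≠ gridIdx e i' k y) :
    i = i' := by
  have hp : (0 : ℝ) < 2 ^ k := by positivity
  have hD : (0 : ℝ) < 2 ^ e - 1 := by
    have : (1 : ℝ) < 2 ^ e := one_lt_pow₀ one_lt_two (by omega)
    linarith
  have he0 : (0 : ℤ) < e := by exact_mod_cast he
  obtain ⟨r, hr⟩ : ∃ r : ℕ, -k % (e : ℤ) = r :=
    ⟨(-k % (e : ℤ)).toNat, by have := Int.emod_nonneg (-k) he0.ne'; omega⟩
  -- the first grid line beyond `x`, in units of `2 ^ k / (2 ^ e - 1)`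
  have key : ∀ j : ℕ, gridIdx e j k x ≠ gridIdx e j k y → ∃ m : ℤ,
      x * (2 ^ e - 1) / 2 ^ k < ((m * (2 ^ e - 1) - j * 2 ^ r : ℤ) : ℝ) ∧
      ((m * (2 ^ e - 1) - j * 2 ^ r : ℤ) : ℝ) ≤ y * (2 ^ e - 1) / 2 ^ k := by
    intro j hj
    have hlt : gridIdx e j k x < gridIdx e j k y := lt_of_le_of_ne (gridIdx_mono e j k hxy) hj
    refine ⟨gridIdx e j k x + 1, ?_, ?_⟩
    · have h1 := Int.lt_floor_add_one (x / (2 : ℝ) ^ k + gridShift e j k)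
      change _ < (gridIdx e j k x : ℝ) + 1 at h1
      rw [gridShift, hr, zpow_natCast] at h1
      have h2 := mul_lt_mul_of_pos_right h1 hD
      rw [add_mul, div_mul_cancel₀ _ hD.ne', div_mul_eq_mul_div] at h2
      push_cast
      linarith
    · have h1 := Int.floor_le (y / (2 : ℝ) ^ k + gridShift e j k)
      change (gridIdx e j k y : ℝ) ≤ _ at h1
      have h3 : ((gridIdx e j k x : ℝ) + 1) ≤ gridIdx e j k y := by exact_mod_cast hlt
      rw [gridShift, hr, zpow_natCast] at h1
      have h2 := mul_le_mul_of_nonneg_right (h3.trans h1) hD.le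
      rw [add_mul (y / _), div_mul_cancel₀ _ hD.ne', div_mul_eq_mul_div] at h2
      push_cast
      linarith
  obtain ⟨m, h1, h2⟩ := key i h
  obtain ⟨m', h1', h2'⟩ := key i' h'
  have hgap : y * (2 ^ e - 1) / 2 ^ k - x * (2 ^ e - 1) / 2 ^ k < 1 := by
    rw [← sub_div, ← sub_mul, div_lt_one hp]
    rwa [lt_div_iff₀ hD] at hlt
  have hEq : m * (2 ^ e - 1) - i * 2 ^ r = m' * (2 ^ e - 1) - i' * 2 ^ r := by
    set a := m * (2 ^ e - 1) - i * 2 ^ r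
    set a' := m' * (2 ^ e - 1) - i' * 2 ^ r
    have ha : (a : ℝ) < a' + 1 := by linarith
    have ha' : (a' : ℝ) < a + 1 := by linarith
    have ha : a < a' + 1 := by exact_mod_cast ha
    have ha' : a' < a + 1 := by exact_mod_cast ha'
    omega
  -- equal grid lines force equal shifts, as `2` is invertible modulo `2 ^ e - 1`
  have hcop : IsCoprime (2 ^ e - 1 : ℤ) (2 ^ r) := by
    refine IsCoprime.pow_right ⟨-1, 2 ^ (e - 1), ?_⟩
    rw [← pow_succ, Nat.sub_add_cancel he]
    ring
  have hdvd : (2 ^ e - 1 : ℤ) ∣ ((i : ℤ) - i') := by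
    refine hcop.dvd_of_dvd_mul_right ⟨m - m', ?_⟩
    linear_combination -hEq
  have h2e : ((2 ^ e - 1 : ℕ) : ℤ) = 2 ^ e - 1 := by
    rw [Nat.cast_sub Nat.one_le_two_pow]; push_cast; ring
  have := Int.eq_zero_of_abs_lt_dvd hdvd (by rw [abs_lt]; omega)
  omega

end Grid

/-! ### The level at which two numbers are separated -/

/-- The largest level at which the `i`-th shifted grid separates `u` and `v`, computed with a
bounded number of operations: both numbers are moved by a large multiple of the period of the
displacements, cut off at the scale of `|u - v|`, and compared digit by digit. -/
noncomputable def sepLevel (e i : ℕ) (u v : ℝ) : ℝ :=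
  let σ : ℝ := i * 2 ^ ((e : ℝ) * (2 + ⌊Real.logb 2 (u * u + v * v + 1)⌋)) / (2 ^ (e : ℝ) - 1)
  let j : ℝ := ⌊Real.logb 2 ((u - v) * (u - v)) / 2⌋
  j + ⌊Real.logb 2 (bitwiseReal Bool.xor ⌊(u + σ) / 2 ^ j⌋ ⌊(v + σ) / 2 ^ j⌋)⌋

/-- Restricting `0 < i < 2 ^ e - 1` makes the displacement `σ` large enough for both numbers to
become positive, and keeps them in one interval of the scale of `σ`. -/
theorem sepLevel_spec {e i : ℕ} (he : 1 ≤ e) (hi1 : 1 ≤ i) (hi : i < 2 ^ e - 1) {u v : ℝ}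
    (huv : u ≠ v) : ∃ κ : ℤ, sepLevel e i u v = κ ∧ gridIdx e i κ u ≠ gridIdx e i κ v ∧
      gridIdx e i (κ + 1) u = gridIdx e i (κ + 1) v := by
  set Y := u * u + v * v + 1 with hY
  have hY1 : 1 ≤ Y := by nlinarith [mul_self_nonneg u, mul_self_nonneg v]
  have hfl0 : 0 ≤ ⌊Real.logb 2 Y⌋ := Int.floor_nonneg.2 (Real.logb_nonneg one_lt_two hY1)
  obtain ⟨g, hg⟩ : ∃ g : ℕ, ⌊Real.logb 2 Y⌋ = g := ⟨_, (Int.toNat_of_nonneg hfl0).symm⟩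
  have hYg : Y < 2 ^ (g + 1) := by
    have h1 := Int.lt_floor_add_one (Real.logb 2 Y)
    rw [hg, Real.logb_lt_iff_lt_rpow one_lt_two (by linarith)] at h1
    exact_mod_cast h1
  have he2 : (1 : ℝ) < 2 ^ e := one_lt_pow₀ one_lt_two (by omega)
  have hD : (0 : ℝ) < 2 ^ e - 1 := by linarith
  have hiD : (i : ℝ) + 1 ≤ 2 ^ e - 1 := by
    have h2 : i + 1 + 1 ≤ 2 ^ e := by omega
    have h3 : ((i + 1 + 1 : ℕ) : ℝ) ≤ ((2 ^ e : ℕ) : ℝ) := by exact_mod_cast h2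
    push_cast at h3
    linarith
  have hi1' : (1 : ℝ) ≤ i := by exact_mod_cast hi1
  set L := (g + 2) * e with hL
  have hpow : (2 : ℝ) ^ ((e : ℝ) * (2 + ((g : ℤ) : ℝ))) = 2 ^ L := by
    rw [← Real.rpow_natCast]; congr 1; rw [hL]; push_cast; ring
  set σ : ℝ := i * 2 ^ L / (2 ^ e - 1) with hσ
  have hL1 : Y * (2 ^ e - 1) < 2 ^ L := by
    have h1 : (2 : ℝ) ^ ((g + 1) + e) ≤ 2 ^ L :=
      pow_le_pow_right₀ one_le_two (by rw [hL]; nlinarith)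
    rw [pow_add] at h1
    nlinarith
  have hYL : Y < 2 ^ L / (2 ^ e - 1) := by rwa [lt_div_iff₀ hD]
  -- both shifted numbers lie in `(0, 2 ^ L)`
  have hbound : ∀ x : ℝ, |x| ≤ Y → 0 < x + σ ∧ x + σ < 2 ^ L := by
    intro x hx
    obtain ⟨hx1, hx2⟩ := abs_le.1 hx
    have e1 : σ = i * (2 ^ L / (2 ^ e - 1)) := by rw [hσ]; ring
    have e2 : (2 : ℝ) ^ L = (2 ^ e - 1) * (2 ^ L / (2 ^ e - 1)) := by field_simp
    set q := (2 : ℝ) ^ L / (2 ^ e - 1)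
    have hq : 0 < q := by linarith
    constructor
    · rw [e1]; nlinarith
    · rw [e1, e2]; nlinarith
  have hu := hbound u (by
    rw [abs_le]
    constructor <;> nlinarith [sq_nonneg (u - 1), sq_nonneg (u + 1), mul_self_nonneg v])
  have hv := hbound v (by
    rw [abs_le]
    constructor <;> nlinarith [sq_nonneg (v - 1), sq_nonneg (v + 1), mul_self_nonneg u])
  -- the floor of a shifted number at scale `k` is the grid index up to a constant
  have hidx : ∀ k : ℤ, k ≤ L → ∃ c : ℤ, ∀ x, ⌊(x + σ) / (2 : ℝ) ^ k⌋ = gridIdx e i k x + c := by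
    intro k hk
    obtain ⟨c, hc⟩ := gridShift_eq_add_int he i (g + 2) (k := k) hk
    refine ⟨c, fun x => ?_⟩
    rw [gridIdx, ← Int.floor_add_intCast, add_assoc, ← hc, ← hL, zpow_sub₀ two_ne_zero,
      zpow_natCast, hσ]
    congr 1
    field_simp
  have hw : 0 < |u - v| := abs_pos.2 (sub_ne_zero.2 huv)
  set j : ℤ := ⌊Real.logb 2 ((u - v) * (u - v)) / 2⌋ with hj
  have hj1 : (2 : ℝ) ^ j ≤ |u - v| := by
    have h1 : Real.logb 2 ((u - v) * (u - v)) / 2 = Real.logb 2 |u - v| := by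
      rw [← abs_mul_abs_self (u - v), Real.logb_mul hw.ne' hw.ne']; ring
    have h2 := Int.floor_le (Real.logb 2 ((u - v) * (u - v)) / 2)
    rw [← hj, h1, Real.le_logb_iff_rpow_le one_lt_two hw, Real.rpow_intCast] at h2
    exact h2
  have hjp : (0 : ℝ) < 2 ^ j := by positivity
  have hjL : j < L := by
    have h1 : |u - v| < 2 ^ L := by rw [abs_lt]; constructor <;> linarith
    have : (2 : ℝ) ^ j < 2 ^ (L : ℤ) := by rw [zpow_natCast]; linarith
    exact (zpow_lt_zpow_iff_right₀ one_lt_two).1 this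
  have hnat : ∀ x : ℝ, 0 < x + σ → ∃ m : ℕ, ⌊(x + σ) / (2 : ℝ) ^ j⌋ = m := fun x hx =>
    ⟨_, (Int.toNat_of_nonneg (Int.floor_nonneg.2 (by positivity))).symm⟩
  obtain ⟨m, hm⟩ := hnat u hu.1
  obtain ⟨n, hn⟩ := hnat v hv.1
  have hdiv : ∀ (x : ℝ) (m k : ℕ), ⌊(x + σ) / (2 : ℝ) ^ j⌋ = m →
      ⌊(x + σ) / (2 : ℝ) ^ (j + k)⌋ = (m / 2 ^ k : ℕ) := by
    intro x m k h
    have h1 : (x + σ) / (2 : ℝ) ^ (j + k) = (x + σ) / 2 ^ j / ((2 ^ k : ℕ) : ℝ) := by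
      rw [zpow_add₀ two_ne_zero, zpow_natCast]; push_cast; rw [div_div]
    rw [h1, Int.floor_div_natCast, h]; push_cast; rfl
  -- from scale `2 ^ j` on, the grids see the binary digits of `m` and `n` only
  have hiff : ∀ k : ℕ, j + k ≤ L →
      (gridIdx e i (j + k) u = gridIdx e i (j + k) v ↔ m ^^^ n < 2 ^ k) := by
    intro k hk
    obtain ⟨c, hc⟩ := hidx _ hk
    rw [← Nat.div_two_pow_eq_iff_xor_lt, ← Nat.cast_inj (R := ℤ), ← hdiv u m k hm,
      ← hdiv v n k hn, hc, hc, add_left_inj]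
  have hmn : m ^^^ n ≠ 0 := by
    intro h0
    have h1 := (hiff 0 (by simpa using hjL.le)).2 (by simp [h0])
    have := abs_sub_lt_of_gridIdx_eq h1
    simp only [Nat.cast_zero, add_zero] at this
    linarith
  set w := Nat.log 2 (m ^^^ n) with hwdef
  have hw1 : 2 ^ w ≤ m ^^^ n := Nat.pow_log_le_self 2 hmn
  have hw2 : m ^^^ n < 2 ^ (w + 1) := Nat.lt_pow_succ_log_self one_lt_two _
  have hwL : j + w < L := by
    by_contra hcon
    have hk : j + ((L - j).toNat : ℤ) = L := by omega
    have h1 : m ^^^ n < 2 ^ (L - j).toNat := by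
      refine (hiff _ (by omega)).1 ?_
      rw [hk]
      obtain ⟨c, hc⟩ := hidx L le_rfl
      have hz : ∀ x, 0 < x + σ ∧ x + σ < 2 ^ L → ⌊(x + σ) / (2 : ℝ) ^ (L : ℤ)⌋ = 0 := by
        intro x hx
        rw [zpow_natCast, Int.floor_eq_zero_iff]
        exact ⟨by have := hx.1; positivity, by rw [div_lt_one (by positivity)]; exact hx.2⟩
      have h1 := hz u hu
      have h2 := hz v hv
      rw [hc] at h1 h2
      omega
    have h2 := (Nat.pow_lt_pow_iff_right one_lt_two).1 (hw1.trans_lt h1)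
    omega
  refine ⟨j + w, ?_, ?_, ?_⟩
  · have h1 : (⌊Real.logb 2 ((m ^^^ n : ℕ) : ℝ)⌋ : ℤ) = w := by
      have := Real.floor_logb_natCast (b := 2) (r := ((m ^^^ n : ℕ) : ℝ)) (Nat.cast_nonneg _)
      rw [Int.log_natCast] at this
      exact_mod_cast this
    unfold sepLevel
    simp only
    rw [← hY, hg, hpow, Real.rpow_natCast, ← hσ, ← hj, Real.rpow_intCast, hm, hn, Int.cast_natCast,
      Int.cast_natCast, bitwiseReal_xor_natCast, h1]
    push_cast
    ring
  · rw [Ne, hiff w hwL.le]; omega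
  · rw [add_assoc, show (w : ℤ) + 1 = ((w + 1 : ℕ) : ℤ) by push_cast; ring,
      hiff (w + 1) (by push_cast; omega)]
    exact hw2

/-! ### Orders defined by hierarchies of intervals -/

/-- `R m` is, for every `m`, an equivalence relation on `ℝ` whose classes are intervals, the classes
grow with `m`, and there is a largest level at which two given numbers are in different classes. -/
structure IsHierarchy (R : ℤ → ℝ → ℝ → Prop) : Prop where
  refl : ∀ m u, R m u u
  symm : ∀ {m u v}, R m u v → R m v u
  trans : ∀ {m u v w}, R m u v → R m v w → R m u w
  mono : ∀ {m m' u v}, m ≤ m' → R m u v → R m' u v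
  convex : ∀ {m u v w}, u ≤ v → v ≤ w → R m u w → R m u v
  sep : ∀ {u v}, u ≠ v → ∃ m, ¬ R m u v ∧ R (m + 1) u v

namespace IsHierarchy

variable {R : ℤ → ℝ → ℝ → Prop} (h : IsHierarchy R)
include h

theorem lt_of_lt_of_rel {m : ℤ} {u v w : ℝ} (huv : u < v) (hn : ¬ R m u v) (hr : R m v w) :
    u < w ∧ ¬ R m u w := by
  refine ⟨?_, fun h' => hn (h.trans h' (h.symm hr))⟩
  by_contra! hc
  exact hn (h.trans (h.symm (h.convex hc huv.le (h.symm hr))) (h.symm hr))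

theorem lt_of_rel_of_lt {m : ℤ} {u v w : ℝ} (hr : R m u v) (hvw : v < w) (hn : ¬ R m v w) :
    u < w ∧ ¬ R m u w := by
  refine ⟨?_, fun h' => hn (h.trans (h.symm hr) h')⟩
  by_contra! hc
  exact hn (h.convex hvw.le hc (h.symm hr))

theorem not_rel_of_lt_of_lt {m : ℤ} {u v w : ℝ} (huv : u < v) (hvw : v < w) (hn : ¬ R m u v) :
    ¬ R m u w := fun h' => hn (h.convex huv.le hvw.le h')

theorem lt_of_not_rel {m m' : ℤ} {u v : ℝ} (hn : ¬ R m u v) (hr : R m' u v) : m < m' := by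
  by_contra! hc
  exact hn (h.mono hc hr)

end IsHierarchy

/-- Among the first `n` coordinates of `p` and `q`, the level `m` is the largest one that separates
some coordinate, and at the first coordinate separated at this level `p` is smaller than `q`. -/
def ZLtAt (R : ℕ → ℤ → ℝ → ℝ → Prop) (n : ℕ) (m : ℤ) (p q : ℕ → ℝ) : Prop :=
  ∃ c < n, p c < q c ∧ ¬ R c m (p c) (q c) ∧ (∀ a < n, R a (m + 1) (p a) (q a)) ∧
    ∀ a < c, R a m (p a) (q a)

/-- The Z-order on sequences of `n` numbers with respect to a hierarchy for each coordinate. -/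
def ZLt (R : ℕ → ℤ → ℝ → ℝ → Prop) (n : ℕ) (p q : ℕ → ℝ) : Prop := ∃ m, ZLtAt R n m p q

section ZLt

variable {R : ℕ → ℤ → ℝ → ℝ → Prop} {n : ℕ} {p q r : ℕ → ℝ} {m m' : ℤ}

theorem ZLtAt.trans (h : ∀ c, IsHierarchy (R c)) (hpq : ZLtAt R n m p q)
    (hqr : ZLtAt R n m' q r) : ZLtAt R n (max m m') p r := by
  obtain ⟨c, hc, hlt, hn, hup, hbelow⟩ := hpq
  obtain ⟨c', hc', hlt', hn', hup', hbelow'⟩ := hqr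
  rcases lt_trichotomy m m' with hm | rfl | hm
  · rw [max_eq_right hm.le]
    have hpq : ∀ a < n, R a m' (p a) (q a) := fun a ha => (h a).mono (by omega) (hup a ha)
    obtain ⟨h1, h2⟩ := (h c').lt_of_rel_of_lt (hpq c' hc') hlt' hn'
    exact ⟨c', hc', h1, h2,
      fun a ha => (h a).trans ((h a).mono (by omega) (hpq a ha)) (hup' a ha),
      fun a ha => (h a).trans (hpq a (by omega)) (hbelow' a ha)⟩
  · rw [max_self]
    have hup2 : ∀ a < n, R a (m + 1) (p a) (r a) := fun a ha =>
      (h a).trans (hup a ha) (hup' a ha)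
    rcases lt_trichotomy c c' with hcc | rfl | hcc
    · obtain ⟨h1, h2⟩ := (h c).lt_of_lt_of_rel hlt hn (hbelow' c hcc)
      exact ⟨c, hc, h1, h2, hup2, fun a ha => (h a).trans (hbelow a ha) (hbelow' a (by omega))⟩
    · exact ⟨c, hc, hlt.trans hlt', (h c).not_rel_of_lt_of_lt hlt hlt' hn, hup2,
        fun a ha => (h a).trans (hbelow a ha) (hbelow' a ha)⟩
    · obtain ⟨h1, h2⟩ := (h c').lt_of_rel_of_lt (hbelow c' hcc) hlt' hn'
      exact ⟨c', hc', h1, h2, hup2, fun a ha => (h a).trans (hbelow a (by omega)) (hbelow' a ha)⟩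
  · rw [max_eq_left hm.le]
    have hqr : ∀ a < n, R a m (q a) (r a) := fun a ha => (h a).mono (by omega) (hup' a ha)
    obtain ⟨h1, h2⟩ := (h c).lt_of_lt_of_rel hlt hn (hqr c hc)
    exact ⟨c, hc, h1, h2,
      fun a ha => (h a).trans (hup a ha) ((h a).mono (by omega) (hqr a ha)),
      fun a ha => (h a).trans (hbelow a ha) (hqr a (by omega))⟩

theorem ZLt.trans (h : ∀ c, IsHierarchy (R c)) (hpq : ZLt R n p q) (hqr : ZLt R n q r) :
    ZLt R n p r :=
  let ⟨_, h1⟩ := hpq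
  let ⟨_, h2⟩ := hqr
  ⟨_, h1.trans h h2⟩

theorem ZLt.irrefl : ¬ ZLt R n p p := fun ⟨_, _, _, h, _⟩ => lt_irrefl _ h

/-- Cells of the product hierarchy are intervals of the Z-order. -/
theorem ZLt.rel_of_between (h : ∀ c, IsHierarchy (R c)) (hpq : ZLt R n p q) (hqr : ZLt R n q r)
    (hm : ∀ a < n, R a m (p a) (r a)) :
    (∀ a < n, R a m (p a) (q a)) ∧ ∀ a < n, R a m (q a) (r a) := by
  obtain ⟨m₁, h1⟩ := hpq
  obtain ⟨m₂, h2⟩ := hqr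
  have h3 : max m₁ m₂ < m := by
    obtain ⟨c, hc, -, hn, -⟩ := h1.trans h h2
    exact (h c).lt_of_not_rel hn (hm c hc)
  obtain ⟨_, _, _, _, hup1, _⟩ := h1
  obtain ⟨_, _, _, _, hup2, _⟩ := h2
  exact ⟨fun a ha => (h a).mono (by omega) (hup1 a ha),
    fun a ha => (h a).mono (by omega) (hup2 a ha)⟩

/-- The state of a left-to-right comparison of two sequences after the first `n` coordinates: `res`
is the sign of the comparison and `best` the separating level. -/
def ZCompared (R : ℕ → ℤ → ℝ → ℝ → Prop) (n : ℕ) (p q : ℕ → ℝ) (res best : ℝ) : Prop :=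
  (res = 0 ∧ ∀ c < n, p c = q c) ∨ (res = 1 ∧ ∃ m : ℤ, best = m ∧ ZLtAt R n m p q) ∨
    (res = -1 ∧ ∃ m : ℤ, best = m ∧ ZLtAt R n m q p)

theorem ZCompared.zero (p q : ℕ → ℝ) (best : ℝ) : ZCompared R 0 p q 0 best :=
  .inl ⟨rfl, by simp⟩

theorem ZLtAt.succ_of_lt (hpq : ∀ c < n, R c (m + 1) (p c) (q c))
    (hb : ∀ c < n, R c m (p c) (q c))
    (hlt : p n < q n) (h1 : ¬ R n m (p n) (q n)) (h2 : R n (m + 1) (p n) (q n)) :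
    ZLtAt R (n + 1) m p q :=
  ⟨n, by omega, hlt, h1, fun a ha => (Nat.lt_succ_iff_lt_or_eq.1 ha).elim (hpq a)
    (fun e => e ▸ h2), hb⟩

theorem ZLtAt.succ_of_rel (hpq : ZLtAt R n m p q) (h2 : R n (m + 1) (p n) (q n)) :
    ZLtAt R (n + 1) m p q := by
  obtain ⟨c, hc, hlt, hn, hup, hb⟩ := hpq
  exact ⟨c, by omega, hlt, hn, fun a ha => (Nat.lt_succ_iff_lt_or_eq.1 ha).elim (hup a)
    (fun e => e ▸ h2), hb⟩

theorem ZCompared.succ_of_eq (h : ∀ c, IsHierarchy (R c)) {res best : ℝ}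
    (hc : ZCompared R n p q res best) (he : p n = q n) : ZCompared R (n + 1) p q res best := by
  rcases hc with ⟨h0, h1⟩ | ⟨h0, m, hm, h1⟩ | ⟨h0, m, hm, h1⟩
  · exact .inl ⟨h0, fun c hc => (Nat.lt_succ_iff_lt_or_eq.1 hc).elim (h1 c) (fun e => e ▸ he)⟩
  · exact .inr (.inl ⟨h0, m, hm, h1.succ_of_rel (he ▸ (h n).refl _ _)⟩)
  · exact .inr (.inr ⟨h0, m, hm, h1.succ_of_rel (he ▸ (h n).refl _ _)⟩)

theorem ZCompared.succ_of_le (h : ∀ c, IsHierarchy (R c)) {res best : ℝ} {l : ℤ}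
    (hc : ZCompared R n p q res best) (h0 : res ≠ 0) (hl : (l : ℝ) ≤ best)
    (h2 : R n (l + 1) (p n) (q n)) : ZCompared R (n + 1) p q res best := by
  rcases hc with ⟨h0', h1⟩ | ⟨h0, m, rfl, h1⟩ | ⟨h0, m, rfl, h1⟩
  · exact absurd h0' h0
  · have hl' : l ≤ m := by exact_mod_cast hl
    exact .inr (.inl ⟨h0, m, rfl, h1.succ_of_rel ((h n).mono (by omega) h2)⟩)
  · have hl' : l ≤ m := by exact_mod_cast hl
    exact .inr (.inr ⟨h0, m, rfl, h1.succ_of_rel ((h n).mono (by omega) ((h n).symm h2))⟩)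

theorem ZCompared.succ_of_lt (h : ∀ c, IsHierarchy (R c)) {res best : ℝ} {l : ℤ}
    (hc : ZCompared R n p q res best) (hl : res = 0 ∨ best < l) (hne : p n ≠ q n)
    (h1 : ¬ R n l (p n) (q n)) (h2 : R n (l + 1) (p n) (q n)) :
    ZCompared R (n + 1) p q (if p n < q n then 1 else -1) l := by
  have hb : ∀ c < n, R c l (p c) (q c) := by
    rcases hc with ⟨h0', h1⟩ | ⟨h0, m, rfl, h1⟩ | ⟨h0, m, rfl, h1⟩
    · exact fun c hc => h1 c hc ▸ (h c).refl _ _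
    · have hl' : m < l := by
        rcases hl with hl | hl
        · norm_num [h0] at hl
        · exact_mod_cast hl
      obtain ⟨_, _, _, _, hup, _⟩ := h1
      exact fun c hc => (h c).mono (by omega) (hup c hc)
    · have hl' : m < l := by
        rcases hl with hl | hl
        · norm_num [h0] at hl
        · exact_mod_cast hl
      obtain ⟨_, _, _, _, hup, _⟩ := h1
      exact fun c hc => (h c).mono (by omega) ((h c).symm (hup c hc))
  have hb' : ∀ c < n, R c (l + 1) (p c) (q c) := fun c hc => (h c).mono (by omega) (hb c hc)
  split_ifs with hlt
  · exact .inr (.inl ⟨rfl, l, rfl, ZLtAt.succ_of_lt hb' hb hlt h1 h2⟩)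
  · refine .inr (.inr ⟨rfl, l, rfl, ZLtAt.succ_of_lt (fun c hc => (h c).symm (hb' c hc))
      (fun c hc => (h c).symm (hb c hc)) (lt_of_le_of_ne (not_lt.1 hlt) hne.symm)
      (fun h' => h1 ((h n).symm h')) ((h n).symm h2)⟩)

theorem ZLt.trichotomy (h : ∀ c, IsHierarchy (R c)) (n : ℕ) (p q : ℕ → ℝ) :
    (∀ c < n, p c = q c) ∨ ZLt R n p q ∨ ZLt R n q p := by
  have : ∃ res best, ZCompared R n p q res best := by
    induction n with
    | zero => exact ⟨0, 0, .zero _ _ _⟩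
    | succ n ih =>
      obtain ⟨res, best, hc⟩ := ih
      by_cases he : p n = q n
      · exact ⟨_, _, hc.succ_of_eq h he⟩
      · obtain ⟨l, h1, h2⟩ := (h n).sep he
        by_cases hl : res = 0 ∨ best < l
        · exact ⟨_, _, hc.succ_of_lt h hl he h1 h2⟩
        · push Not at hl
          exact ⟨_, _, hc.succ_of_le h hl.1 hl.2 h2⟩
  obtain ⟨res, best, ⟨-, h1⟩ | ⟨-, m, -, h1⟩ | ⟨-, m, -, h1⟩⟩ := this
  · exact .inl h1
  · exact .inr (.inl ⟨m, h1⟩)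
  · exact .inr (.inr ⟨m, h1⟩)

end ZLt

/-! ### The hierarchy of cells of hyperbolic space -/

/-- The upper end of the interval of the shifted grid of scale `2 ^ l` that contains `w`. -/
noncomputable def cellTop (e i : ℕ) (l : ℤ) (w : ℝ) : ℝ :=
  2 ^ l * (gridIdx e i l w + 1 - gridShift e i l)

/-- A cell of level `l` consists of the points whose logarithmic height lies in an interval of
length `2 ^ l` of the shifted grid, and whose horizontal coordinates lie in intervals of the grid of
scale `2 ^ cellScale`. This scale grows exponentially with the height of the top of the cell, so
that the hyperbolic diameter of the cell is proportional to `2 ^ l`. -/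
noncomputable def cellScale (e i : ℕ) (l : ℤ) (w : ℝ) : ℤ := ⌊cellTop e i l w⌋ + l

/-- Two logarithmic heights are identified at the horizontal scale `2 ^ m` if they lie in the same
interval at some level whose cells have horizontal scale at most `2 ^ m`. -/
def heightRel (e i : ℕ) (m : ℤ) (u v : ℝ) : Prop :=
  u = v ∨ ∃ l, gridIdx e i l u = gridIdx e i l v ∧ cellScale e i l u ≤ m

/-- The hierarchy for the coordinate `c` of the half-space `ℍ^d`. -/
def coordRel (d e i c : ℕ) (m : ℤ) (u v : ℝ) : Prop :=
  if c < d - 1 then gridIdx e i m u = gridIdx e i m v else heightRel e i m u v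

section Cells

variable {e i : ℕ}

theorem cellScale_congr {l : ℤ} {u v : ℝ} (h : gridIdx e i l u = gridIdx e i l v) :
    cellScale e i l u = cellScale e i l v := by rw [cellScale, cellScale, cellTop, cellTop, h]

theorem lt_cellTop (l : ℤ) (w : ℝ) : w < cellTop e i l w := by
  have h := Int.lt_floor_add_one (w / (2 : ℝ) ^ l + gridShift e i l)
  change _ < (gridIdx e i l w : ℝ) + 1 at h
  have h2 : w / (2 : ℝ) ^ l < gridIdx e i l w + 1 - gridShift e i l := by linarith
  rw [div_lt_iff₀ (by positivity)] at h2
  rw [cellTop]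
  linarith

theorem cellTop_le (l : ℤ) (w : ℝ) : cellTop e i l w ≤ w + 2 ^ l := by
  have h := Int.floor_le (w / (2 : ℝ) ^ l + gridShift e i l)
  change (gridIdx e i l w : ℝ) ≤ _ at h
  have h2 : gridIdx e i l w + 1 - gridShift e i l ≤ w / (2 : ℝ) ^ l + 1 := by linarith
  have h3 := mul_le_mul_of_nonneg_left h2 (show (0 : ℝ) ≤ 2 ^ l by positivity)
  rw [cellTop]
  refine h3.trans_eq ?_
  field_simp

theorem cellTop_le_succ (he : 1 ≤ e) (l : ℤ) (w : ℝ) :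
    cellTop e i l w ≤ cellTop e i (l + 1) w := by
  obtain ⟨c, hc, h⟩ := gridIdx_succ he i l
  have hp : (0 : ℝ) < 2 ^ l := by positivity
  have h1 : gridIdx e i l w + c ≤ 2 * gridIdx e i (l + 1) w + 1 := by rw [h]; omega
  have h1' : (gridIdx e i l w : ℝ) + c ≤ 2 * gridIdx e i (l + 1) w + 1 := by exact_mod_cast h1
  rw [cellTop, cellTop, zpow_add_one₀ two_ne_zero, mul_assoc]
  refine mul_le_mul_of_nonneg_left ?_ hp.le
  linarith

theorem cellScale_strictMono (he : 1 ≤ e) (w : ℝ) : StrictMono fun l => cellScale e i l w :=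
  strictMono_int_of_lt_succ fun l => by
    have := Int.floor_le_floor (cellTop_le_succ (i := i) he l w)
    simp only [cellScale]
    omega

theorem isHierarchy_grid (he : 1 ≤ e) (hi1 : 1 ≤ i) (hi : i < 2 ^ e - 1) :
    IsHierarchy fun m u v => gridIdx e i m u = gridIdx e i m v where
  refl _ _ := rfl
  symm := Eq.symm
  trans := Eq.trans
  mono hm h := gridIdx_eq_of_le he hm h
  convex h1 h2 h := gridIdx_eq_of_between h1 h2 h
  sep h := let ⟨κ, _, h1, h2⟩ := sepLevel_spec he hi1 hi h; ⟨κ, h1, h2⟩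

/-- If `κ` is the level separating two heights, they are identified precisely from the scale of the
cells of level `κ + 1` on. -/
theorem heightRel_sep (he : 1 ≤ e) {κ : ℤ} {u v : ℝ} (h1 : gridIdx e i κ u ≠ gridIdx e i κ v)
    (h2 : gridIdx e i (κ + 1) u = gridIdx e i (κ + 1) v) :
    ¬ heightRel e i (cellScale e i (κ + 1) u - 1) u v ∧
      heightRel e i (cellScale e i (κ + 1) u - 1 + 1) u v := by
  constructor
  · rintro (rfl | ⟨l, hl, hs⟩)
    · exact h1 rfl
    · have : l < κ + 1 := by
        rw [← (cellScale_strictMono (i := i) he u).lt_iff_lt]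
        change cellScale e i l u < cellScale e i (κ + 1) u
        omega
      exact h1 (gridIdx_eq_of_le he (by omega) hl)
  · exact .inr ⟨κ + 1, h2, by omega⟩

theorem isHierarchy_heightRel (he : 1 ≤ e) (hi1 : 1 ≤ i) (hi : i < 2 ^ e - 1) :
    IsHierarchy (heightRel e i) where
  refl _ _ := .inl rfl
  symm := by
    rintro m u v (rfl | ⟨l, hl, hs⟩)
    · exact .inl rfl
    · exact .inr ⟨l, hl.symm, by rwa [← cellScale_congr hl]⟩
  trans := by
    rintro m u v w (rfl | ⟨l, hl, hs⟩) (rfl | ⟨l', hl', hs'⟩)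
    · exact .inl rfl
    · exact .inr ⟨l', hl', hs'⟩
    · exact .inr ⟨l, hl, hs⟩
    · rcases le_total l l' with h | h
      · have := gridIdx_eq_of_le he h hl
        exact .inr ⟨l', this.trans hl', by rwa [cellScale_congr this]⟩
      · exact .inr ⟨l, hl.trans (gridIdx_eq_of_le he h hl'), hs⟩
  mono := by
    rintro m m' u v hm (rfl | ⟨l, hl, hs⟩)
    · exact .inl rfl
    · exact .inr ⟨l, hl, hs.trans hm⟩
  convex := by
    rintro m u v w huv hvw (rfl | ⟨l, hl, hs⟩)
    · exact .inl (le_antisymm huv hvw)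
    · exact .inr ⟨l, gridIdx_eq_of_between huv hvw hl, hs⟩
  sep h := by
    obtain ⟨κ, -, h1, h2⟩ := sepLevel_spec he hi1 hi h
    exact ⟨_, heightRel_sep he h1 h2⟩

theorem isHierarchy_coordRel (he : 1 ≤ e) (hi1 : 1 ≤ i) (hi : i < 2 ^ e - 1) (d c : ℕ) :
    IsHierarchy (coordRel d e i c) := by
  by_cases h : c < d - 1
  · have : coordRel d e i c = fun m u v => gridIdx e i m u = gridIdx e i m v := by
      funext m u v; simp [coordRel, h]
    rw [this]; exact isHierarchy_grid he hi1 hi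
  · have : coordRel d e i c = heightRel e i := by
      funext m u v; simp [coordRel, h]
    rw [this]; exact isHierarchy_heightRel he hi1 hi

/-- The level of `heightRel` that separates two heights, as computed by the machine: `θ` is the
displacement of the grid of scale `2 ^ k`, with the exponent `-k % e` written out, and `k` is the
first level at which the heights share an interval. -/
noncomputable def heightSepLevel (e i : ℕ) (u v : ℝ) : ℝ :=
  let k : ℝ := sepLevel e i u v + 1
  let θ : ℝ := i * 2 ^ (-k - e * ⌊-k / e⌋) / (2 ^ (e : ℝ) - 1)
  ⌊(2 : ℝ) ^ k * (⌊u / 2 ^ k + θ⌋ + 1 - θ)⌋ + k - 1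

theorem heightSepLevel_spec (he : 1 ≤ e) (hi1 : 1 ≤ i) (hi : i < 2 ^ e - 1) {u v : ℝ}
    (huv : u ≠ v) : ∃ m : ℤ, heightSepLevel e i u v = m ∧ ¬ heightRel e i m u v ∧
      heightRel e i (m + 1) u v := by
  obtain ⟨κ, hκ, h1, h2⟩ := sepLevel_spec he hi1 hi huv
  refine ⟨_, ?_, heightRel_sep he h1 h2⟩
  have hk : sepLevel e i u v + 1 = ((κ + 1 : ℤ) : ℝ) := by rw [hκ]; push_cast; ring
  have hfl : ⌊-((κ + 1 : ℤ) : ℝ) / (e : ℝ)⌋ = -(κ + 1) / (e : ℤ) := by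
    rw [Int.floor_div_natCast, ← Int.cast_neg, Int.floor_intCast]
  have hθ : (i : ℝ) * 2 ^ (-((κ + 1 : ℤ) : ℝ) - e * ⌊-((κ + 1 : ℤ) : ℝ) / e⌋) / (2 ^ (e : ℝ) - 1)
      = gridShift e i (κ + 1) := by
    have : -((κ + 1 : ℤ) : ℝ) - e * ⌊-((κ + 1 : ℤ) : ℝ) / e⌋ = ((-(κ + 1) % (e : ℤ) : ℤ) : ℝ) := by
      rw [hfl, Int.emod_def]; push_cast; ring
    rw [this, Real.rpow_intCast, Real.rpow_natCast, gridShift]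
  unfold heightSepLevel
  simp only
  rw [hk, hθ, Real.rpow_intCast]
  change ((⌊cellTop e i (κ + 1) u⌋ : ℤ) : ℝ) + _ - 1 = _
  rw [cellScale]
  push_cast
  ring

/-- The separating level for the coordinate `c` of the half-space `ℍ^d`. -/
noncomputable def coordSepLevel (d e i c : ℕ) (u v : ℝ) : ℝ :=
  if c < d - 1 then sepLevel e i u v else heightSepLevel e i u v

theorem coordSepLevel_spec (he : 1 ≤ e) (hi1 : 1 ≤ i) (hi : i < 2 ^ e - 1) (d c : ℕ) {u v : ℝ}
    (huv : u ≠ v) : ∃ m : ℤ, coordSepLevel d e i c u v = m ∧ ¬ coordRel d e i c m u v ∧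
      coordRel d e i c (m + 1) u v := by
  unfold coordSepLevel coordRel
  split_ifs
  · exact sepLevel_spec he hi1 hi huv
  · exact heightSepLevel_spec he hi1 hi huv

end Cells

/-- The coordinates of a point, with the height replaced by its binary logarithm. -/
noncomputable def HPoint.key {d : ℕ} (p : HPoint d) (c : ℕ) : ℝ :=
  if c < d - 1 then p.coord c else Real.logb 2 (p.coord c)

theorem HPoint.coord_last {d : ℕ} (p : HPoint d) : p.coord (d - 1) = p.z := by
  simp [HPoint.coord]

theorem HPoint.ext_coord {d : ℕ} (hd : 1 ≤ d) {p q : HPoint d}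
    (h : ∀ c < d, p.coord c = q.coord c) : p = q := by
  ext c
  · have := h c (by omega)
    simpa [HPoint.coord, c.2] using this
  · simpa [HPoint.coord_last] using h (d - 1) (by omega)

theorem HPoint.key_eq_iff {d : ℕ} (p q : HPoint d) {c : ℕ} (hc : c < d) :
    p.key c = q.key c ↔ p.coord c = q.coord c := by
  unfold HPoint.key
  split_ifs with h
  · rfl
  · obtain rfl : c = d - 1 := by omega
    rw [HPoint.coord_last, HPoint.coord_last]
    exact (Real.logb_injOn_pos one_lt_two).eq_iff p.z_pos q.z_pos

/-- The number of bits of the denominator `2 ^ e - 1` of the displacements in dimension `d`. -/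
def shiftBits (d : ℕ) : ℕ := Nat.log 2 d + 2

theorem one_le_shiftBits (d : ℕ) : 1 ≤ shiftBits d := by unfold shiftBits; omega

theorem lt_two_pow_shiftBits {d i : ℕ} (hd : 1 ≤ d) (hi : i ≤ d + 1) :
    i < 2 ^ shiftBits d - 1 := by
  have h : d < 2 ^ (Nat.log 2 d + 1) := Nat.lt_pow_succ_log_self one_lt_two d
  have : 2 ^ shiftBits d = 2 * 2 ^ (Nat.log 2 d + 1) := by
    rw [shiftBits]; ring
  omega

theorem two_pow_shiftBits_le {d : ℕ} (hd : 1 ≤ d) : 2 ^ shiftBits d ≤ 4 * d := by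
  have h : 2 ^ Nat.log 2 d ≤ d := Nat.pow_log_le_self 2 (by omega)
  rw [shiftBits, pow_add]
  omega

/-- The `i`-th linear order on `ℍ^d`: the Z-order of the `i`-th shifted hierarchy of cells. -/
def HLt {d : ℕ} (i : ℕ) (p q : HPoint d) : Prop :=
  ZLt (coordRel d (shiftBits d) i) d p.key q.key

/-- The points `p` and `q` lie in the same cell of horizontal scale `2 ^ m`. -/
def SameCell {d : ℕ} (i : ℕ) (m : ℤ) (p q : HPoint d) : Prop :=
  ∀ c < d, coordRel d (shiftBits d) i c m (p.key c) (q.key c)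

section HLt

variable {d i : ℕ} {p q r : HPoint d}

theorem isHierarchy_coordRel_shiftBits (hd : 1 ≤ d) (hi1 : 1 ≤ i) (hi : i ≤ d + 1) (c : ℕ) :
    IsHierarchy (coordRel d (shiftBits d) i c) :=
  isHierarchy_coordRel (one_le_shiftBits d) hi1 (lt_two_pow_shiftBits hd hi) d c

theorem HLt.irrefl : ¬ HLt i p p := ZLt.irrefl

theorem HLt.trans (hd : 1 ≤ d) (hi1 : 1 ≤ i) (hi : i ≤ d + 1) (h : HLt i p q) (h' : HLt i q r) :
    HLt i p r := ZLt.trans (isHierarchy_coordRel_shiftBits hd hi1 hi) h h'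

theorem HLt.asymm (hd : 1 ≤ d) (hi1 : 1 ≤ i) (hi : i ≤ d + 1) (h : HLt i p q) : ¬ HLt i q p :=
  fun h' => HLt.irrefl (h.trans hd hi1 hi h')

theorem HLt.trichotomy (hd : 1 ≤ d) (hi1 : 1 ≤ i) (hi : i ≤ d + 1) (p q : HPoint d) :
    p = q ∨ HLt i p q ∨ HLt i q p := by
  rcases ZLt.trichotomy (isHierarchy_coordRel_shiftBits hd hi1 hi) d p.key q.key with h | h
  · exact .inl (HPoint.ext_coord hd fun c hc => (HPoint.key_eq_iff p q hc).1 (h c hc))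
  · exact .inr h

/-- Cells are intervals of the order. -/
theorem SameCell.of_between (hd : 1 ≤ d) (hi1 : 1 ≤ i) (hi : i ≤ d + 1) {m : ℤ} (hpq : HLt i p q)
    (hqr : HLt i q r) (h : SameCell i m p r) : SameCell i m p q ∧ SameCell i m q r :=
  ZLt.rel_of_between (isHierarchy_coordRel_shiftBits hd hi1 hi) hpq hqr h

theorem SameCell.symm (hd : 1 ≤ d) (hi1 : 1 ≤ i) (hi : i ≤ d + 1) {m : ℤ} (h : SameCell i m p q) :
    SameCell i m q p :=
  fun c hc => (isHierarchy_coordRel_shiftBits hd hi1 hi c).symm (h c hc)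

end HLt

/-! ### Hyperbolic distances -/

section Hyperbolic

variable {d : ℕ}

/-- The quotient in the formula for the hyperbolic distance, in terms of coordinates. -/
noncomputable def sqRatio (p q : HPoint d) : ℝ :=
  (∑ j ∈ Finset.range d, (p.coord j - q.coord j) * (p.coord j - q.coord j)) / (p.z * q.z)

theorem sum_coord_sub_sq (hd : 1 ≤ d) (p q : HPoint d) :
    ∑ j ∈ Finset.range d, (p.coord j - q.coord j) * (p.coord j - q.coord j) =
      ‖p.x - q.x‖ ^ 2 + (p.z - q.z) ^ 2 := by
  have h : Finset.range d = Finset.range ((d - 1) + 1) := by rw [Nat.sub_add_cancel hd]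
  rw [EuclideanSpace.norm_sq_eq, h, Finset.sum_range_succ, Finset.sum_range, HPoint.coord_last,
    HPoint.coord_last, ← pow_two]
  congr 1
  refine Finset.sum_congr rfl fun j _ => ?_
  simp [HPoint.coord, ← pow_two]

theorem hdist_eq_sqRatio (hd : 1 ≤ d) (p q : HPoint d) :
    hdist p q = 2 * Real.arsinh (1 / 2 * Real.sqrt (sqRatio p q)) := by
  rw [hdist, sqRatio, sum_coord_sub_sq hd]

theorem hdist_le_hdist_of_sqRatio_le (hd : 1 ≤ d) {p q p' q' : HPoint d}
    (h : sqRatio p q ≤ sqRatio p' q') : hdist p q ≤ hdist p' q' := by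
  rw [hdist_eq_sqRatio hd, hdist_eq_sqRatio hd]
  have := Real.arsinh_le_arsinh.2
    (mul_le_mul_of_nonneg_left (Real.sqrt_le_sqrt h) (by norm_num : (0 : ℝ) ≤ 1 / 2))
  linarith

theorem hdist_self (p : HPoint d) : hdist p p = 0 := by simp [hdist]

theorem hdist_comm (p q : HPoint d) : hdist p q = hdist q p := by
  rw [hdist, hdist, norm_sub_rev, ← neg_sub p.z, neg_sq, mul_comm p.z]

theorem hdist_nonneg (p q : HPoint d) : 0 ≤ hdist p q := by
  have : 0 ≤ Real.arsinh (1 / 2 * Real.sqrt ((‖p.x - q.x‖ ^ 2 + (p.z - q.z) ^ 2) / (p.z * q.z))) :=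
    Real.arsinh_nonneg_iff.2 (by positivity)
  rw [hdist]
  positivity

theorem sinh_half_hdist (p q : HPoint d) : Real.sinh (hdist p q / 2) =
    1 / 2 * Real.sqrt ((‖p.x - q.x‖ ^ 2 + (p.z - q.z) ^ 2) / (p.z * q.z)) := by
  rw [hdist, mul_div_cancel_left₀ _ two_ne_zero, Real.sinh_arsinh]

theorem hdist_pos {p q : HPoint d} (h : p ≠ q) : 0 < hdist p q := by
  refine lt_of_le_of_ne (hdist_nonneg p q) fun h0 => h ?_
  have h1 := sinh_half_hdist p q
  have hz : 0 < p.z * q.z := mul_pos p.z_pos q.z_pos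
  rw [← h0, zero_div, Real.sinh_zero, eq_comm, mul_eq_zero, or_iff_right (by norm_num),
    Real.sqrt_eq_zero (by positivity), div_eq_zero_iff, or_iff_left hz.ne'] at h1
  have h2 : ‖p.x - q.x‖ ^ 2 = 0 := by nlinarith [sq_nonneg ‖p.x - q.x‖, sq_nonneg (p.z - q.z)]
  have h3 : (p.z - q.z) ^ 2 = 0 := by nlinarith [sq_nonneg ‖p.x - q.x‖, sq_nonneg (p.z - q.z)]
  have h4 : p.x = q.x := by simpa [sub_eq_zero] using h2
  have h5 : p.z = q.z := by simpa [sub_eq_zero] using h3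
  ext1
  exacts [h4, h5]

/-- The vertical part of the formula for the distance. -/
theorem sinh_half_log_sub (p q : HPoint d) :
    Real.sinh ((Real.log p.z - Real.log q.z) / 2) = (p.z - q.z) / (2 * Real.sqrt (p.z * q.z)) := by
  have hp := p.z_pos
  have hq := q.z_pos
  have ha : 0 < Real.sqrt p.z := Real.sqrt_pos.2 hp
  have hb : 0 < Real.sqrt q.z := Real.sqrt_pos.2 hq
  have h1 : (Real.log p.z - Real.log q.z) / 2 = Real.log (Real.sqrt p.z / Real.sqrt q.z) := by
    rw [Real.log_div ha.ne' hb.ne', Real.log_sqrt hp.le, Real.log_sqrt hq.le]; ring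
  rw [h1, Real.sinh_log (div_pos ha hb), Real.sqrt_mul hp.le]
  have e1 := Real.sq_sqrt hp.le
  have e2 := Real.sq_sqrt hq.le
  field_simp
  rw [e1, e2]

theorem abs_log_sub_le_hdist (p q : HPoint d) : |Real.log p.z - Real.log q.z| ≤ hdist p q := by
  have hz : 0 < p.z * q.z := mul_pos p.z_pos q.z_pos
  have h1 : Real.sinh (|Real.log p.z - Real.log q.z| / 2) ≤ Real.sinh (hdist p q / 2) := by
    have : |Real.log p.z - Real.log q.z| / 2 = |(Real.log p.z - Real.log q.z) / 2| := by
      rw [abs_div, abs_two]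
    rw [this, ← Real.abs_sinh, sinh_half_log_sub, sinh_half_hdist, Real.sqrt_div' _ hz.le, abs_div,
      abs_of_pos (by positivity : 0 < 2 * Real.sqrt (p.z * q.z)), ← Real.sqrt_sq_eq_abs]
    rw [div_le_iff₀ (by positivity)]
    have hs := Real.sqrt_pos.2 hz
    calc Real.sqrt ((p.z - q.z) ^ 2) ≤ Real.sqrt (‖p.x - q.x‖ ^ 2 + (p.z - q.z) ^ 2) :=
          Real.sqrt_le_sqrt (by nlinarith [sq_nonneg ‖p.x - q.x‖])
      _ = _ := by field_simp
  have := Real.sinh_le_sinh.1 h1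
  linarith

theorem norm_sub_le_of_hdist (p q : HPoint d) :
    ‖p.x - q.x‖ ≤ 2 * Real.sinh (hdist p q / 2) * Real.sqrt (p.z * q.z) := by
  have hz : 0 < p.z * q.z := mul_pos p.z_pos q.z_pos
  have hs := Real.sqrt_pos.2 hz
  rw [sinh_half_hdist, Real.sqrt_div' _ hz.le]
  calc ‖p.x - q.x‖ ≤ Real.sqrt (‖p.x - q.x‖ ^ 2 + (p.z - q.z) ^ 2) :=
        Real.le_sqrt_of_sq_le (by nlinarith [sq_nonneg (p.z - q.z)])
    _ = _ := by field_simp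

theorem sinh_le_mul_exp {s : ℝ} : Real.sinh s ≤ s * Real.exp s := by
  have h1 := Real.add_one_le_exp (-(2 * s))
  have h2 : Real.exp (-s) = Real.exp s * Real.exp (-(2 * s)) := by rw [← Real.exp_add]; ring_nf
  have h3 := Real.exp_pos s
  rw [Real.sinh_eq, h2]
  nlinarith

theorem mul_exp_le_sinh_two_mul {a : ℝ} (ha : 0 ≤ a) : a * Real.exp a ≤ Real.sinh (2 * a) := by
  have h1 : a ≤ Real.sinh a := Real.self_le_sinh_iff.2 ha
  have h2 : Real.exp a / 2 ≤ Real.cosh a := by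
    rw [Real.cosh_eq]; have := Real.exp_pos (-a); linarith
  have h3 := Real.exp_pos a
  rw [Real.sinh_two_mul]
  nlinarith [mul_le_mul h1 h2 (by positivity) (ha.trans h1)]

theorem sinh_add_le {a b : ℝ} (ha : 0 ≤ a) (hb : 0 ≤ b) :
    Real.sinh a + Real.sinh b ≤ Real.sinh (a + b) := by
  rw [Real.sinh_add]
  nlinarith [Real.one_le_cosh a, Real.one_le_cosh b, Real.sinh_nonneg_iff.2 ha,
    Real.sinh_nonneg_iff.2 hb]

theorem two_rpow_le_exp {t : ℝ} (ht : 0 ≤ t) : (2 : ℝ) ^ t ≤ Real.exp t := by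
  rw [Real.rpow_def_of_pos two_pos]
  exact Real.exp_le_exp.2 (by nlinarith [Real.log_two_lt_d9])

theorem HPoint.key_last (p : HPoint d) : p.key (d - 1) = Real.logb 2 p.z := by
  simp [HPoint.key, HPoint.coord_last]

theorem HPoint.key_of_lt (p : HPoint d) {c : ℕ} (hc : c < d - 1) : p.key c = p.x ⟨c, hc⟩ := by
  simp [HPoint.key, HPoint.coord, hc]

theorem HPoint.two_rpow_key (p : HPoint d) : (2 : ℝ) ^ p.key (d - 1) = p.z := by
  rw [p.key_last, Real.rpow_logb two_pos (by norm_num) p.z_pos]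

theorem abs_log_sub_eq_key (p q : HPoint d) : |Real.log p.z - Real.log q.z| =
    Real.log 2 * |p.key (d - 1) - q.key (d - 1)| := by
  have h2 : 0 < Real.log 2 := Real.log_pos one_lt_two
  rw [p.key_last, q.key_last, Real.logb, Real.logb, ← sub_div, abs_div, abs_of_pos h2,
    mul_div_cancel₀ _ h2.ne']

/-- Two points whose logarithmic heights differ by at most `t` and whose horizontal coordinates
differ by at most `t 2 ^ t` times the height of the lower point have distance `O(√d t)`. -/
theorem hdist_le_of_coord_close (hd : 1 ≤ d) {p q : HPoint d} {t : ℝ} (ht : 0 ≤ t)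
    (hkey : |p.key (d - 1) - q.key (d - 1)| ≤ t)
    (hx : ∀ c, |p.x c - q.x c| ≤ t * 2 ^ t * min p.z q.z) :
    hdist p q ≤ 5 * Real.sqrt d * t := by
  have hz : 0 < p.z * q.z := mul_pos p.z_pos q.z_pos
  have hs := Real.sqrt_pos.2 hz
  have hd1 : (1 : ℝ) ≤ d := by exact_mod_cast hd
  have hsd : 1 ≤ Real.sqrt d := Real.one_le_sqrt.2 hd1
  have hmin : 0 < min p.z q.z := lt_min p.z_pos q.z_pos
  have hmin2 : min p.z q.z ≤ Real.sqrt (p.z * q.z) :=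
    Real.le_sqrt_of_sq_le (by
      rw [pow_two]
      exact mul_le_mul (min_le_left _ _) (min_le_right _ _) hmin.le p.z_pos.le)
  have hT : 0 ≤ t * 2 ^ t := by positivity
  have hnorm : ‖p.x - q.x‖ ≤ Real.sqrt d * (t * 2 ^ t * Real.sqrt (p.z * q.z)) := by
    rw [EuclideanSpace.norm_eq, ← Real.sqrt_sq (show 0 ≤ t * 2 ^ t * Real.sqrt (p.z * q.z) by
      positivity), ← Real.sqrt_mul (by positivity)]
    refine Real.sqrt_le_sqrt ?_
    calc ∑ c, ‖(p.x - q.x) c‖ ^ 2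
        ≤ ∑ _c : Fin (d - 1), (t * 2 ^ t * Real.sqrt (p.z * q.z)) ^ 2 := by
          refine Finset.sum_le_sum fun c _ => ?_
          refine pow_le_pow_left₀ (norm_nonneg _) ?_ 2
          have h1 := hx c
          rw [PiLp.sub_apply, Real.norm_eq_abs]
          exact h1.trans (mul_le_mul_of_nonneg_left hmin2 hT)
      _ = ((d - 1 : ℕ) : ℝ) * (t * 2 ^ t * Real.sqrt (p.z * q.z)) ^ 2 := by simp
      _ ≤ _ := by
          refine mul_le_mul_of_nonneg_right ?_ (sq_nonneg _)
          exact_mod_cast Nat.sub_le d 1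
  set δ := |Real.log p.z - Real.log q.z| with hδ
  have hδ0 : 0 ≤ δ := abs_nonneg _
  have hδt : δ ≤ t := by
    rw [hδ, abs_log_sub_eq_key]
    nlinarith [Real.log_two_lt_d9, Real.log_two_gt_d9, abs_nonneg (p.key (d - 1) - q.key (d - 1))]
  have hB : |p.z - q.z| / (2 * Real.sqrt (p.z * q.z)) = Real.sinh (δ / 2) := by
    have h1 : δ / 2 = |(Real.log p.z - Real.log q.z) / 2| := by rw [abs_div, abs_two]
    rw [h1, ← Real.abs_sinh, sinh_half_log_sub, abs_div,
      abs_of_pos (by positivity : 0 < 2 * Real.sqrt (p.z * q.z))]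
  set a := Real.sqrt d * t with ha
  have ha0 : 0 ≤ a := by positivity
  have hta : t ≤ a := by nlinarith
  have hA : ‖p.x - q.x‖ / (2 * Real.sqrt (p.z * q.z)) ≤ Real.sinh (2 * a) := by
    rw [div_le_iff₀ (by positivity)]
    have h1 : (2 : ℝ) ^ t ≤ Real.exp a := (two_rpow_le_exp ht).trans (Real.exp_le_exp.2 hta)
    have h2 := mul_exp_le_sinh_two_mul ha0
    have h3 : a * 2 ^ t ≤ Real.sinh (2 * a) := (mul_le_mul_of_nonneg_left h1 ha0).trans h2
    have h4 : ‖p.x - q.x‖ ≤ a * 2 ^ t * Real.sqrt (p.z * q.z) := by rw [ha]; linarith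
    nlinarith [mul_le_mul_of_nonneg_right h3 hs.le, h4,
      Real.sinh_nonneg_iff.2 (by positivity : 0 ≤ 2 * a)]
  have hmain : Real.sinh (hdist p q / 2) ≤ Real.sinh (2 * a + δ / 2) := by
    refine le_trans ?_ (sinh_add_le (by positivity) (by positivity))
    refine le_trans ?_ (add_le_add hA hB.le)
    rw [sinh_half_hdist, Real.sqrt_div' _ hz.le, ← add_div, le_div_iff₀ (by positivity)]
    have h1 : Real.sqrt (‖p.x - q.x‖ ^ 2 + (p.z - q.z) ^ 2) ≤ ‖p.x - q.x‖ + |p.z - q.z| := by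
      refine Real.sqrt_le_iff.2 ⟨by positivity, ?_⟩
      nlinarith [sq_abs (p.z - q.z), mul_nonneg (norm_nonneg (p.x - q.x)) (abs_nonneg (p.z - q.z))]
    calc _ = Real.sqrt (‖p.x - q.x‖ ^ 2 + (p.z - q.z) ^ 2) := by field_simp
      _ ≤ _ := h1
  have := Real.sinh_le_sinh.1 hmain
  nlinarith

/-- Cells of level `l` have diameter `O(√d 2 ^ l)`. -/
theorem SameCell.hdist_le (hd : 1 ≤ d) {i : ℕ} {l : ℤ} {p q : HPoint d}
    (h : SameCell i (cellScale (shiftBits d) i l (p.key (d - 1))) p q) :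
    hdist p q ≤ 5 * Real.sqrt d * 2 ^ l := by
  set e := shiftBits d
  have he : 1 ≤ e := one_le_shiftBits d
  have hl : gridIdx e i l (p.key (d - 1)) = gridIdx e i l (q.key (d - 1)) := by
    have h1 := h (d - 1) (by omega)
    rw [coordRel, if_neg (lt_irrefl _)] at h1
    rcases h1 with h1 | ⟨l', h1, h2⟩
    · rw [h1]
    · exact gridIdx_eq_of_le he ((cellScale_strictMono he _).le_iff_le.1 h2) h1
  have ht : (0 : ℝ) < 2 ^ l := by positivity
  refine hdist_le_of_coord_close hd ht.le (abs_sub_lt_of_gridIdx_eq hl).le fun c => ?_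
  have h1 := h c (by omega)
  rw [coordRel, if_pos c.2, p.key_of_lt c.2, q.key_of_lt c.2] at h1
  refine (abs_sub_lt_of_gridIdx_eq h1).le.trans ?_
  set k := cellScale e i l (p.key (d - 1)) with hk
  have hbound : ∀ r : HPoint d, k = cellScale e i l (r.key (d - 1)) →
      (2 : ℝ) ^ k ≤ 2 ^ l * 2 ^ ((2 : ℝ) ^ l) * r.z := by
    intro r hr
    have h2 : (k : ℝ) ≤ r.key (d - 1) + 2 ^ l + l := by
      rw [hr, cellScale]
      push_cast
      have := Int.floor_le (cellTop e i l (r.key (d - 1)))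
      have := cellTop_le (e := e) (i := i) l (r.key (d - 1))
      linarith
    calc (2 : ℝ) ^ k = (2 : ℝ) ^ (k : ℝ) := (Real.rpow_intCast _ _).symm
      _ ≤ (2 : ℝ) ^ (r.key (d - 1) + 2 ^ l + l) := Real.rpow_le_rpow_of_exponent_le one_le_two h2
      _ = _ := by
        rw [Real.rpow_add two_pos, Real.rpow_add two_pos, r.two_rpow_key, Real.rpow_intCast]; ring
  have h3 := hbound p rfl
  have h4 := hbound q (cellScale_congr hl)
  rcases le_total p.z q.z with h5 | h5
  · rwa [min_eq_left h5]
  · rwa [min_eq_right h5]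

/-- A version of `eq_of_gridIdx_ne` for unordered pairs. -/
theorem eq_of_gridIdx_ne_abs {e : ℕ} (he : 1 ≤ e) {i i' : ℕ} (hi : i < 2 ^ e - 1)
    (hi' : i' < 2 ^ e - 1) {k : ℤ} {x y : ℝ} (hlt : |x - y| < 2 ^ k / (2 ^ e - 1))
    (h : gridIdx e i k x ≠ gridIdx e i k y) (h' : gridIdx e i' k x ≠ gridIdx e i' k y) :
    i = i' := by
  rcases le_total x y with hxy | hxy
  · rw [abs_sub_comm, abs_of_nonneg (by linarith)] at hlt
    exact eq_of_gridIdx_ne he hi hi' hxy hlt h h'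
  · rw [abs_of_nonneg (by linarith)] at hlt
    exact eq_of_gridIdx_ne he hi hi' hxy hlt h.symm h'.symm

/-- For two points at distance `r`, one of the `d + 1` shifted hierarchies has a cell of size
`O(d r)` that contains both: each of the `d` coordinates spoils at most one shift. -/
theorem exists_sameCell (hd : 1 ≤ d) {p q : HPoint d} (hpq : p ≠ q) :
    ∃ i, 1 ≤ i ∧ i ≤ d + 1 ∧ ∃ l : ℤ, (2 : ℝ) ^ l ≤ 32 * d * hdist p q ∧
      SameCell i (cellScale (shiftBits d) i l (p.key (d - 1))) p q := by
  set e := shiftBits d with he_def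
  have he : 1 ≤ e := one_le_shiftBits d
  set r := hdist p q with hr
  have hr0 : 0 < r := hdist_pos hpq
  have he2 : (1 : ℝ) < 2 ^ e := one_lt_pow₀ one_lt_two (by omega)
  set D : ℝ := 2 ^ e - 1 with hD
  have hD0 : 0 < D := by linarith
  have hD4 : D ≤ 4 * d := by
    have := two_pow_shiftBits_le hd
    have h2 : ((2 ^ e : ℕ) : ℝ) ≤ ((4 * d : ℕ) : ℝ) := by exact_mod_cast this
    push_cast at h2
    linarith
  -- intervals of length `2 ^ l / D` are longer than `4 r`
  set l : ℤ := ⌊Real.logb 2 (8 * D * r)⌋ with hl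
  have hpos : 0 < 8 * D * r := by positivity
  have hl1 : (2 : ℝ) ^ l ≤ 8 * D * r := by
    have := Int.floor_le (Real.logb 2 (8 * D * r))
    rwa [← hl, Real.le_logb_iff_rpow_le one_lt_two hpos, Real.rpow_intCast] at this
  have hl2 : 4 * D * r < 2 ^ l := by
    have := Int.lt_floor_add_one (Real.logb 2 (8 * D * r))
    rw [← hl, Real.logb_lt_iff_lt_rpow one_lt_two hpos] at this
    have e1 : (2 : ℝ) ^ ((l : ℝ) + 1) = 2 ^ l * 2 := by
      rw [Real.rpow_add two_pos, Real.rpow_intCast, Real.rpow_one]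
    rw [e1] at this
    linarith
  set u := p.key (d - 1) with hu
  set v := q.key (d - 1) with hv
  -- The heights are required to share their interval with `top`. The reserve `r` above them
  -- raises the horizontal scale of the cell by the factor `2 ^ r`, which horizontal
  -- displacements at distance `r` need.
  set top := max u v + r with htop
  set k : ℤ := ⌊top⌋ + l with hk
  have huv : |u - v| ≤ 2 * r := by
    have h1 := abs_log_sub_le_hdist p q
    rw [abs_log_sub_eq_key] at h1
    have := Real.log_two_gt_d9
    nlinarith [abs_nonneg (p.key (d - 1) - q.key (d - 1))]
  have hvert : |min u v - top| < 2 ^ l / (2 ^ e - 1) := by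
    rw [lt_div_iff₀ hD0, abs_sub_comm, abs_of_nonneg (by
      have := min_le_max (a := u) (b := v); linarith)]
    have : max u v - min u v ≤ 2 * r := by rw [max_sub_min_eq_abs']; exact huv
    have : top - min u v ≤ 3 * r := by rw [htop]; linarith
    change _ * D < _
    nlinarith
  have hhor : ∀ c, |p.x c - q.x c| < 2 ^ k / (2 ^ e - 1) := by
    intro c
    have hz : p.z * q.z ≤ (2 ^ max u v) ^ 2 := by
      rw [pow_two, ← p.two_rpow_key, ← q.two_rpow_key]
      exact mul_le_mul (Real.rpow_le_rpow_of_exponent_le one_le_two (le_max_left _ _))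
        (Real.rpow_le_rpow_of_exponent_le one_le_two (le_max_right _ _)) (by positivity)
        (by positivity)
    have hW : (0 : ℝ) < 2 ^ max u v := by positivity
    have h1 : |p.x c - q.x c| ≤ ‖p.x - q.x‖ := by
      have := PiLp.norm_apply_le (p.x - q.x) c
      rwa [PiLp.sub_apply, Real.norm_eq_abs] at this
    have h2 := norm_sub_le_of_hdist p q
    have h3 : Real.sqrt (p.z * q.z) ≤ 2 ^ max u v := Real.sqrt_le_iff.2 ⟨hW.le, hz⟩
    have h4 : 2 * Real.sinh (r / 2) ≤ r * 2 ^ r := by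
      have e1 := sinh_le_mul_exp (s := r / 2)
      have e2 : Real.exp (r / 2) ≤ 2 ^ r := by
        rw [Real.rpow_def_of_pos two_pos]
        exact Real.exp_le_exp.2 (by nlinarith [Real.log_two_gt_d9])
      have e3 := mul_le_mul_of_nonneg_left e2 hr0.le
      linarith
    have h5 : 0 ≤ 2 * Real.sinh (r / 2) := by
      have := Real.sinh_nonneg_iff.2 (by positivity : 0 ≤ r / 2)
      linarith
    have h6 : |p.x c - q.x c| ≤ r * 2 ^ r * 2 ^ max u v :=
      (h1.trans h2).trans (mul_le_mul h4 h3 (Real.sqrt_nonneg _) (h5.trans h4))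
    have h7 : 2 ^ max u v * 2 ^ r * 2 ^ l < 2 * (2 : ℝ) ^ k := by
      have e1 : (2 : ℝ) ^ k = 2 ^ ((⌊top⌋ : ℤ) : ℝ) * 2 ^ l := by
        rw [hk, zpow_add₀ two_ne_zero, Real.rpow_intCast]
      have e2 : (2 : ℝ) ^ top < 2 ^ ((⌊top⌋ : ℝ) + 1) :=
        Real.rpow_lt_rpow_of_exponent_lt one_lt_two (Int.lt_floor_add_one top)
      rw [htop, Real.rpow_add two_pos, Real.rpow_add two_pos, Real.rpow_one, ← htop] at e2
      have e3 : (0 : ℝ) < 2 ^ l := by positivity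
      rw [e1]
      nlinarith
    rw [lt_div_iff₀ hD0]
    have h8 : (0 : ℝ) < 2 ^ r * 2 ^ max u v := by positivity
    have h9 := mul_lt_mul_of_pos_left hl2 h8
    have h10 := mul_le_mul_of_nonneg_right h6 hD0.le
    change _ * D < _
    nlinarith
  -- a shift is bad for a coordinate if it separates the points in this coordinate
  let bad : ℕ → ℕ → Prop := fun i c => if h : c < d - 1 then
    gridIdx e i k (p.x ⟨c, h⟩) ≠ gridIdx e i k (q.x ⟨c, h⟩) else
    gridIdx e i l (min u v) ≠ gridIdx e i l top
  have hbad : ∀ i i' c, i ≤ d + 1 → i' ≤ d + 1 → bad i c → bad i' c → i = i' := by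
    intro i i' c hi hi' h h'
    by_cases hc : c < d - 1
    · simp only [bad, dif_pos hc] at h h'
      exact eq_of_gridIdx_ne_abs he (lt_two_pow_shiftBits hd hi) (lt_two_pow_shiftBits hd hi')
        (hhor _) h h'
    · simp only [bad, dif_neg hc] at h h'
      exact eq_of_gridIdx_ne_abs he (lt_two_pow_shiftBits hd hi) (lt_two_pow_shiftBits hd hi')
        hvert h h'
  obtain ⟨i, hi1, hi2, hgood⟩ : ∃ i, 1 ≤ i ∧ i ≤ d + 1 ∧ ∀ c < d, ¬ bad i c := by
    by_contra! hcon
    choose! c hc hcb using hcon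
    obtain ⟨i, hi, i', hi', hne, heq⟩ := Finset.exists_ne_map_eq_of_card_lt_of_maps_to
      (s := Finset.Icc 1 (d + 1)) (t := Finset.range d) (f := c) (by simp)
      (fun i hi => by
        have := Finset.mem_Icc.1 hi
        exact Finset.mem_coe.2 (Finset.mem_range.2 (hc i this.1 this.2)))
    rw [Finset.mem_Icc] at hi hi'
    exact hne (hbad i i' (c i) hi.2 hi'.2 (hcb i hi.1 hi.2) (heq ▸ hcb i' hi'.1 hi'.2))
  refine ⟨i, hi1, hi2, l, hl1.trans (by nlinarith), ?_⟩
  have hvert' : gridIdx e i l (min u v) = gridIdx e i l top := by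
    have := hgood (d - 1) (by omega)
    simpa [bad] using this
  have hmt : ∀ w, min u v ≤ w → w ≤ max u v → gridIdx e i l w = gridIdx e i l top := fun w h1 h2 =>
    (gridIdx_eq_of_between h1 (by linarith) hvert').symm.trans hvert'
  have hu' := hmt u (min_le_left _ _) (le_max_left _ _)
  have hv' := hmt v (min_le_right _ _) (le_max_right _ _)
  intro c hc
  by_cases hcd : c < d - 1
  · rw [coordRel, if_pos hcd, p.key_of_lt hcd, q.key_of_lt hcd]
    have h1 := hgood c hc
    simp only [bad, dif_pos hcd, not_not] at h1
    refine gridIdx_eq_of_le he ?_ h1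
    rw [cellScale_congr hu', cellScale, hk]
    have := Int.floor_le_floor (lt_cellTop (e := e) (i := i) l top).le
    omega
  · obtain rfl : c = d - 1 := by omega
    rw [coordRel, if_neg hcd]
    exact .inr ⟨l, hu'.trans hv'.symm, le_rfl⟩

/-- For any two points, one of the `d + 1` shifted hierarchies has a cell that contains both and
all of whose points are within `O(d √d)` times the distance of the two points. -/
theorem exists_shift (hd : 1 ≤ d) {p q : HPoint d} (hpq : p ≠ q) :
    ∃ i, 1 ≤ i ∧ i ≤ d + 1 ∧ ∃ m : ℤ, SameCell i m p q ∧
      ∀ r, SameCell i m p r → hdist p r ≤ 160 * (d * Real.sqrt d) * hdist p q := by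
  obtain ⟨i, h1, h2, l, hl, h⟩ := exists_sameCell hd hpq
  refine ⟨i, h1, h2, _, h, fun r hr => (hr.hdist_le hd).trans ?_⟩
  have := mul_le_mul_of_nonneg_left hl (by positivity : 0 ≤ 5 * Real.sqrt d)
  linarith

end Hyperbolic

/-! ### Terms -/

namespace Term

instance : Add Term := ⟨.bin .add⟩
instance : Sub Term := ⟨.bin .sub⟩
instance : Mul Term := ⟨.bin .mul⟩
instance : Div Term := ⟨.bin .div⟩
instance (n : ℕ) : OfNat Term n := ⟨.const n⟩

/-- The term `⌊a⌋`. -/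
def floor (a : Term) : Term := .un .floor a
/-- The term `log₂ a`. -/
def log (a : Term) : Term := .un .log a
/-- The term `2 ^ a`. -/
def pow2 (a : Term) : Term := .un .pow2 a

variable (s : Store) (a b : Term) (M : ℕ)

@[simp] theorem eval_add : (a + b).eval s = a.eval s + b.eval s := rfl
@[simp] theorem eval_sub : (a - b).eval s = a.eval s - b.eval s := rfl
@[simp] theorem eval_mul : (a * b).eval s = a.eval s * b.eval s := rfl
@[simp] theorem eval_div : (a / b).eval s = a.eval s / b.eval s := rfl
@[simp] theorem eval_band :
    (bin .band a b).eval s = bitwiseReal Bool.and (a.eval s) (b.eval s) := rfl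
@[simp] theorem eval_bxor :
    (bin .bxor a b).eval s = bitwiseReal Bool.xor (a.eval s) (b.eval s) := rfl
@[simp] theorem eval_zero : (0 : Term).eval s = 0 := Nat.cast_zero
@[simp] theorem eval_one : (1 : Term).eval s = 1 := Nat.cast_one
@[simp] theorem eval_ofNat (n : ℕ) [n.AtLeastTwo] :
    (ofNat(n) : Term).eval s = (ofNat(n) : ℝ) := rfl
@[simp] theorem eval_const (k : ℤ) : (const k).eval s = k := rfl
@[simp] theorem eval_reg (i : ℕ) : (reg i).eval s = s.reg i := rfl
@[simp] theorem eval_floor : (floor a).eval s = ⌊a.eval s⌋ := rfl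
@[simp] theorem eval_log : (log a).eval s = Real.logb 2 (a.eval s) := rfl
@[simp] theorem eval_pow2 : (pow2 a).eval s = (2 : ℝ) ^ a.eval s := rfl

@[simp] theorem cost_add : (a + b).cost = a.cost + b.cost + 1 := rfl
@[simp] theorem cost_sub : (a - b).cost = a.cost + b.cost + 1 := rfl
@[simp] theorem cost_mul : (a * b).cost = a.cost + b.cost + 1 := rfl
@[simp] theorem cost_div : (a / b).cost = a.cost + b.cost + 1 := rfl
@[simp] theorem cost_ofNat (n : ℕ) : (ofNat(n) : Term).cost = 1 := rfl
@[simp] theorem cost_reg (i : ℕ) : (reg i).cost = 1 := rfl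
@[simp] theorem cost_mem : (mem a).cost = a.cost + 1 := rfl
@[simp] theorem cost_inp : (inp a).cost = a.cost + 1 := rfl
@[simp] theorem cost_floor : (floor a).cost = a.cost + 1 := rfl
@[simp] theorem cost_pow2 : (pow2 a).cost = a.cost + 1 := rfl

@[simp] theorem fits_add : (a + b).Fits M s ↔ a.Fits M s ∧ b.Fits M s := Iff.rfl
@[simp] theorem fits_sub : (a - b).Fits M s ↔ a.Fits M s ∧ b.Fits M s := Iff.rfl
@[simp] theorem fits_mul : (a * b).Fits M s ↔ a.Fits M s ∧ b.Fits M s := Iff.rfl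
@[simp] theorem fits_div : (a / b).Fits M s ↔ a.Fits M s ∧ b.Fits M s := Iff.rfl
@[simp] theorem fits_bin (o : BinOp) : (bin o a b).Fits M s ↔ a.Fits M s ∧ b.Fits M s := Iff.rfl
@[simp] theorem fits_ofNat (n : ℕ) : (ofNat(n) : Term).Fits M s := trivial
@[simp] theorem fits_const (k : ℤ) : (const k).Fits M s := trivial
@[simp] theorem fits_reg (i : ℕ) : (reg i).Fits M s := trivial
@[simp] theorem fits_inp : (inp a).Fits M s ↔ a.Fits M s := Iff.rfl
@[simp] theorem fits_floor : (floor a).Fits M s ↔ a.Fits M s := Iff.rfl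
@[simp] theorem fits_log : (log a).Fits M s ↔ a.Fits M s := Iff.rfl
@[simp] theorem fits_pow2 : (pow2 a).Fits M s ↔ a.Fits M s := Iff.rfl

variable {s a M}

theorem eval_mem_of {k : ℕ} (h : a.eval s = k) : (mem a).eval s = s.mem k := by
  rw [Term.eval, h, Nat.floor_natCast]

theorem eval_inp_of {k : ℕ} (h : a.eval s = k) : (inp a).eval s = s.inp k := by
  rw [Term.eval, h, Nat.floor_natCast]

theorem fits_mem_of {k : ℕ} (h : a.eval s = k) (hk : k < M) (ha : a.Fits M s) :
    (mem a).Fits M s := ⟨ha, by rwa [h, Nat.floor_natCast]⟩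

/-- The number `shiftBits d`, where register `0` holds `d`. -/
def bits : Term := floor (log (reg 0)) + 2

theorem eval_bits {d : ℕ} (h0 : s.reg 0 = d) : bits.eval s = shiftBits d := by
  have h : (⌊Real.logb 2 (d : ℝ)⌋ : ℤ) = Nat.log 2 d := by
    have := Real.floor_logb_natCast (b := 2) (r := (d : ℝ)) (Nat.cast_nonneg _)
    rw [Int.log_natCast] at this
    exact_mod_cast this
  simp [bits, h0, h, shiftBits]

/-- The number `sepLevel e i u v`. -/
def sep (i u v : Term) : Term :=
  let σ := i * pow2 (bits * (2 + floor (log (u * u + v * v + 1)))) / (pow2 bits - 1)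
  let j := floor (log ((u - v) * (u - v)) / 2)
  j + floor (log (.bin .bxor (floor ((u + σ) / pow2 j)) (floor ((v + σ) / pow2 j))))

theorem eval_sep {d i : ℕ} {ti u v : Term} (h0 : s.reg 0 = d) (hi : ti.eval s = i) :
    (sep ti u v).eval s = sepLevel (shiftBits d) i (u.eval s) (v.eval s) := by
  simp [sep, sepLevel, hi, eval_bits h0]

/-- The number `heightSepLevel e i u v`. -/
def heightSep (i u v : Term) : Term :=
  let k := sep i u v + 1
  let θ := i * pow2 (0 - k - bits * floor ((0 - k) / bits)) / (pow2 bits - 1)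
  floor (pow2 k * (floor (u / pow2 k + θ) + 1 - θ)) + k - 1

theorem eval_heightSep {d i : ℕ} {ti u v : Term} (h0 : s.reg 0 = d) (hi : ti.eval s = i) :
    (heightSep ti u v).eval s = heightSepLevel (shiftBits d) i (u.eval s) (v.eval s) := by
  simp [heightSep, heightSepLevel, hi, eval_bits h0, eval_sep h0 hi]

end Term

/-- The store `s'` differs from `s` at most in registers with addresses from `k` on. -/
structure Frame (k : ℕ) (s s' : Store) : Prop where
  mem : s'.mem = s.mem
  inp : s'.inp = s.inp
  out : s'.out = s.out
  reg : ∀ r < k, s'.reg r = s.reg r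

namespace Frame

variable {k l : ℕ} {s s' s'' : Store}

theorem refl (k : ℕ) (s : Store) : Frame k s s := ⟨rfl, rfl, rfl, fun _ _ => rfl⟩

theorem trans (h : Frame k s s') (h' : Frame k s' s'') : Frame k s s'' :=
  ⟨h'.mem.trans h.mem, h'.inp.trans h.inp, h'.out.trans h.out,
    fun r hr => (h'.reg r hr).trans (h.reg r hr)⟩

theorem mono (h : Frame k s s') (hl : l ≤ k) : Frame l s s' :=
  ⟨h.mem, h.inp, h.out, fun r hr => h.reg r (hr.trans_le hl)⟩

theorem setReg (h : Frame k s s') {r : ℕ} (hr : k ≤ r) (v : ℝ) : Frame k s (s'.setReg r v) :=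
  ⟨h.mem, h.inp, h.out, fun r' hr' => by
    rw [Store.setReg_reg, if_neg (by omega), h.reg r' hr']⟩

end Frame

/-- The coordinates of `p` are stored from address `a` on. -/
def HoldsPoint {d : ℕ} (mem : ℕ → ℝ) (a : ℕ) (p : HPoint d) : Prop :=
  ∀ j < d, mem (a + j) = p.coord j

/-! ### Comparing two points -/

/-- Compares the points stored at the addresses in registers `40`, `41` in the order whose index is
in register `42`. The sign of the comparison is returned in register `48`, with `1` for `<`. Register
`47` holds the largest separating level so far; the first coordinate that attains it decides. -/
def cmpProg : Prog :=
  let assign : Prog := .seq (.set 47 (.reg 46))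
    (.ite (.lt (.reg 44) (.reg 45)) (.set 48 1) (.set 48 (.const (-1))))
  .seq (.set 43 0) <| .seq (.set 48 0) <| forLoop 43 (.reg 0) <|
    .seq (.set 44 (.mem (.reg 40 + .reg 43))) <|
    .seq (.set 45 (.mem (.reg 41 + .reg 43))) <|
    .ite (.ne (.reg 44) (.reg 45))
      (.seq (.ite (.lt (.reg 43) (.reg 0 - 1))
          (.set 46 (.sep (.reg 42) (.reg 44) (.reg 45)))
          (.seq (.set 44 (.log (.reg 44))) <| .seq (.set 45 (.log (.reg 45))) <|
            .set 46 (.heightSep (.reg 42) (.reg 44) (.reg 45))))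
        (.ite (.eq (.reg 48) 0) assign (.ite (.lt (.reg 47) (.reg 46)) assign .skip)))
      .skip

theorem runs_cmpProg {M d i a b : ℕ} (hd : 1 ≤ d) (hi1 : 1 ≤ i) (hi : i ≤ d + 1) {s : Store}
    {p q : HPoint d} (h0 : s.reg 0 = d) (ha : s.reg 40 = a) (hb : s.reg 41 = b) (h42 : s.reg 42 = i)
    (hp : HoldsPoint s.mem a p) (hq : HoldsPoint s.mem b q) (haM : a + d ≤ M) (hbM : b + d ≤ M) :
    Runs M cmpProg s (2000 * d) (fun s' => Frame 43 s s' ∧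
      ((s'.reg 48 = 0 ∧ p = q) ∨ (s'.reg 48 = 1 ∧ HLt i p q) ∨
        (s'.reg 48 = -1 ∧ HLt i q p))) := by
  set e := shiftBits d with he
  set R := coordRel d e i with hR
  have hH : ∀ c, IsHierarchy (R c) := isHierarchy_coordRel_shiftBits hd hi1 hi
  let Inv : ℕ → Store → Prop := fun k s' => Frame 43 s s' ∧ s'.reg 43 = k ∧
    ZCompared R k p.key q.key (s'.reg 48) (s'.reg 47)
  unfold cmpProg
  refine Runs.set_seq (v := 0) (by simp) (by simp) (T₂ := 1990 * d + 8) ?_ (by simp; omega)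
  refine Runs.set_seq (v := 0) (by simp) (by simp) (T₂ := 1990 * d + 6) ?_ (by simp; omega)
  refine Runs.mono (Runs.forLoop (T := 1940) (N := d) (a := 0) Inv ?_ ?_ ?_ (by omega)) ?_ ?_
  · rintro k s' ⟨hF, h43, -⟩
    exact ⟨h43, trivial, by rw [Term.eval_reg, hF.reg 0 (by omega), h0]⟩
  · rintro k s₁ hk ⟨hF, h43, hZ⟩
    have e0 : s₁.reg 0 = d := by rw [hF.reg 0 (by omega), h0]
    have e40 : s₁.reg 40 = a := by rw [hF.reg 40 (by omega), ha]
    have e41 : s₁.reg 41 = b := by rw [hF.reg 41 (by omega), hb]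
    have e42 : s₁.reg 42 = i := by rw [hF.reg 42 (by omega), h42]
    have ea : (Term.reg 40 + .reg 43).eval s₁ = (a + k : ℕ) := by simp [e40, h43]
    refine Runs.set_seq (v := p.coord k) (Term.fits_mem_of ea (by omega) (by simp))
      (by rw [Term.eval_mem_of ea, hF.mem, hp k hk]) (T₂ := 1930) ?_ (by decide)
    set s₂ := s₁.setReg 44 (p.coord k) with hs₂
    have eb : (Term.reg 41 + .reg 43).eval s₂ = (b + k : ℕ) := by simp [hs₂, e41, h43]
    refine Runs.set_seq (v := q.coord k) (Term.fits_mem_of eb (by omega) (by simp))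
      (by rw [Term.eval_mem_of eb, hs₂, Store.setReg_mem, hF.mem, hq k hk]) (T₂ := 1920) ?_
      (by decide)
    set s₃ := s₂.setReg 45 (q.coord k) with hs₃
    have hF₃ : Frame 43 s s₃ := (hF.setReg (by omega) _).setReg (by omega) _
    refine Runs.ite (T₁ := 1900) (by simp [Test.Fits]) (fun hne => ?_) (fun hne => ?_) (by decide)
    · replace hne : p.key k ≠ q.key k := by
        rw [Ne, HPoint.key_eq_iff _ _ hk]; simpa [Test.Holds, hs₃, hs₂] using hne
      obtain ⟨l, hl, hl1, hl2⟩ := coordSepLevel_spec (one_le_shiftBits d) hi1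
        (lt_two_pow_shiftBits hd hi) d k hne
      refine Runs.seq (T₁ := 1800) (T₂ := 100) (R := fun s' => Frame 43 s s' ∧ s'.reg 43 = k ∧
        s'.reg 44 = p.key k ∧ s'.reg 45 = q.key k ∧ s'.reg 46 = l ∧ s'.reg 47 = s₁.reg 47 ∧
        s'.reg 48 = s₁.reg 48) ?_ ?_ (by omega)
      · refine Runs.ite (T₁ := 1780) (by simp [Test.Fits]) (fun hlt => ?_) (fun hlt => ?_)
          (by decide)
        · replace hlt : k < d - 1 := by
            have h1 : (k : ℝ) < d - 1 := by simpa [Test.Holds, hs₃, hs₂, h43, e0] using hlt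
            have : (k : ℝ) + 1 < d := by linarith
            have : k + 1 < d := by exact_mod_cast this
            omega
          refine Runs.set (by simp [Term.sep, Term.bits]) (by decide) ⟨hF₃.setReg (by omega) _, ?_⟩
          rw [Term.eval_sep (d := d) (i := i) (by simp [hs₃, hs₂, e0]) (by simp [hs₃, hs₂, e42])]
          have e1 : p.key k = p.coord k := by rw [HPoint.key, if_pos hlt]
          have e2 : q.key k = q.coord k := by rw [HPoint.key, if_pos hlt]
          rw [coordSepLevel, if_pos hlt, e1, e2] at hl
          simp [hs₃, hs₂, e1, e2, h43, ← hl]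
        · replace hlt : ¬ k < d - 1 := by
            intro h1
            have h2 : ((k + 1 : ℕ) : ℝ) < d := by exact_mod_cast (by omega : k + 1 < d)
            push_cast at h2
            refine hlt ?_
            simp only [Test.Holds, hs₃, hs₂, Term.eval_reg, Term.eval_sub, Term.eval_one,
              Store.setReg_reg]
            norm_num [h43, e0]
            linarith
          have e1 : p.key k = Real.logb 2 (p.coord k) := by rw [HPoint.key, if_neg hlt]
          have e2 : q.key k = Real.logb 2 (q.coord k) := by rw [HPoint.key, if_neg hlt]
          refine Runs.set_seq (v := p.key k) (by simp) (by simp [hs₃, hs₂, e1]) (T₂ := 1770) ?_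
            (by decide)
          refine Runs.set_seq (v := q.key k) (by simp) (by simp [hs₃, hs₂, e2]) (T₂ := 1760) ?_
            (by decide)
          refine Runs.set (by simp [Term.heightSep, Term.sep, Term.bits]) (by decide)
            ⟨((hF₃.setReg (by omega) _).setReg (by omega) _).setReg (by omega) _, ?_⟩
          rw [Term.eval_heightSep (d := d) (i := i) (by simp [hs₃, hs₂, e0])
            (by simp [hs₃, hs₂, e42])]
          rw [coordSepLevel, if_neg hlt] at hl
          simp [hs₃, hs₂, h43, ← hl]
      · rintro s₄ ⟨hF₄, g43, g44, g45, g46, g47, g48⟩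
        have hassign : s₁.reg 48 = 0 ∨ s₁.reg 47 < l → Runs M (.seq (.set 47 (.reg 46))
            (.ite (.lt (.reg 44) (.reg 45)) (.set 48 1) (.set 48 (.const (-1))))) s₄ 20
            (fun s' => s'.reg 43 = k ∧ Inv (k + 1) (s'.setReg 43 (k + 1 : ℕ))) := by
          intro hor
          have hZ' := hZ.succ_of_lt hH hor hne hl1 hl2
          refine Runs.set_seq (v := l) (by simp) (by simp [g46]) (T₂ := 15) ?_ (by decide)
          refine Runs.ite (T₁ := 5) (by simp [Test.Fits]) (fun hlt => ?_) (fun hlt => ?_)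
            (by decide)
          · replace hlt : p.key k < q.key k := by simpa [Test.Holds, g44, g45] using hlt
            rw [if_pos hlt] at hZ'
            refine Runs.set (by simp) (by decide) ⟨by simp [g43], ?_, by simp, by simpa using hZ'⟩
            exact ((hF₄.setReg (by omega) _).setReg (by omega) _).setReg (by omega) _
          · replace hlt : ¬ p.key k < q.key k := by simpa [Test.Holds, g44, g45] using hlt
            rw [if_neg hlt] at hZ'
            refine Runs.set (by simp) (by decide) ⟨by simp [g43], ?_, by simp, by simpa using hZ'⟩
            exact ((hF₄.setReg (by omega) _).setReg (by omega) _).setReg (by omega) _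
        refine Runs.ite (T₁ := 50) (by simp [Test.Fits]) (fun h48 => ?_) (fun h48 => ?_)
          (by decide)
        · exact (hassign (.inl (by simpa [Test.Holds, g48] using h48))).mono (by omega)
            fun _ h => h
        · replace h48 : s₁.reg 48 ≠ 0 := by simpa [Test.Holds, g48] using h48
          refine Runs.ite (T₁ := 20) (by simp [Test.Fits]) (fun h47 => ?_) (fun h47 => ?_)
            (by decide)
          · exact hassign (.inr (by simpa [Test.Holds, g47, g46] using h47))
          · replace h47 : (l : ℝ) ≤ s₁.reg 47 := by simpa [Test.Holds, g47, g46] using h47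
            refine Runs.skip (by omega) ⟨g43, hF₄.setReg (by omega) _, by simp, ?_⟩
            simpa [g47, g48] using hZ.succ_of_le hH h48 h47 hl2
    · replace hne : p.key k = q.key k := by
        rw [HPoint.key_eq_iff _ _ hk]; simpa [Test.Holds, hs₃, hs₂] using hne
      refine Runs.skip (by omega) ⟨by simp [hs₃, hs₂, h43], hF₃.setReg (by omega) _, by simp, ?_⟩
      simpa [hs₃, hs₂] using hZ.succ_of_eq hH hne
  · refine ⟨((Frame.refl _ _).setReg (by omega) _).setReg (by omega) _, by simp, ?_⟩
    simpa using ZCompared.zero _ _ _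
  · simp only [Term.cost_reg]
    omega
  · rintro s' ⟨hF, -, ⟨h1, h2⟩ | ⟨h1, m, -, h2⟩ | ⟨h1, m, -, h2⟩⟩
    · exact ⟨hF, .inl ⟨h1, HPoint.ext_coord hd fun c hc =>
        (HPoint.key_eq_iff p q hc).1 (h2 c hc)⟩⟩
    · exact ⟨hF, .inr (.inl ⟨h1, m, h2⟩)⟩
    · exact ⟨hF, .inr (.inr ⟨h1, m, h2⟩)⟩

/-! ### Packed sorted lists and binary search -/

namespace Term

variable {s : Store} {M : ℕ}

@[simp] theorem eval_mem_zero : (mem 0).eval s = s.mem 0 := eval_mem_of (by simp)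
@[simp] theorem eval_mem_one : (mem 1).eval s = s.mem 1 := eval_mem_of (by simp)

theorem fits_mem_zero (hM : 2 ≤ M) : (mem 0).Fits M s :=
  fits_mem_of (k := 0) (by simp) (by omega) (by simp)

theorem fits_mem_one (hM : 2 ≤ M) : (mem 1).Fits M s :=
  fits_mem_of (k := 1) (by simp) (by omega) (by simp)

/-- The `k`-th digit of `L` in base `2 ^ b`, where memory cell `1` holds `b`. -/
def digit (L k : Term) : Term :=
  floor (L / pow2 (mem 1 * k)) - pow2 (mem 1) * floor (L / pow2 (mem 1 * (k + 1)))

/-- The cell that holds the packed list of the `i`-th order. -/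
def listCell (i : Term) : Term := mem (reg 0 + 2 + i)

/-- The address of the point with number `k`. -/
def pointAddr (k : Term) : Term := 2 * reg 0 + 4 + k * reg 0

theorem fits_digit {L k : Term} (hM : 2 ≤ M) (hL : L.Fits M s) (hk : k.Fits M s) :
    (digit L k).Fits M s := by
  have := fits_mem_one (s := s) hM
  simp [digit, hL, hk, this]

theorem floor_div_two_pow_mul (N b k : ℕ) :
    ⌊(N : ℝ) / (2 : ℝ) ^ ((b : ℝ) * k)⌋ = ((N / (2 ^ b) ^ k : ℕ) : ℤ) := by
  have h : (2 : ℝ) ^ ((b : ℝ) * k) = (((2 ^ b) ^ k : ℕ) : ℝ) := by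
    rw [← Nat.cast_mul, Real.rpow_natCast, pow_mul]; push_cast; rfl
  rw [h, Int.floor_div_natCast, Int.floor_natCast]
  rfl

theorem eval_digit {L tk : Term} {b k : ℕ} {l : List ℕ} (hb : s.mem 1 = b)
    (hL : L.eval s = (Nat.ofDigits (2 ^ b) l : ℕ)) (hk : tk.eval s = k)
    (hl : ∀ x ∈ l, x < 2 ^ b) : (digit L tk).eval s = (l.getD k 0 : ℕ) := by
  rw [← Nat.ofDigits_getD hl k]
  set N := Nat.ofDigits (2 ^ b) l
  have h1 := floor_div_two_pow_mul N b k
  have h2 := floor_div_two_pow_mul N b (k + 1)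
  push_cast at h1 h2
  simp only [digit, eval_sub, eval_floor, eval_div, hL, eval_pow2, eval_mul, eval_mem_one, hb, hk,
    eval_add, eval_one, h1, h2, Real.rpow_natCast]
  have h3 : N / (2 ^ b) ^ (k + 1) = N / (2 ^ b) ^ k / 2 ^ b := by
    rw [pow_succ, Nat.div_div_eq_div_mul]
  have h4 := Nat.mod_add_div (N / (2 ^ b) ^ k) (2 ^ b)
  have h5 : (((N / (2 ^ b) ^ k) % 2 ^ b : ℕ) : ℝ) + 2 ^ b * ((N / (2 ^ b) ^ k / 2 ^ b : ℕ) : ℝ)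
      = ((N / (2 ^ b) ^ k : ℕ) : ℝ) := by exact_mod_cast h4
  have e1 : (((N : ℤ) / ((2 : ℤ) ^ b) ^ k : ℤ) : ℝ) = ((N / (2 ^ b) ^ k : ℕ) : ℝ) := by
    norm_cast
  have e2 : (((N : ℤ) / ((2 : ℤ) ^ b) ^ (k + 1) : ℤ) : ℝ) = ((N / (2 ^ b) ^ k / 2 ^ b : ℕ) : ℝ) := by
    rw [← h3]; norm_cast
  rw [e1, e2]
  linarith

theorem eval_listCell {ti : Term} {d i : ℕ} (h0 : s.reg 0 = d) (hi : ti.eval s = i) :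
    (listCell ti).eval s = s.mem (d + 2 + i) := eval_mem_of (by simp [h0, hi])

theorem fits_listCell {ti : Term} {d i : ℕ} (h0 : s.reg 0 = d) (hi : ti.eval s = i)
    (hM : d + 2 + i < M) (hti : ti.Fits M s) : (listCell ti).Fits M s :=
  fits_mem_of (k := d + 2 + i) (by simp [h0, hi]) hM (by simp [hti])

theorem eval_pointAddr {tk : Term} {d k : ℕ} (h0 : s.reg 0 = d) (hk : tk.eval s = k) :
    (pointAddr tk).eval s = (2 * d + 4 + k * d : ℕ) := by simp [pointAddr, h0, hk]

theorem fits_pointAddr {tk : Term} (h : tk.Fits M s) : (pointAddr tk).Fits M s := by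
  simp [pointAddr, h]

end Term

/-- The first `n` points are stored one after the other from address `2 d + 4` on. -/
def PointsAt {d : ℕ} (n : ℕ) (pts : ℕ → HPoint d) (mem : ℕ → ℝ) : Prop :=
  ∀ k < n, HoldsPoint mem (2 * d + 4 + k * d) (pts k)

/-- The list `l` enumerates the numbers below `n` in increasing `i`-th order of the points. -/
structure SortedList {d : ℕ} (i n : ℕ) (pts : ℕ → HPoint d) (l : List ℕ) : Prop where
  pairwise : l.Pairwise fun a b => HLt i (pts a) (pts b)
  mem_iff : ∀ k, k ∈ l ↔ k < n

theorem SortedList.nodup {d i n : ℕ} {pts : ℕ → HPoint d} {l : List ℕ} (h : SortedList i n pts l) :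
    l.Nodup := h.pairwise.imp fun {a b} hab => by rintro rfl; exact HLt.irrefl hab

theorem SortedList.length_eq {d i n : ℕ} {pts : ℕ → HPoint d} {l : List ℕ}
    (h : SortedList i n pts l) : l.length = n := by
  rw [← List.toFinset_card_of_nodup h.nodup, show l.toFinset = Finset.range n by
    ext k; simp [h.mem_iff], Finset.card_range]

/-- Binary search in the list whose order index is in register `20`, for the point stored at the
address in register `21`. Register `22` holds the length of the list. The number of smaller list
elements is returned in register `23`. -/
def searchProg : Prog :=
  .seq (.set 23 0) <| .seq (.set 24 (.reg 22)) <|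
    .loop (.lt (.reg 23) (.reg 24)) <|
      .seq (.set 25 (.floor ((.reg 23 + .reg 24) / 2))) <|
      .seq (.set 40 (.pointAddr (.digit (.listCell (.reg 20)) (.reg 25)))) <|
      .seq (.set 41 (.reg 21)) <| .seq (.set 42 (.reg 20)) <| .seq cmpProg <|
      .ite (.eq (.reg 48) 1) (.set 23 (.reg 25 + 1)) (.set 24 (.reg 25))

theorem runs_searchProg {M d i a b n : ℕ} (hd : 1 ≤ d) (hi1 : 1 ≤ i) (hi : i ≤ d + 1) {s : Store}
    {pts : ℕ → HPoint d} {q : HPoint d} {l : List ℕ} (h0 : s.reg 0 = d) (h20 : s.reg 20 = i)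
    (h21 : s.reg 21 = a) (h22 : s.reg 22 = l.length) (hb : s.mem 1 = b)
    (hL : s.mem (d + 2 + i) = (Nat.ofDigits (2 ^ b) l : ℕ)) (hpts : PointsAt n pts s.mem)
    (hq : HoldsPoint s.mem a q) (hlen : l.length ≤ n) (hlt : ∀ x ∈ l, x < n) (hnb : n ≤ 2 ^ b)
    (hpw : l.Pairwise fun a b => HLt i (pts a) (pts b))
    (hM : 2 * d + 4 + n * d ≤ M) (haM : a + d ≤ M) :
    Runs M searchProg s (5000 * d * Nat.log 2 (n + 2)) (fun s' => Frame 23 s s' ∧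
      ∃ k ≤ l.length, s'.reg 23 = k ∧ (∀ x ∈ l.take k, HLt i (pts x) q) ∧
        ∀ x ∈ l.drop k, ¬ HLt i (pts x) q) := by
  set N := l.length with hN
  have hlt' : ∀ x ∈ l, x < 2 ^ b := fun x hx => (hlt x hx).trans_le hnb
  have hget : ∀ j < N, l.getD j 0 ∈ l := fun j hj => by
    rw [List.getD_eq_getElem l 0 hj]; exact List.getElem_mem hj
  have hpw' : ∀ j j', j < j' → j' < N → HLt i (pts (l.getD j 0)) (pts (l.getD j' 0)) := by
    intro j j' h1 h2
    rw [List.getD_eq_getElem l 0 h2, List.getD_eq_getElem l 0 (h1.trans h2)]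
    exact List.pairwise_iff_getElem.1 hpw _ _ _ _ h1
  let Inv : ℕ → Store → Prop := fun k s' => Frame 23 s s' ∧ ∃ lo hi : ℕ, s'.reg 23 = lo ∧
    s'.reg 24 = hi ∧ lo ≤ hi ∧ hi ≤ N ∧ hi - lo < 2 ^ k ∧
    (∀ j < lo, HLt i (pts (l.getD j 0)) q) ∧ ∀ j, hi ≤ j → j < N → ¬ HLt i (pts (l.getD j 0)) q
  set lg := Nat.log 2 (n + 2) with hlg
  have hlg1 : 1 ≤ lg := Nat.log_pos one_lt_two (by omega)
  have hNlg : N < 2 ^ (lg + 1) := by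
    have : n + 2 < 2 ^ (lg + 1) := Nat.lt_pow_succ_log_self one_lt_two (n + 2)
    omega
  unfold searchProg
  refine Runs.set_seq (v := 0) (by simp) (by simp) (T₂ := (lg + 1) * (2000 * d + 204) + 6) ?_ ?_
  swap
  · simp only [Term.cost_ofNat]
    nlinarith [Nat.mul_le_mul hd hlg1, Nat.mul_le_mul_left d hlg1]
  refine Runs.set_seq (v := N) (by simp) (by simp [h22])
    (T₂ := (lg + 1) * (2000 * d + 204) + 4) ?_ (by simp; omega)
  refine (Runs.loop (T := 2000 * d + 200) (Inv := Inv) ?_ ?_ (lg + 1) ?_).mono ?_ ?_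
  · intro k s' _; simp [Test.Fits]
  · rintro k s₁ ⟨hF, lo, hi', h23, h24, hlo, hhi, hk, hL1, hL2⟩ hlt1
    replace hlt1 : lo < hi' := by simpa [Test.Holds, h23, h24] using hlt1
    obtain _ | k := k
    · simp at hk; omega
    refine ⟨k, rfl, ?_⟩
    set mid := (lo + hi') / 2 with hmid
    have hmid1 : lo ≤ mid := by omega
    have hmid2 : mid < hi' := by omega
    have hpow : 2 ^ (k + 1) = 2 * 2 ^ k := by ring
    have e0 : s₁.reg 0 = d := by rw [hF.reg 0 (by omega), h0]
    have e20 : s₁.reg 20 = i := by rw [hF.reg 20 (by omega), h20]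
    have e21 : s₁.reg 21 = a := by rw [hF.reg 21 (by omega), h21]
    refine Runs.set_seq (v := mid) (by simp) ?_ (T₂ := 2000 * d + 190) ?_ (by simp; omega)
    · have : ⌊(((lo + hi' : ℕ) : ℝ)) / (2 : ℕ)⌋ = ((lo + hi' : ℕ) : ℤ) / (2 : ℕ) := by
        rw [Int.floor_div_natCast, Int.floor_natCast]
      push_cast at this
      simp only [Term.eval_floor, Term.eval_div, Term.eval_add, Term.eval_reg, h23, h24,
        Term.eval_ofNat, this, hmid]
      norm_cast
    set s₂ := s₁.setReg 25 mid with hs₂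
    set x := l.getD mid 0 with hx
    have hxl : x ∈ l := hget mid (by omega)
    have c20 : (Term.reg 20).eval s₂ = i := by simp [hs₂, e20]
    have c0 : s₂.reg 0 = d := by simp [hs₂, e0]
    have m2 : s₂.mem = s.mem := hF.mem
    have hdig : (Term.digit (.listCell (.reg 20)) (.reg 25)).eval s₂ = (x : ℕ) :=
      Term.eval_digit (by rw [m2, hb]) (by rw [Term.eval_listCell c0 c20, m2, hL])
        (by simp [hs₂]) hlt'
    refine Runs.set_seq (v := (2 * d + 4 + x * d : ℕ)) ?_ (Term.eval_pointAddr c0 hdig)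
      (T₂ := 2000 * d + 100) ?_ ?_
    · exact Term.fits_pointAddr (Term.fits_digit (by omega)
        (Term.fits_listCell c0 c20 (by omega) (by simp)) (by simp))
    swap
    · have : (Term.pointAddr (.digit (.listCell (.reg 20)) (.reg 25))).cost ≤ 60 := by decide
      omega
    refine Runs.set_seq (v := a) (by simp) (by simp [hs₂, e21]) (T₂ := 2000 * d + 80) ?_
      (by simp; omega)
    refine Runs.set_seq (v := i) (by simp) (by simp [hs₂, e20]) (T₂ := 2000 * d + 60) ?_
      (by simp; omega)
    have hxn := hlt x hxl
    have hxd : (x + 1) * d ≤ n * d := Nat.mul_le_mul_right d hxn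
    have hxd' : (x + 1) * d = x * d + d := by ring
    refine Runs.seq (runs_cmpProg (a := 2 * d + 4 + x * d) (b := a) (p := pts x) (q := q) hd hi1 hi
      (by simp [hs₂, e0]) (by simp) (by simp) (by simp) ?_ ?_ (by omega) haM) ?_
      (T₂ := 50) (by omega)
    · simp only [Store.setReg_mem, m2]; exact hpts x hxn
    · simp only [Store.setReg_mem, m2]; exact hq
    rintro s₃ ⟨hF₃, hcmp⟩
    have hF₄ : Frame 23 s s₃ := Frame.trans ((((hF.setReg (by omega) _).setReg (by omega)
      _).setReg (by omega) _).setReg (by omega) _) (hF₃.mono (by omega))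
    have f23 : s₃.reg 23 = lo := by rw [hF₃.reg 23 (by omega)]; simp [hs₂, h23]
    have f24 : s₃.reg 24 = hi' := by rw [hF₃.reg 24 (by omega)]; simp [hs₂, h24]
    have f25 : s₃.reg 25 = mid := by rw [hF₃.reg 25 (by omega)]; simp [hs₂]
    refine Runs.ite (T₁ := 10) (by simp [Test.Fits]) (fun h48 => ?_) (fun h48 => ?_) (by decide)
    · have hxq : HLt i (pts x) q := by
        have h48 : s₃.reg 48 = 1 := by simpa [Test.Holds] using h48
        rcases hcmp with ⟨h, -⟩ | ⟨-, h⟩ | ⟨h, -⟩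
        · norm_num [h] at h48
        · exact h
        · norm_num [h] at h48
      refine Runs.set (by simp) (by decide) ⟨hF₄.setReg (by omega) _, mid + 1, hi', ?_, ?_,
        by omega, hhi, by omega, ?_, hL2⟩
      · simp [f25]
      · simp [f24]
      · intro j hj
        rcases Nat.lt_succ_iff_lt_or_eq.1 hj with h | rfl
        · exact (hpw' j mid h (by omega)).trans hd hi1 hi hxq
        · exact hxq
    · have hxq : ¬ HLt i (pts x) q := by
        have h48 : s₃.reg 48 ≠ 1 := by simpa [Test.Holds] using h48
        rcases hcmp with ⟨-, rfl⟩ | ⟨h, -⟩ | ⟨-, h⟩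
        · exact HLt.irrefl
        · exact absurd h h48
        · exact h.asymm hd hi1 hi
      refine Runs.set (by simp) (by decide) ⟨hF₄.setReg (by omega) _, lo, mid, ?_, ?_,
        by omega, by omega, by omega, hL1, ?_⟩
      · simp [f23]
      · simp [f25]
      · intro j hj1 hj2 hjq
        rcases Nat.eq_or_lt_of_le hj1 with rfl | h
        · exact hxq hjq
        · exact hxq ((hpw' mid j h hj2).trans hd hi1 hi hjq)
  · exact ⟨((Frame.refl _ _).setReg (by omega) _).setReg (by omega) _, 0, N, by simp, by simp,
      by omega, le_rfl, by simpa using hNlg, by simp, by omega⟩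
  · simp only [Test.cost, Term.cost_reg, show 2000 * d + 200 + (1 + 1 + 1) + 1 = 2000 * d + 204 by
      ring]
    omega
  · rintro s' ⟨k, ⟨hF, lo, hi', h23, h24, hlo, hhi, hk, hL1, hL2⟩, hge⟩
    replace hge : hi' ≤ lo := by simpa [Test.Holds, h23, h24] using hge
    obtain rfl : lo = hi' := by omega
    refine ⟨hF, lo, hhi, h23, fun x hx => ?_, fun x hx => ?_⟩
    · obtain ⟨j, hj, rfl⟩ := List.mem_take_iff_getElem.1 hx
      have := hL1 j (by omega)
      rwa [List.getD_eq_getElem l 0 (by omega)] at this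
    · obtain ⟨j, hj, rfl⟩ := List.mem_drop_iff_getElem.1 hx
      have := hL2 (lo + j) (by omega) (by omega)
      rwa [List.getD_eq_getElem l 0 (by omega)] at this

/-! ### Editing packed lists -/

namespace Term

variable {s : Store} {M : ℕ} {L tk tx : Term} {b k : ℕ} {l : List ℕ}

/-- Inserts the digit `x` at position `k` of the packed list `L`. -/
def insertDigit (L k x : Term) : Term :=
  L - floor (L / pow2 (mem 1 * k)) * pow2 (mem 1 * k) +
    pow2 (mem 1 * k) * (x + pow2 (mem 1) * floor (L / pow2 (mem 1 * k)))

/-- Removes the digit at position `k` of the packed list `L`. -/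
def removeDigit (L k : Term) : Term :=
  L - floor (L / pow2 (mem 1 * k)) * pow2 (mem 1 * k) +
    pow2 (mem 1 * k) * floor (L / pow2 (mem 1 * (k + 1)))

/-- Replaces the digit `y` at position `k` of the packed list `L` by `x`. -/
def replaceDigit (L k x y : Term) : Term := L + (x - y) * pow2 (mem 1 * k)

theorem fits_insertDigit (hM : 2 ≤ M) (hL : L.Fits M s) (hk : tk.Fits M s) (hx : tx.Fits M s) :
    (insertDigit L tk tx).Fits M s := by
  have := fits_mem_one (s := s) hM
  simp [insertDigit, hL, hk, hx, this]

theorem fits_removeDigit (hM : 2 ≤ M) (hL : L.Fits M s) (hk : tk.Fits M s) :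
    (removeDigit L tk).Fits M s := by
  have := fits_mem_one (s := s) hM
  simp [removeDigit, hL, hk, this]

theorem fits_replaceDigit {ty : Term} (hM : 2 ≤ M) (hL : L.Fits M s) (hk : tk.Fits M s)
    (hx : tx.Fits M s) (hy : ty.Fits M s) : (replaceDigit L tk tx ty).Fits M s := by
  have := fits_mem_one (s := s) hM
  simp [replaceDigit, hL, hk, hx, hy, this]

theorem eval_pow2_mul (hb : s.mem 1 = b) (hk : tk.eval s = k) :
    (pow2 (mem 1 * tk)).eval s = (((2 ^ b) ^ k : ℕ) : ℝ) := by
  rw [eval_pow2, eval_mul, eval_mem_one, hb, hk, ← Nat.cast_mul, Real.rpow_natCast, pow_mul]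
  push_cast; rfl

theorem eval_floor_div (hb : s.mem 1 = b) (hL : L.eval s = (Nat.ofDigits (2 ^ b) l : ℕ))
    (hk : tk.eval s = k) (hl : ∀ x ∈ l, x < 2 ^ b) :
    (floor (L / pow2 (mem 1 * tk))).eval s = (Nat.ofDigits (2 ^ b) (l.drop k) : ℕ) := by
  rw [← Nat.ofDigits_div_pow_eq_ofDigits_drop k (by positivity) l hl, eval_floor, eval_div, hL,
    eval_pow2, eval_mul, eval_mem_one, hb, hk, floor_div_two_pow_mul]
  norm_cast

theorem ofDigits_take_add_drop {B : ℕ} (hk : k ≤ l.length) : Nat.ofDigits B l =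
    Nat.ofDigits B (l.take k) + B ^ k * Nat.ofDigits B (l.drop k) := by
  have := Nat.ofDigits_append (b := B) (l1 := l.take k) (l2 := l.drop k)
  rwa [List.take_append_drop, List.length_take_of_le hk] at this

theorem eval_insertDigit {x : ℕ} (hb : s.mem 1 = b)
    (hL : L.eval s = (Nat.ofDigits (2 ^ b) l : ℕ)) (hk : tk.eval s = k) (hx : tx.eval s = x)
    (hl : ∀ x ∈ l, x < 2 ^ b) (hkl : k ≤ l.length) :
    (insertDigit L tk tx).eval s = (Nat.ofDigits (2 ^ b) (l.take k ++ x :: l.drop k) : ℕ) := by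
  have hp : (2 : ℝ) ^ s.mem 1 = 2 ^ b := by rw [hb, Real.rpow_natCast]
  rw [insertDigit, eval_add, eval_sub, eval_mul, eval_mul, eval_floor_div hb hL hk hl,
    eval_pow2_mul hb hk, eval_add, eval_mul, eval_floor_div hb hL hk hl, hL, hx, eval_pow2,
    eval_mem_one, hp, ofDigits_take_add_drop hkl, Nat.ofDigits_append, Nat.ofDigits_cons,
    List.length_take_of_le hkl]
  push_cast
  ring

theorem eval_removeDigit (hb : s.mem 1 = b)
    (hL : L.eval s = (Nat.ofDigits (2 ^ b) l : ℕ)) (hk : tk.eval s = k)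
    (hl : ∀ x ∈ l, x < 2 ^ b) (hkl : k ≤ l.length) :
    (removeDigit L tk).eval s = (Nat.ofDigits (2 ^ b) (l.take k ++ l.drop (k + 1)) : ℕ) := by
  have hk1 : (tk + 1).eval s = (k + 1 : ℕ) := by simp [hk]
  rw [removeDigit, eval_add, eval_sub, eval_mul, eval_mul, eval_floor_div hb hL hk hl,
    eval_pow2_mul hb hk, eval_floor_div hb hL hk1 hl, hL, ofDigits_take_add_drop hkl,
    Nat.ofDigits_append, List.length_take_of_le hkl]
  push_cast
  ring

theorem eval_replaceDigit {ty : Term} {x y : ℕ} (hb : s.mem 1 = b)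
    (hL : L.eval s = (Nat.ofDigits (2 ^ b) l : ℕ)) (hk : tk.eval s = k) (hx : tx.eval s = x)
    (hy : ty.eval s = y) (hkl : k < l.length) (hly : l[k] = y) :
    (replaceDigit L tk tx ty).eval s =
      (Nat.ofDigits (2 ^ b) (l.take k ++ x :: l.drop (k + 1)) : ℕ) := by
  rw [replaceDigit, eval_add, eval_mul, eval_sub, eval_pow2_mul hb hk, hL, hx, hy,
    ofDigits_take_add_drop hkl.le, List.drop_eq_getElem_cons hkl, hly, Nat.ofDigits_append,
    List.length_take_of_le hkl.le, Nat.ofDigits_cons, Nat.ofDigits_cons]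
  push_cast
  ring

/-- Changes the base of the packed list `L` with `n` digits from `2 ^ b` to `2 ^ ((n + 1) b)`, where
memory cells `0` and `1` hold `n` and `b`. -/
def widen (L : Term) : Term :=
  let n := mem 0
  let b := mem 1
  .bin .band (L * ((pow2 (n * b * n) - 1) / (pow2 (n * b) - 1)))
    ((pow2 b - 1) * ((pow2 ((n + 1) * b * n) - 1) / (pow2 ((n + 1) * b) - 1)))

theorem fits_widen (hM : 2 ≤ M) (hL : L.Fits M s) : (widen L).Fits M s := by
  have h1 := fits_mem_one (s := s) hM
  have h0 := fits_mem_zero (s := s) hM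
  simp [widen, hL, h0, h1]

theorem eval_geom (c n : ℕ) (hc : 0 < c) : (((2 : ℝ) ^ (c * n) - 1) / (2 ^ c - 1)) =
    (Nat.ofDigits (2 ^ c) (List.replicate n 1) : ℕ) := by
  rw [Nat.cast_ofDigits_replicate_one (Nat.one_lt_two_pow hc.ne'), pow_mul]
  push_cast; rfl

theorem eval_widen (hn : s.mem 0 = l.length) (hb : s.mem 1 = b)
    (hL : L.eval s = (Nat.ofDigits (2 ^ b) l : ℕ)) (hb0 : 0 < b) (hl : ∀ x ∈ l, x < 2 ^ b)
    (hl0 : 0 < l.length) :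
    (widen L).eval s = (Nat.ofDigits (2 ^ ((l.length + 1) * b)) l : ℕ) := by
  rw [← Nat.ofDigits_widen hb0 hl hl0, ← bitwiseReal_and_natCast]
  set n := l.length
  have e1 : (2 : ℝ) ^ ((n : ℝ) * b * n) = 2 ^ (n * b * n) := by
    rw [← Nat.cast_mul, ← Nat.cast_mul, Real.rpow_natCast]
  have e2 : (2 : ℝ) ^ ((n : ℝ) * b) = 2 ^ (n * b) := by
    rw [← Nat.cast_mul, Real.rpow_natCast]
  have e3 : (2 : ℝ) ^ (((n : ℝ) + 1) * b * n) = 2 ^ ((n + 1) * b * n) := by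
    rw [← Nat.cast_add_one, ← Nat.cast_mul, ← Nat.cast_mul, Real.rpow_natCast]
  have e4 : (2 : ℝ) ^ (((n : ℝ) + 1) * b) = 2 ^ ((n + 1) * b) := by
    rw [← Nat.cast_add_one, ← Nat.cast_mul, Real.rpow_natCast]
  have e5 : ((2 ^ b - 1 : ℕ) : ℝ) = 2 ^ b - 1 := by rw [Nat.cast_sub Nat.one_le_two_pow]; simp
  simp only [widen, eval_band, eval_mul, eval_div, eval_sub, eval_pow2, eval_mem_zero,
    eval_mem_one, eval_one, eval_add, hn, hb, hL, e1, e2, e3, e4, Real.rpow_natCast]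
  rw [eval_geom _ _ (Nat.mul_pos hl0 hb0), eval_geom _ _ (Nat.mul_pos (Nat.succ_pos n) hb0),
    ← e5, ← Nat.cast_mul, ← Nat.cast_mul]

end Term

/-! ### Loops that write to memory -/

/-- The store `s'` has memory contents `m` and differs from `s` otherwise at most in registers with
addresses from `k` on. -/
structure Writes (k : ℕ) (m : ℕ → ℝ) (s s' : Store) : Prop where
  mem : s'.mem = m
  inp : s'.inp = s.inp
  out : s'.out = s.out
  reg : ∀ r < k, s'.reg r = s.reg r

namespace Writes

variable {k l : ℕ} {m m' : ℕ → ℝ} {s s' s'' : Store}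

theorem refl (k : ℕ) (s : Store) : Writes k s.mem s s := ⟨rfl, rfl, rfl, fun _ _ => rfl⟩

theorem trans (h : Writes k m s s') (h' : Writes k m' s' s'') : Writes k m' s s'' :=
  ⟨h'.mem, h'.inp.trans h.inp, h'.out.trans h.out,
    fun r hr => (h'.reg r hr).trans (h.reg r hr)⟩

theorem mono (h : Writes k m s s') (hl : l ≤ k) : Writes l m s s' :=
  ⟨h.mem, h.inp, h.out, fun r hr => h.reg r (hr.trans_le hl)⟩

theorem setReg (h : Writes k m s s') {r : ℕ} (hr : k ≤ r) (v : ℝ) : Writes k m s (s'.setReg r v) :=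
  ⟨h.mem, h.inp, h.out, fun r' hr' => by
    rw [Store.setReg_reg, if_neg (by omega), h.reg r' hr']⟩

theorem setMem (h : Writes k m s s') (a : ℕ) (v : ℝ) :
    Writes k (Function.update m a v) s (s'.setMem a v) :=
  ⟨by rw [← h.mem]; rfl, h.inp, h.out, h.reg⟩

theorem frame (h : Writes k m s s') (h' : Frame k s' s'') : Writes k m s s'' :=
  ⟨h'.mem.trans h.mem, h'.inp.trans h.inp, h'.out.trans h.out,
    fun r hr => (h'.reg r hr).trans (h.reg r hr)⟩

end Writes

theorem Frame.writes {k : ℕ} {s s' : Store} (h : Frame k s s') : Writes k s.mem s s' :=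
  ⟨h.mem, h.inp, h.out, h.reg⟩

/-- The memory contents `m` with `k` cells from address `a` on overwritten by the values of `v`. -/
def writeBlock (m : ℕ → ℝ) (a k : ℕ) (v : ℕ → ℝ) (x : ℕ) : ℝ :=
  if a ≤ x ∧ x < a + k then v (x - a) else m x

theorem writeBlock_zero (m : ℕ → ℝ) (a : ℕ) (v : ℕ → ℝ) : writeBlock m a 0 v = m := by
  funext x; simp only [writeBlock]; rw [if_neg (by omega)]

theorem writeBlock_succ (m : ℕ → ℝ) (a k : ℕ) (v : ℕ → ℝ) :
    Function.update (writeBlock m a k v) (a + k) (v k) = writeBlock m a (k + 1) v := by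
  funext x
  rw [Function.update_apply]
  split_ifs with h
  · subst h; simp [writeBlock]
  · simp only [writeBlock]
    by_cases h' : a ≤ x ∧ x < a + k
    · rw [if_pos h', if_pos (by omega)]
    · rw [if_neg h', if_neg (by omega)]

theorem writeBlock_of_lt {m : ℕ → ℝ} {a k x : ℕ} {v : ℕ → ℝ} (h : x < a) :
    writeBlock m a k v x = m x := if_neg (by omega)

theorem writeBlock_of_ge {m : ℕ → ℝ} {a k x : ℕ} {v : ℕ → ℝ} (h : a + k ≤ x) :
    writeBlock m a k v x = m x := if_neg (by omega)

theorem writeBlock_add {m : ℕ → ℝ} {a k j : ℕ} {v : ℕ → ℝ} (h : j < k) :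
    writeBlock m a k v (a + j) = v j := by
  rw [writeBlock, if_pos (by omega), Nat.add_sub_cancel_left]

/-- `for r < d do mem[A + r] := e`. -/
def storeLoop (r : ℕ) (A e : Term) : Prog :=
  .seq (.set r 0) (forLoop r (.reg 0) (.store (A + .reg r) e))

theorem runs_storeLoop {M d r a : ℕ} {s : Store} {A e : Term} {v : ℕ → ℝ} (hr : 0 < r)
    (h0 : s.reg 0 = d) (haM : a + d ≤ M)
    (hbody : ∀ j < d, ∀ s₁, Writes r (writeBlock s.mem a j v) s s₁ → s₁.reg r = j →
      (A.Fits M s₁ ∧ A.eval s₁ = a) ∧ e.Fits M s₁ ∧ e.eval s₁ = v j) :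
    Runs M (storeLoop r A e) s (d * (A.cost + e.cost + 11) + 6)
      (Writes r (writeBlock s.mem a d v) s) := by
  unfold storeLoop
  refine Runs.set_seq (v := 0) (by simp) (by simp) (T₂ := d * (A.cost + e.cost + 11) + 4) ?_
    (by simp; omega)
  refine (Runs.forLoop (T := A.cost + e.cost + 3) (N := d) (a := 0)
    (fun j s' => Writes r (writeBlock s.mem a j v) s s' ∧ s'.reg r = j) ?_ ?_ ?_ (by omega)).mono
    ?_ ?_
  · rintro j s₁ ⟨hW, hj⟩
    exact ⟨hj, trivial, by rw [Term.eval_reg, hW.reg 0 hr, h0]⟩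
  · rintro j s₁ hj ⟨hW, hrj⟩
    obtain ⟨⟨h1, h2⟩, h3, h4⟩ := hbody j hj s₁ hW hrj
    refine Runs.store (k := a + j) (v := v j) (by simp [h1]) h3 (by simp [h2, hrj]) h4 (by omega)
      (by simp; omega) ⟨by simp [hrj], ?_, by simp⟩
    have := (hW.setMem (a + j) (v j)).setReg le_rfl ((j + 1 : ℕ) : ℝ)
    rwa [writeBlock_succ] at this
  · refine ⟨⟨(writeBlock_zero _ _ _).symm, rfl, rfl, fun r' hr' => ?_⟩, by simp⟩
    simp [show r' ≠ r by omega]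
  · simp only [Term.cost_reg, Nat.sub_zero]
    rw [show A.cost + e.cost + 3 + 1 + 7 = A.cost + e.cost + 11 by ring]
  · rintro s' ⟨h, -⟩
    exact h

/-- The memory contents `m'` arise from `m` by replacing the packed lists of the orders with index
below `k` by lists that satisfy `P`. -/
structure ListsUpdated (d k : ℕ) (P : ℕ → ℝ → Prop) (m m' : ℕ → ℝ) : Prop where
  other : ∀ a, (a < d + 3 ∨ 2 * d + 4 ≤ a) → m' a = m a
  new : ∀ i, 1 ≤ i → i ≤ d + 1 → i < k → P i (m' (d + 2 + i))
  old : ∀ i, 1 ≤ i → i ≤ d + 1 → k ≤ i → m' (d + 2 + i) = m (d + 2 + i)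

/-- Runs `body` once for each order, with the index of the order in register `r`. -/
def forOrders (r : ℕ) (body : Prog) : Prog := .seq (.set r 1) (forLoop r (.reg 0 + 2) body)

theorem runs_forOrders {M d r T : ℕ} {s : Store} {body : Prog} (Inv : ℕ → Store → Prop)
    (h0 : ∀ i s', Inv i s' → s'.reg 0 = d)
    (hset : ∀ i s' v, Inv i s' → Inv i (s'.setReg r v)) (h : Inv 1 s)
    (hbody : ∀ i, 1 ≤ i → i ≤ d + 1 → ∀ s₁, Inv i s₁ → s₁.reg r = i →
      Runs M body s₁ T (fun s' => s'.reg r = i ∧ Inv (i + 1) s')) :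
    Runs M (forOrders r body) s ((d + 1) * (T + 10) + 8) (Inv (d + 2)) := by
  unfold forOrders
  refine Runs.set_seq (v := 1) (by simp) (by simp) (T₂ := (d + 1) * (T + 10) + 6) ?_
    (by simp; omega)
  refine (Runs.forLoop (T := T) (N := d + 2) (a := 1)
    (fun i s' => Inv i s' ∧ s'.reg r = i ∧ 1 ≤ i) ?_ ?_ ?_ (by omega)).mono ?_ ?_
  · rintro i s₁ ⟨hI, hi, -⟩
    exact ⟨hi, by simp, by simp [h0 _ _ hI]⟩
  · rintro i s₁ hi ⟨hI, hri, hi1⟩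
    refine (hbody i hi1 (by omega) s₁ hI hri).mono le_rfl ?_
    rintro s' ⟨hr, hI'⟩
    exact ⟨hr, hset _ _ _ hI', by simp, by omega⟩
  · exact ⟨hset _ _ _ h, by simp, le_rfl⟩
  · simp only [Term.cost_reg, Term.cost_add, Term.cost_ofNat]
    rw [show d + 2 - 1 = d + 1 by omega]
  · exact fun s' h => h.1

/-- The case of a body that replaces the list of its order. -/
theorem runs_forOrders_update {M d r T : ℕ} {s : Store} {body : Prog} {P : ℕ → ℝ → Prop}
    (hr : 0 < r) (h0 : s.reg 0 = d)
    (hbody : ∀ i, 1 ≤ i → i ≤ d + 1 → ∀ s₁ m, ListsUpdated d i P s.mem m → Writes r m s s₁ →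
      s₁.reg r = i → Runs M body s₁ T (fun s' => ∃ v, P i v ∧
        Writes (r + 1) (Function.update m (d + 2 + i) v) s₁ s')) :
    Runs M (forOrders r body) s ((d + 1) * (T + 10) + 8)
      (fun s' => ∃ m, ListsUpdated d (d + 2) P s.mem m ∧ Writes r m s s') := by
  refine runs_forOrders (fun i s' => ∃ m, ListsUpdated d i P s.mem m ∧ Writes r m s s') ?_ ?_ ?_ ?_
  · rintro i s₁ ⟨m, hm, hW⟩
    rw [hW.reg 0 hr, h0]
  · rintro i s₁ v ⟨m, hm, hW⟩
    exact ⟨m, hm, hW.setReg le_rfl v⟩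
  · exact ⟨s.mem, ⟨fun _ _ => rfl, by omega, fun _ _ _ _ => rfl⟩, Writes.refl _ _⟩
  · rintro i hi1 hi s₁ ⟨m, hm, hW⟩ hri
    refine (hbody i hi1 hi s₁ m hm hW hri).mono le_rfl ?_
    rintro s' ⟨v, hv, hW'⟩
    refine ⟨(hW'.reg r (by omega)).trans hri, _, ⟨fun a ha => ?_, fun j h1 h2 h3 => ?_,
      fun j h1 h2 h3 => ?_⟩, hW.trans (hW'.mono (by omega))⟩
    · rw [Function.update_of_ne (by omega), hm.other a ha]
    · rcases Nat.lt_succ_iff_lt_or_eq.1 h3 with h | rfl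
      · rw [Function.update_of_ne (by omega)]; exact hm.new j h1 h2 h
      · rw [Function.update_self]; exact hv
    · rw [Function.update_of_ne (by omega), hm.old j h1 h2 (by omega)]

/-! ### The data structure -/

/-- The memory holds the points `pts 0, …, pts (n - 1)`, sorted with respect to the `d + 1` orders.
Cell `0` holds `n`, cell `1` the number `b` of bits per list entry, the cells `d + 3, …, 2 d + 3`
the lists, packed in base `2 ^ b`; the points follow, and then there are zeros. The cells
`2, …, d + 1` are a buffer for a point. -/
structure Represents (d n b : ℕ) (pts : ℕ → HPoint d) (ls : ℕ → List ℕ) (m : ℕ → ℝ) : Prop where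
  size : m 0 = n
  bits : m 1 = b
  b_pos : 1 ≤ b
  n_le : n ≤ 2 ^ b
  lists : ∀ i, 1 ≤ i → i ≤ d + 1 → m (d + 2 + i) = (Nat.ofDigits (2 ^ b) (ls i) : ℕ)
  sorted : ∀ i, 1 ≤ i → i ≤ d + 1 → SortedList i n pts (ls i)
  points : PointsAt n pts m
  zero : ∀ a, 2 * d + 4 + n * d ≤ a → m a = 0

/-- If exactly the first `k` elements of the sorted list are smaller than the element `j`, then `j` is
at position `k`. -/
theorem getElem_eq_of_split {d i : ℕ} {pts : ℕ → HPoint d} {l : List ℕ} {j k : ℕ}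
    (hpw : l.Pairwise fun a b => HLt i (pts a) (pts b)) (hj : j ∈ l)
    (h1 : ∀ x ∈ l.take k, HLt i (pts x) (pts j)) (h2 : ∀ x ∈ l.drop k, ¬ HLt i (pts x) (pts j)) :
    ∃ hk : k < l.length, l[k] = j := by
  have hjd : j ∈ l.drop k := by
    rw [← List.take_append_drop k l, List.mem_append] at hj
    exact hj.resolve_left fun h => HLt.irrefl (h1 j h)
  have hkl : k < l.length := by
    by_contra hcon
    rw [List.drop_eq_nil_of_le (by omega)] at hjd
    simp at hjd
  refine ⟨hkl, ?_⟩
  have hx := h2 l[k] (List.mem_drop_iff_getElem.2 ⟨0, by omega, by simp⟩)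
  obtain ⟨t, ht, rfl⟩ := List.mem_drop_iff_getElem.1 hjd
  obtain _ | t := t
  · simp
  · exact absurd (List.pairwise_iff_getElem.1 hpw k (k + (t + 1)) hkl (by omega) (by omega)) hx

/-- Locates the point in the buffer. Register `10` tells whether it is present, register `11`
returns its number. -/
def findProg : Prog :=
  .seq (.set 10 0) <| .seq (.set 20 1) <| .seq (.set 21 2) <| .seq (.set 22 (.mem 0)) <|
  .seq searchProg <|
  .ite (.lt (.reg 23) (.mem 0))
    (.seq (.set 11 (.digit (.listCell (.reg 20)) (.reg 23))) <|
      .seq (.set 40 (.pointAddr (.reg 11))) <|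
      .seq (.set 41 2) <| .seq (.set 42 1) <| .seq cmpProg <|
      .ite (.eq (.reg 48) 0) (.set 10 1) .skip)
    .skip

theorem SortedList.lt_of_mem {d i n : ℕ} {pts : ℕ → HPoint d} {l : List ℕ}
    (h : SortedList i n pts l) {k : ℕ} (hk : k ∈ l) : k < n := (h.mem_iff k).1 hk

theorem runs_findProg {M d n b : ℕ} (hd : 1 ≤ d) {s : Store} {pts : ℕ → HPoint d}
    {ls : ℕ → List ℕ} {p : HPoint d} (h0 : s.reg 0 = d) (hRep : Represents d n b pts ls s.mem)
    (hp : HoldsPoint s.mem 2 p) (hM : 2 * d + 4 + n * d ≤ M) :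
    Runs M findProg s (8000 * d * Nat.log 2 (n + 2)) (fun s' => Frame 10 s s' ∧
      ((s'.reg 10 = 1 ∧ ∃ k < n, s'.reg 11 = k ∧ pts k = p) ∨
        (s'.reg 10 = 0 ∧ ∀ k < n, pts k ≠ p))) := by
  set lg := Nat.log 2 (n + 2) with hlg
  have hlg1 : 1 ≤ lg := Nat.log_pos one_lt_two (by omega)
  have hdl : d ≤ d * lg := Nat.le_mul_of_pos_right d hlg1
  have hS := hRep.sorted 1 le_rfl (by omega)
  have hlen := hS.length_eq
  have hlt : ∀ x ∈ ls 1, x < 2 ^ b := fun x hx => (hS.lt_of_mem hx).trans_le hRep.n_le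
  have hm0 : ∀ s' : Store, (Term.mem 0).Fits M s' := fun s' => Term.fits_mem_zero (by omega)
  unfold findProg
  refine Runs.set_seq (v := 0) (by simp) (by simp) (T₂ := 5000 * d * lg + 2000 * d + 200) ?_
    (by simp only [Term.cost_ofNat]; rw [mul_assoc, mul_assoc]; omega)
  refine Runs.set_seq (v := 1) (by simp) (by simp) (T₂ := 5000 * d * lg + 2000 * d + 190) ?_
    (by simp; omega)
  refine Runs.set_seq (v := 2) (by simp) (by simp) (T₂ := 5000 * d * lg + 2000 * d + 180) ?_
    (by simp; omega)
  refine Runs.set_seq (v := n) (hm0 _) (by simp [hRep.size]) (T₂ := 5000 * d * lg + 2000 * d + 170)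
    ?_ (by simp; omega)
  refine Runs.seq (runs_searchProg (i := 1) (a := 2) (b := b) (n := n) (pts := pts) (q := p)
    (l := ls 1) hd le_rfl (by omega) (by simp [h0]) (by simp) (by simp) (by simp [hlen])
    hRep.bits (hRep.lists 1 le_rfl (by omega)) hRep.points hp hlen.le
    (fun x hx => hS.lt_of_mem hx) hRep.n_le hS.pairwise hM (by omega)) ?_
    (T₂ := 2000 * d + 170) (by rw [← hlg]; omega)
  rintro s₁ ⟨hF, k, hk, h23, hL1, hL2⟩
  have e0 : s₁.reg 0 = d := by rw [hF.reg 0 (by omega)]; simp [h0]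
  have e10 : s₁.reg 10 = 0 := by rw [hF.reg 10 (by omega)]; simp
  have e20 : s₁.reg 20 = 1 := by rw [hF.reg 20 (by omega)]; simp
  have em : s₁.mem = s.mem := hF.mem
  have hF10 : Frame 10 s s₁ := Frame.trans (((((Frame.refl 10 s).setReg (by omega) _).setReg
    (by omega) _).setReg (by omega) _).setReg (by omega) _) (hF.mono (by omega))
  -- a stored point equal to `p` can only be the first one that is not smaller than `p`
  have hfirst : ∀ j < n, pts j = p → ∃ hk : k < (ls 1).length, pts (ls 1)[k] = p := by
    rintro j hj rfl
    obtain ⟨hkl, h⟩ := getElem_eq_of_split hS.pairwise ((hS.mem_iff j).2 hj) hL1 hL2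
    exact ⟨hkl, by rw [h]⟩
  refine Runs.ite (T₁ := 2000 * d + 160) ⟨by simp, hm0 _⟩ (fun hlt1 => ?_) (fun hlt1 => ?_)
    (by simp [Test.cost]; omega)
  · replace hlt1 : k < n := by simpa [Test.Holds, h23, em, hRep.size] using hlt1
    have hkl : k < (ls 1).length := by omega
    have hxl : (ls 1)[k] ∈ ls 1 := List.getElem_mem hkl
    have hxn := hS.lt_of_mem hxl
    set x := (ls 1)[k] with hx
    have c20 : (Term.reg 20).eval s₁ = (1 : ℕ) := by simp [e20]
    have hxd : (x + 1) * d ≤ n * d := Nat.mul_le_mul_right d hxn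
    have hxd' : (x + 1) * d = x * d + d := by ring
    refine Runs.set_seq (v := x) ?_ ?_ (T₂ := 2000 * d + 110) ?_ ?_
    · exact Term.fits_digit (by omega) (Term.fits_listCell e0 c20 (by omega) (by simp)) (by simp)
    · rw [Term.eval_digit (b := b) (k := k) (l := ls 1) (by rw [em, hRep.bits])
        (by rw [Term.eval_listCell e0 c20, em, hRep.lists 1 le_rfl (by omega)]) (by simp [h23]) hlt,
        List.getD_eq_getElem _ _ hkl]
    · refine Runs.set_seq (v := (2 * d + 4 + x * d : ℕ)) (Term.fits_pointAddr (by simp))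
        (Term.eval_pointAddr (by simp [e0]) (by simp)) (T₂ := 2000 * d + 90) ?_ ?_
      swap
      · have : (Term.pointAddr (.reg 11)).cost ≤ 15 := by decide
        omega
      refine Runs.set_seq (v := 2) (by simp) (by simp) (T₂ := 2000 * d + 80) ?_ (by simp; omega)
      refine Runs.set_seq (v := 1) (by simp) (by simp) (T₂ := 2000 * d + 70) ?_ (by simp; omega)
      refine Runs.seq (runs_cmpProg (a := 2 * d + 4 + x * d) (b := 2) (i := 1) (p := pts x) (q := p)
        hd le_rfl (by omega) (by simp [e0]) (by simp) (by simp) (by simp) ?_ ?_ (by omega)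
        (by omega)) ?_ (T₂ := 50) (by omega)
      · simp only [Store.setReg_mem, em]; exact hRep.points x hxn
      · simp only [Store.setReg_mem, em]; exact hp
      rintro s₂ ⟨hF₂, hcmp⟩
      have f10 : s₂.reg 10 = 0 := by rw [hF₂.reg 10 (by omega)]; simp [e10]
      have f11 : s₂.reg 11 = x := by rw [hF₂.reg 11 (by omega)]; simp
      have hF₃ : Frame 10 s s₂ := Frame.trans ((((hF10.setReg (by omega) _).setReg (by omega)
        _).setReg (by omega) _).setReg (by omega) _) (hF₂.mono (by omega))
      refine Runs.ite (T₁ := 10) (by simp [Test.Fits]) (fun h48 => ?_) (fun h48 => ?_) (by decide)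
      · have h48 : s₂.reg 48 = 0 := by simpa [Test.Holds] using h48
        refine Runs.set (by simp) (by decide) ⟨hF₃.setReg le_rfl _, .inl ⟨by simp, x, hxn, ?_, ?_⟩⟩
        · simp [f11]
        · rcases hcmp with ⟨-, h⟩ | ⟨h, -⟩ | ⟨h, -⟩
          · exact h
          · norm_num [h] at h48
          · norm_num [h] at h48
      · have h48 : s₂.reg 48 ≠ 0 := by simpa [Test.Holds] using h48
        refine Runs.skip (by omega) ⟨hF₃, .inr ⟨f10, fun j hj hjp => ?_⟩⟩
        obtain ⟨_, h⟩ := hfirst j hj hjp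
        rw [← hx] at h
        rcases hcmp with ⟨h', -⟩ | ⟨-, h'⟩ | ⟨-, h'⟩
        · exact h48 h'
        · exact HLt.irrefl (h ▸ h')
        · exact HLt.irrefl (h ▸ h')
    · have : (Term.digit (.listCell (.reg 20)) (.reg 23)).cost ≤ 45 := by decide
      omega
  · replace hlt1 : n ≤ k := by simpa [Test.Holds, h23, em, hRep.size] using hlt1
    refine Runs.skip (by omega) ⟨hF10, .inr ⟨e10, fun j hj hjp => ?_⟩⟩
    obtain ⟨h, -⟩ := hfirst j hj hjp
    omega

/-! ### Insertion -/

theorem SortedList.insert {d i n : ℕ} (hd : 1 ≤ d) (hi1 : 1 ≤ i) (hi : i ≤ d + 1)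
    {pts : ℕ → HPoint d} {p : HPoint d} {l : List ℕ} (h : SortedList i n pts l)
    (hp : ∀ k < n, pts k ≠ p) {k : ℕ} (h1 : ∀ x ∈ l.take k, HLt i (pts x) p)
    (h2 : ∀ x ∈ l.drop k, ¬ HLt i (pts x) p) :
    SortedList i (n + 1) (Function.update pts n p) (l.take k ++ n :: l.drop k) := by
  have hu : ∀ x ∈ l, Function.update pts n p x = pts x := fun x hx =>
    Function.update_of_ne (h.lt_of_mem hx).ne _ _
  have h2' : ∀ x ∈ l.drop k, HLt i p (pts x) := fun x hx => by
    rcases HLt.trichotomy hd hi1 hi (pts x) p with h' | h' | h'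
    · exact absurd h' (hp x (h.lt_of_mem (List.mem_of_mem_drop hx)))
    · exact absurd h' (h2 x hx)
    · exact h'
  have hpw : (l.take k ++ l.drop k).Pairwise fun a b => HLt i (pts a) (pts b) := by
    rw [List.take_append_drop]; exact h.pairwise
  rw [List.pairwise_append] at hpw
  have ht : ∀ x ∈ l.take k, Function.update pts n p x = pts x := fun x hx =>
    hu x (List.mem_of_mem_take hx)
  have hdr : ∀ x ∈ l.drop k, Function.update pts n p x = pts x := fun x hx =>
    hu x (List.mem_of_mem_drop hx)
  constructor
  · rw [List.pairwise_append, List.pairwise_cons]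
    refine ⟨hpw.1.imp_of_mem fun ha hb hab => ?_, ⟨fun x hx => ?_,
      hpw.2.1.imp_of_mem fun ha hb hab => ?_⟩, fun a ha b hb => ?_⟩
    · rwa [ht _ ha, ht _ hb]
    · rw [Function.update_self, hdr x hx]; exact h2' x hx
    · rwa [hdr _ ha, hdr _ hb]
    · rw [ht a ha]
      rcases List.mem_cons.1 hb with rfl | hb
      · rw [Function.update_self]; exact h1 a ha
      · rw [hdr b hb]; exact hpw.2.2 a ha b hb
  · intro x
    have := h.mem_iff x
    rw [← List.take_append_drop k l, List.mem_append] at this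
    rw [List.mem_append, List.mem_cons]
    constructor
    · rintro (h' | rfl | h')
      · have := this.1 (.inl h'); omega
      · omega
      · have := this.1 (.inr h'); omega
    · intro hx
      rcases Nat.lt_succ_iff_lt_or_eq.1 hx with h' | rfl
      · exact (this.2 h').elim .inl fun h => .inr (.inr h)
      · exact .inr (.inl rfl)

/-- Makes room for one more point number in the packed lists: if the `2 ^ b` numbers that fit into
the digits are used up, the digits are widened to `(n + 1) b` bits. -/
def widenProg : Prog :=
  .ite (.eq (.mem 0) (.pow2 (.mem 1)))
    (.seq (forOrders 12 (.store (.reg 0 + 2 + .reg 12) (.widen (.listCell (.reg 12)))))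
      (.store 1 ((.mem 0 + 1) * .mem 1)))
    .skip

theorem runs_widenProg {M d n b : ℕ} (hd : 1 ≤ d) {s : Store} {pts : ℕ → HPoint d}
    {ls : ℕ → List ℕ} (h0 : s.reg 0 = d) (hRep : Represents d n b pts ls s.mem)
    (hM : 2 * d + 4 + n * d ≤ M) :
    Runs M widenProg s (1000 * d) (fun s' => ∃ m b', Writes 12 m s s' ∧
      Represents d n b' pts ls m ∧ n < 2 ^ b' ∧ ∀ j < d, m (2 + j) = s.mem (2 + j)) := by
  have hm0 : ∀ s' : Store, (Term.mem 0).Fits M s' := fun s' => Term.fits_mem_zero (by omega)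
  have hm1 : ∀ s' : Store, (Term.mem 1).Fits M s' := fun s' => Term.fits_mem_one (by omega)
  unfold widenProg
  refine Runs.ite (T₁ := (d + 1) * 200 + 100) ⟨hm0 _, by simp [hm1]⟩ (fun heq => ?_) (fun hne => ?_)
    (by simp [Test.cost]; omega)
  swap
  · refine Runs.skip (by omega) ⟨s.mem, b, Writes.refl _ _, hRep, lt_of_le_of_ne hRep.n_le ?_,
      fun _ _ => rfl⟩
    rintro rfl
    simp [Test.Holds, hRep.size, hRep.bits] at hne
  replace heq : n = 2 ^ b := by
    have : (n : ℝ) = (2 : ℝ) ^ b := by simpa [Test.Holds, hRep.size, hRep.bits] using heq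
    exact_mod_cast this
  have hn1 : 0 < n := by rw [heq]; positivity
  have hb0 : 0 < b := hRep.b_pos
  set b' := (n + 1) * b with hb'
  have hnb' : n < 2 ^ b' := Nat.lt_two_pow_self.trans_le
    (Nat.pow_le_pow_right two_pos (by rw [hb']; nlinarith))
  refine Runs.seq (runs_forOrders_update (d := d) (T := 100)
    (P := fun i v => v = (Nat.ofDigits (2 ^ b') (ls i) : ℕ)) (by omega) h0 ?_) ?_
    (T₂ := 20) (by omega)
  · intro i hi1 hi s₁ m hm hW hr
    have hS := hRep.sorted i hi1 hi
    have hlen := hS.length_eq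
    have e0 : s₁.reg 0 = d := by rw [hW.reg 0 (by omega), h0]
    have e12 : (Term.reg 12).eval s₁ = i := by simp [hr]
    have m0 : s₁.mem 0 = (ls i).length := by
      rw [hW.mem, hm.other 0 (by omega), hRep.size, hlen]
    have m1 : s₁.mem 1 = b := by rw [hW.mem, hm.other 1 (by omega), hRep.bits]
    have hL : (Term.listCell (.reg 12)).eval s₁ = (Nat.ofDigits (2 ^ b) (ls i) : ℕ) := by
      rw [Term.eval_listCell e0 e12, hW.mem, hm.old i hi1 hi le_rfl, hRep.lists i hi1 hi]
    refine Runs.store (k := d + 2 + i) (by simp)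
      (Term.fits_widen (by omega) (Term.fits_listCell e0 e12 (by omega) (by simp)))
      (by simp [e0, hr])
      (Term.eval_widen m0 m1 hL hb0 (fun x hx => (hS.lt_of_mem hx).trans_le hRep.n_le) (by omega))
      (by omega) (by decide) ⟨_, rfl, ?_⟩
    rw [hlen]
    have := (Writes.refl (12 + 1) s₁).setMem (d + 2 + i)
      ((Nat.ofDigits (2 ^ b') (ls i) : ℕ) : ℝ)
    rwa [hW.mem] at this
  · rintro s₁ ⟨m, hm, hW⟩
    have m0 : s₁.mem 0 = n := by rw [hW.mem, hm.other 0 (by omega), hRep.size]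
    have m1 : s₁.mem 1 = b := by rw [hW.mem, hm.other 1 (by omega), hRep.bits]
    refine Runs.store (k := 1) (v := (b' : ℕ)) (by simp) (by simp [hm0, hm1]) (by simp) ?_ (by omega)
      (by decide) ⟨_, b', hW.setMem 1 _, ⟨?_, ?_, ?_, hnb'.le, ?_, hRep.sorted, ?_, ?_⟩, hnb', ?_⟩
    · simp [m0, m1, hb']
    · rw [Function.update_of_ne (by omega), hm.other 0 (by omega), hRep.size]
    · rw [Function.update_self]
    · exact Nat.mul_pos (by omega) hb0
    · intro i hi1 hi
      rw [Function.update_of_ne (by omega)]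
      exact hm.new i hi1 hi (by omega)
    · intro k hk j hj
      rw [Function.update_of_ne (by omega), hm.other _ (by omega)]
      exact hRep.points k hk j hj
    · intro a ha
      rw [Function.update_of_ne (by omega), hm.other _ (by omega)]
      exact hRep.zero a ha
    · intro j hj
      rw [Function.update_of_ne (by omega), hm.other _ (by omega)]

/-- Appends the point in the buffer, which must not be present yet. -/
def appendProg : Prog :=
  .seq (forOrders 12 <|
    .seq (.set 20 (.reg 12)) <| .seq (.set 21 2) <| .seq (.set 22 (.mem 0)) <| .seq searchProg <|
    .store (.reg 0 + 2 + .reg 12) (.insertDigit (.listCell (.reg 12)) (.reg 23) (.mem 0))) <|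
  .seq (storeLoop 13 (.pointAddr (.mem 0)) (.mem (2 + .reg 13))) <|
  .store 0 (.mem 0 + 1)

theorem runs_appendProg {M d n b : ℕ} (hd : 1 ≤ d) {s : Store} {pts : ℕ → HPoint d}
    {ls : ℕ → List ℕ} {p : HPoint d} (h0 : s.reg 0 = d) (hRep : Represents d n b pts ls s.mem)
    (hnb : n < 2 ^ b) (hp : HoldsPoint s.mem 2 p) (hnew : ∀ k < n, pts k ≠ p)
    (hM : 2 * d + 4 + (n + 1) * d ≤ M) :
    Runs M appendProg s (13000 * d ^ 2 * Nat.log 2 (n + 2)) (fun s' => ∃ m ls', Writes 12 m s s' ∧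
      Represents d (n + 1) b (Function.update pts n p) ls' m) := by
  have hM' : 2 * d + 4 + n * d + d ≤ M := by rw [add_one_mul] at hM; omega
  have hm0 : ∀ s' : Store, (Term.mem 0).Fits M s' := fun s' => Term.fits_mem_zero (by omega)
  obtain ⟨lg, hlg⟩ : ∃ lg, lg = Nat.log 2 (n + 2) := ⟨_, rfl⟩
  have hlg1 : 1 ≤ lg := hlg ▸ Nat.log_pos one_lt_two (by omega)
  have hd2 : d ≤ d ^ 2 := Nat.le_self_pow two_ne_zero d
  have hdl : d ^ 2 ≤ d ^ 2 * lg := Nat.le_mul_of_pos_right _ hlg1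
  have hTot : (d + 1) * (5000 * d * lg + 150 + 10) + 8 + (d * 60 + 6 + 20) ≤ 13000 * d ^ 2 * lg := by
    have h1 : (d + 1) * (5000 * d * lg + 150 + 10) = 5000 * (d ^ 2 * lg) + 5000 * (d * lg) +
      160 * d + 160 := by ring
    have h2 : d * lg ≤ d ^ 2 * lg := Nat.mul_le_mul_right _ hd2
    have h3 : 13000 * d ^ 2 * lg = 13000 * (d ^ 2 * lg) := by ring
    omega
  rw [← hlg]
  unfold appendProg
  refine Runs.seq (runs_forOrders_update (d := d) (T := 5000 * d * lg + 150)
    (P := fun i v => ∃ l, v = (Nat.ofDigits (2 ^ b) l : ℕ) ∧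
      SortedList i (n + 1) (Function.update pts n p) l) (by omega) h0 ?_) ?_
    (T₂ := d * 60 + 6 + 20) hTot
  · intro i hi1 hi s₁ m hm hW hr
    have hS := hRep.sorted i hi1 hi
    have hlen := hS.length_eq
    have e0 : s₁.reg 0 = d := by rw [hW.reg 0 (by omega), h0]
    have m0 : s₁.mem 0 = n := by rw [hW.mem, hm.other 0 (by omega), hRep.size]
    have m1 : s₁.mem 1 = b := by rw [hW.mem, hm.other 1 (by omega), hRep.bits]
    have mL : s₁.mem (d + 2 + i) = (Nat.ofDigits (2 ^ b) (ls i) : ℕ) := by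
      rw [hW.mem, hm.old i hi1 hi le_rfl, hRep.lists i hi1 hi]
    refine Runs.set_seq (v := i) (by simp) (by simp [hr]) (T₂ := 5000 * d * lg + 140) ?_
      (by simp; omega)
    refine Runs.set_seq (v := 2) (by simp) (by simp) (T₂ := 5000 * d * lg + 130) ?_
      (by simp; omega)
    refine Runs.set_seq (v := n) (hm0 _) (by simp [m0]) (T₂ := 5000 * d * lg + 120) ?_
      (by simp; omega)
    refine Runs.seq (runs_searchProg (i := i) (a := 2) (b := b) (n := n) (pts := pts) (q := p)
      (l := ls i) hd hi1 hi (by simp [e0]) (by simp) (by simp) (by simp [hlen])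
      m1 mL (fun k hk j hj => ?_) (fun j hj => ?_) hlen.le
      (fun x hx => hS.lt_of_mem hx) hRep.n_le hS.pairwise (by omega) (by omega)) ?_
      (T₂ := 110) (by rw [← hlg]; omega)
    · rw [Store.setReg_mem, Store.setReg_mem, Store.setReg_mem, hW.mem, hm.other _ (by omega)]
      exact hRep.points k hk j hj
    · rw [Store.setReg_mem, Store.setReg_mem, Store.setReg_mem, hW.mem, hm.other _ (by omega)]
      exact hp j hj
    rintro s₂ ⟨hF, k, hk, h23, hL1, hL2⟩
    have f0 : s₂.reg 0 = d := by rw [hF.reg 0 (by omega)]; simp [e0]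
    have f12 : (Term.reg 12).eval s₂ = i := by rw [Term.eval_reg, hF.reg 12 (by omega)]; simp [hr]
    have fm : s₂.mem = s₁.mem := hF.mem
    have hlt : ∀ x ∈ ls i, x < 2 ^ b := fun x hx => (hS.lt_of_mem hx).trans_le hRep.n_le
    refine Runs.store (k := d + 2 + i) (by simp)
      (Term.fits_insertDigit (by omega) (Term.fits_listCell f0 f12 (by omega) (by simp)) (by simp)
        (hm0 _)) (by rw [Term.eval_add, f12]; simp [f0])
      (Term.eval_insertDigit (x := n) (by rw [fm, m1])
        (by rw [Term.eval_listCell f0 f12, fm, mL]) (by simp [h23]) (by simp [fm, m0]) hlt hk)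
      (by omega) (by decide) ⟨_, ⟨_, rfl, hS.insert hd hi1 hi hnew hL1 hL2⟩, ?_⟩
    have hF' : Frame 13 s₁ s₂ := Frame.trans ((((Frame.refl 13 s₁).setReg (by omega) _).setReg
      (by omega) _).setReg (by omega) _) (hF.mono (by omega))
    have := (hF'.writes).setMem (d + 2 + i)
      ((Nat.ofDigits (2 ^ b) ((ls i).take k ++ n :: (ls i).drop k) : ℕ) : ℝ)
    rwa [hW.mem] at this
  · rintro s₁ ⟨m, hm, hW⟩
    have m0 : m 0 = n := by rw [hm.other 0 (by omega), hRep.size]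
    have e0 : s₁.reg 0 = d := by rw [hW.reg 0 (by omega), h0]
    refine Runs.seq (runs_storeLoop (d := d) (a := 2 * d + 4 + n * d) (v := p.coord) (by omega) e0
      hM' ?_) ?_ (T₂ := 20) ?_
    · intro j hj s₂ hW₂ hrj
      have hmem : ∀ a < 2 * d + 4, s₂.mem a = m a := fun a ha => by
        rw [hW₂.mem, writeBlock_of_lt (by omega), hW.mem]
      have g0 : s₂.reg 0 = d := by rw [hW₂.reg 0 (by omega), e0]
      have gn : (Term.mem 0).eval s₂ = n := by rw [Term.eval_mem_zero, hmem 0 (by omega), m0]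
      have ha : (2 + Term.reg 13 : Term).eval s₂ = (2 + j : ℕ) := by simp [hrj]
      refine ⟨⟨Term.fits_pointAddr (hm0 _), Term.eval_pointAddr g0 gn⟩,
        Term.fits_mem_of ha (by omega) (by simp), ?_⟩
      rw [Term.eval_mem_of ha, hmem _ (by omega), hm.other _ (by omega), hp j hj]
    swap
    · have h1 : (Term.pointAddr (.mem 0)).cost = 10 := by decide
      have h2 : (Term.mem (2 + .reg 13)).cost = 4 := by decide
      rw [h1, h2]; omega
    rintro s₂ hW₂
    set m₂ := writeBlock s₁.mem (2 * d + 4 + n * d) d p.coord with hm₂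
    rw [hW.mem] at hm₂
    choose! ls' hls' using hm.new
    refine Runs.store (k := 0) (v := (n + 1 : ℕ)) (by simp) (by simp [hm0]) (by simp) ?_ (by omega)
      (by decide) ⟨_, ls', (hW.trans (hW₂.mono (by omega))).setMem 0 _, ⟨?_, ?_, hRep.b_pos, hnb,
        ?_, ?_, ?_, ?_⟩⟩
    · simp [hW₂.mem, hm₂, writeBlock_of_lt, m0]
    · rw [Function.update_self]
    · rw [Function.update_of_ne (by omega), hm₂, writeBlock_of_lt (by omega), hm.other 1 (by omega),
        hRep.bits]
    · intro i hi1 hi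
      rw [Function.update_of_ne (by omega), hm₂, writeBlock_of_lt (by omega)]
      exact (hls' i hi1 hi (by omega)).1
    · exact fun i hi1 hi => (hls' i hi1 hi (by omega)).2
    · intro k hk j hj
      rw [Function.update_of_ne (by omega), hm₂]
      rcases Nat.lt_succ_iff_lt_or_eq.1 hk with h | rfl
      · have : (k + 1) * d ≤ n * d := Nat.mul_le_mul_right d h
        rw [add_one_mul] at this
        rw [writeBlock_of_lt (by omega), hm.other _ (by omega), Function.update_of_ne h.ne]
        exact hRep.points k h j hj
      · rw [writeBlock_add hj, Function.update_self]
    · intro a ha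
      rw [add_one_mul] at ha
      rw [Function.update_of_ne (by omega), hm₂, writeBlock_of_ge (by omega),
        hm.other _ (by omega)]
      exact hRep.zero a (by omega)

/-- Inserts the point in the buffer. -/
def insertProg : Prog :=
  .seq findProg <| .ite (.eq (.reg 10) 0) (.seq widenProg appendProg) .skip

theorem runs_insertProg {M d n b : ℕ} (hd : 1 ≤ d) {s : Store} {pts : ℕ → HPoint d}
    {ls : ℕ → List ℕ} {p : HPoint d} (h0 : s.reg 0 = d) (hRep : Represents d n b pts ls s.mem)
    (hp : HoldsPoint s.mem 2 p) (hM : 2 * d + 4 + (n + 1) * d ≤ M) :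
    Runs M insertProg s (25000 * d ^ 2 * Nat.log 2 (n + 2)) (fun s' => ∃ m, Writes 10 m s s' ∧
      (((∃ k < n, pts k = p) ∧ m = s.mem) ∨ ((∀ k < n, pts k ≠ p) ∧
        ∃ b' ls', Represents d (n + 1) b' (Function.update pts n p) ls' m))) := by
  have hM' : 2 * d + 4 + n * d + d ≤ M := by rw [add_one_mul] at hM; omega
  obtain ⟨lg, hlg⟩ : ∃ lg, lg = Nat.log 2 (n + 2) := ⟨_, rfl⟩
  have hlg1 : 1 ≤ lg := hlg ▸ Nat.log_pos one_lt_two (by omega)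
  have hd2 : d ≤ d ^ 2 := Nat.le_self_pow two_ne_zero d
  have hdl : d ^ 2 ≤ d ^ 2 * lg := Nat.le_mul_of_pos_right _ hlg1
  have hdl2 : d * lg ≤ d ^ 2 * lg := Nat.mul_le_mul_right _ hd2
  have h1 : 25000 * d ^ 2 * lg = 25000 * (d ^ 2 * lg) := by ring
  have h2 : 13000 * d ^ 2 * lg = 13000 * (d ^ 2 * lg) := by ring
  have h3 : 8000 * d * lg = 8000 * (d * lg) := by ring
  unfold insertProg
  refine Runs.seq (runs_findProg hd h0 hRep hp (by omega)) ?_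
    (T₂ := 1000 * d + 13000 * d ^ 2 * lg + 4) (by rw [← hlg]; omega)
  rintro s₁ ⟨hF, hcase⟩
  refine Runs.ite (T₁ := 1000 * d + 13000 * d ^ 2 * lg) (by simp [Test.Fits]) (fun h10 => ?_)
    (fun h10 => ?_) (by simp [Test.cost]; omega)
  · replace h10 : s₁.reg 10 = 0 := by simpa [Test.Holds] using h10
    have hnew : ∀ k < n, pts k ≠ p := by
      rcases hcase with ⟨h, -⟩ | ⟨-, h⟩
      · norm_num [h10] at h
      · exact h
    have e0 : s₁.reg 0 = d := by rw [hF.reg 0 (by omega), h0]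
    refine Runs.seq (runs_widenProg hd e0 (by rw [hF.mem]; exact hRep) (by omega)) ?_ le_rfl
    rintro s₂ ⟨m, b', hW, hRep', hlt, hbuf⟩
    refine (runs_appendProg hd (by rw [hW.reg 0 (by omega), e0]) (by rw [hW.mem]; exact hRep') hlt
      (fun j hj => ?_) hnew hM).mono (by rw [hlg]) ?_
    · rw [hW.mem, hbuf j hj, hF.mem, hp j hj]
    · rintro s₃ ⟨m', ls', hW', hRep''⟩
      exact ⟨m', ((hF.writes).trans (hW.mono (by omega))).trans (hW'.mono (by omega)),
        .inr ⟨hnew, b', ls', hRep''⟩⟩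
  · replace h10 : s₁.reg 10 ≠ 0 := by simpa [Test.Holds] using h10
    refine Runs.skip (by omega) ⟨_, hF.writes, .inl ⟨?_, rfl⟩⟩
    rcases hcase with ⟨-, k, hk, -, h⟩ | ⟨h, -⟩
    · exact ⟨k, hk, h⟩
    · exact absurd h h10

/-! ### Deletion -/

theorem List.Nodup.mem_take_append_drop_succ {l : List ℕ} (h : l.Nodup) {k : ℕ}
    (hk : k < l.length) (x : ℕ) : x ∈ l.take k ++ l.drop (k + 1) ↔ x ∈ l ∧ x ≠ l[k] := by
  have e : l = l.take k ++ l[k] :: l.drop (k + 1) := by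
    rw [← List.drop_eq_getElem_cons hk, List.take_append_drop]
  have h' := h
  rw [e, List.nodup_middle, List.nodup_cons] at h'
  constructor
  · intro hx
    refine ⟨?_, ?_⟩
    · rw [List.mem_append] at hx
      exact hx.elim List.mem_of_mem_take List.mem_of_mem_drop
    · rintro rfl
      exact h'.1 hx
  · rintro ⟨hx, hne⟩
    rw [e, List.mem_append, List.mem_cons] at hx
    rw [List.mem_append]
    tauto

/-- Removing the `k`-th entry `s` of a sorted list and renaming the last point `n` to `s`. -/
theorem SortedList.remove {d i n s : ℕ} {pts : ℕ → HPoint d} {l : List ℕ}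
    (h : SortedList i (n + 1) pts l) (hs : s ≤ n) {l' : List ℕ}
    (hsub : l'.Sublist l) (hmem : ∀ x, x ∈ l' ↔ x ∈ l ∧ x ≠ s) :
    SortedList i n (Function.update pts s (pts n)) (l'.map fun x => if x = n then s else x) := by
  have hval : ∀ x ∈ l', Function.update pts s (pts n) (if x = n then s else x) = pts x := by
    intro x hx
    split_ifs with hxn
    · rw [Function.update_self, hxn]
    · rw [Function.update_of_ne ((hmem x).1 hx).2]
  constructor
  · rw [List.pairwise_map]
    refine (h.pairwise.sublist hsub).imp_of_mem fun ha hb hab => ?_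
    rwa [hval _ ha, hval _ hb]
  · intro k
    rw [List.mem_map]
    constructor
    · rintro ⟨x, hx, rfl⟩
      obtain ⟨h1, h2⟩ := (hmem x).1 hx
      have := h.lt_of_mem h1
      split_ifs with hxn
      · omega
      · omega
    · intro hk
      by_cases hks : k = s
      · exact ⟨n, (hmem n).2 ⟨(h.mem_iff n).2 (by omega), by omega⟩, by simp [hks]⟩
      · exact ⟨k, (hmem k).2 ⟨(h.mem_iff k).2 (by omega), hks⟩, by simp [show k ≠ n by omega]⟩

/-- Removes the point in the buffer, whose number is in register `11`; the last point takes over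
this number. -/
def removeProg : Prog :=
  .seq (forOrders 12 <|
    .seq (.set 20 (.reg 12)) <| .seq (.set 21 2) <| .seq (.set 22 (.mem 0)) <| .seq searchProg <|
    .seq (.store (.reg 0 + 2 + .reg 12) (.removeDigit (.listCell (.reg 12)) (.reg 23))) <|
    .seq (.set 20 (.reg 12)) <| .seq (.set 21 (.pointAddr (.mem 0 - 1))) <|
    .seq (.set 22 (.mem 0 - 1)) <| .seq searchProg <|
    .store (.reg 0 + 2 + .reg 12)
      (.replaceDigit (.listCell (.reg 12)) (.reg 23) (.reg 11) (.mem 0 - 1))) <|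
  .seq (storeLoop 13 (.pointAddr (.reg 11)) (.mem (.pointAddr (.mem 0 - 1) + .reg 13))) <|
  .seq (storeLoop 13 (.pointAddr (.mem 0 - 1)) 0) <|
  .store 0 (.mem 0 - 1)

/-- Updating the list of a single order on removal of a point. -/
theorem runs_removeProg_body {M d n b σ i : ℕ} (hd : 1 ≤ d) {s : Store} {pts : ℕ → HPoint d}
    {l : List ℕ} (h0 : s.reg 0 = d) (h11 : s.reg 11 = σ) (hσ : σ ≤ n)
    (hi1 : 1 ≤ i) (hi : i ≤ d + 1) (h12 : s.reg 12 = i) (m0 : s.mem 0 = (n + 1 : ℕ))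
    (m1 : s.mem 1 = b) (mL : s.mem (d + 2 + i) = (Nat.ofDigits (2 ^ b) l : ℕ))
    (hS : SortedList i (n + 1) pts l) (hpts : PointsAt (n + 1) pts s.mem) (hnb : n + 1 ≤ 2 ^ b)
    (hp : HoldsPoint s.mem 2 (pts σ)) (hM : 2 * d + 4 + (n + 1) * d ≤ M) :
    Runs M (.seq (.set 20 (.reg 12)) <| .seq (.set 21 2) <| .seq (.set 22 (.mem 0)) <|
      .seq searchProg <|
      .seq (.store (.reg 0 + 2 + .reg 12) (.removeDigit (.listCell (.reg 12)) (.reg 23))) <|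
      .seq (.set 20 (.reg 12)) <| .seq (.set 21 (.pointAddr (.mem 0 - 1))) <|
      .seq (.set 22 (.mem 0 - 1)) <| .seq searchProg <|
      .store (.reg 0 + 2 + .reg 12)
        (.replaceDigit (.listCell (.reg 12)) (.reg 23) (.reg 11) (.mem 0 - 1))) s
      (10000 * d * Nat.log 2 (n + 1 + 2) + 400) (fun s' => ∃ l',
        SortedList i n (Function.update pts σ (pts n)) l' ∧
        Writes 13 (Function.update s.mem (d + 2 + i) (Nat.ofDigits (2 ^ b) l' : ℕ)) s s') := by
  have hM' : 2 * d + 4 + n * d + d ≤ M := by rw [add_one_mul] at hM; omega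
  have hm0 : ∀ s' : Store, (Term.mem 0).Fits M s' := fun s' => Term.fits_mem_zero (by omega)
  obtain ⟨lg, hlg⟩ : ∃ lg, lg = Nat.log 2 (n + 1 + 2) := ⟨_, rfl⟩
  rw [← hlg]
  have hlen := hS.length_eq
  have hlt : ∀ x ∈ l, x < 2 ^ b := fun x hx => (hS.lt_of_mem hx).trans_le hnb
  refine Runs.set_seq (v := i) (by simp) (by simp [h12]) (T₂ := 10000 * d * lg + 390) ?_
    (by simp; omega)
  refine Runs.set_seq (v := 2) (by simp) (by simp) (T₂ := 10000 * d * lg + 380) ?_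
    (by simp; omega)
  refine Runs.set_seq (v := (n + 1 : ℕ)) (hm0 _) (by simp [m0]) (T₂ := 10000 * d * lg + 370) ?_
    (by simp; omega)
  have h10 : 10000 * d * lg = 5000 * d * lg + 5000 * d * lg := by ring
  refine Runs.seq (runs_searchProg (i := i) (a := 2) (b := b) (n := n + 1) (pts := pts)
    (q := pts σ) (l := l) hd hi1 hi (by simp [h0]) (by simp) (by simp) (by simp [hlen])
    m1 mL hpts hp hlen.le (fun x hx => hS.lt_of_mem hx) hnb hS.pairwise (by omega) (by omega)) ?_
    (T₂ := 5000 * d * lg + 370) (by rw [← hlg]; omega)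
  rintro s₁ ⟨hF, k, hk, h23, hL1, hL2⟩
  obtain ⟨hkl, hkσ⟩ := getElem_eq_of_split hS.pairwise ((hS.mem_iff σ).2 (by omega)) hL1 hL2
  have hmem1 : s₁.mem = s.mem := hF.mem
  have hF13 : Frame 13 s s₁ := Frame.trans ((((Frame.refl 13 s).setReg (by omega) _).setReg
      (by omega) _).setReg (by omega) _) (hF.mono (by omega))
  have e0 : s₁.reg 0 = d := by rw [hF13.reg 0 (by omega), h0]
  have e11 : s₁.reg 11 = σ := by rw [hF13.reg 11 (by omega), h11]
  have e12 : s₁.reg 12 = i := by rw [hF13.reg 12 (by omega), h12]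
  have t12 : (Term.reg 12).eval s₁ = i := e12
  set l₁ := l.take k ++ l.drop (k + 1) with hl₁
  have hmem₁ : ∀ x, x ∈ l₁ ↔ x ∈ l ∧ x ≠ σ := fun x => by
    rw [hl₁, hS.nodup.mem_take_append_drop_succ hkl, hkσ]
  have hsub₁ : l₁.Sublist l := by
    conv_rhs => rw [← List.take_append_drop k l]
    exact List.Sublist.append_left (List.drop_sublist_drop_left l (Nat.le_succ k)) _
  have hlen₁ : l₁.length = n := by
    rw [hl₁, List.length_append, List.length_take, List.length_drop]
    omega
  refine Runs.store_seq (k := d + 2 + i) (by simp)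
    (Term.fits_removeDigit (by omega) (Term.fits_listCell e0 t12 (by omega) (by simp)) (by simp))
    (by simp [e0, e12])
    (Term.eval_removeDigit (by rw [hmem1, m1]) (by rw [Term.eval_listCell e0 t12, hmem1, mL])
      (by simp [h23]) hlt hkl.le) (by omega) (T₂ := 5000 * d * lg + 270) ?_ ?_
  swap
  · have h1 : (Term.reg 0 + 2 + .reg 12).cost = 5 := by decide
    have h2 : (Term.removeDigit (.listCell (.reg 12)) (.reg 23)).cost ≤ 80 := by decide
    omega
  rw [← hl₁]
  set s₂ := s₁.setMem (d + 2 + i) (Nat.ofDigits (2 ^ b) l₁ : ℕ) with hs₂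
  have hW₂ : Writes 13 (Function.update s.mem (d + 2 + i) (Nat.ofDigits (2 ^ b) l₁ : ℕ)) s s₂ :=
    hF13.writes.setMem _ _
  have g0 : s₂.reg 0 = d := e0
  have g12 : s₂.reg 12 = i := e12
  have gm0 : s₂.mem 0 = n + 1 := by
    rw [hW₂.mem, Function.update_of_ne (by omega), m0]; push_cast; rfl
  have gm1 : s₂.mem 1 = b := by rw [hW₂.mem, Function.update_of_ne (by omega), m1]
  refine Runs.set_seq (v := i) (by simp) (by simp [g12]) (T₂ := 5000 * d * lg + 260) ?_
    (by simp; omega)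
  refine Runs.set_seq (v := (2 * d + 4 + n * d : ℕ)) (Term.fits_pointAddr (by simp [hm0]))
    (Term.eval_pointAddr (by simp [g0]) (by simp [gm0])) (T₂ := 5000 * d * lg + 230) ?_ ?_
  swap
  · have h1 : (Term.pointAddr (.mem 0 - 1)).cost ≤ 15 := by decide
    omega
  refine Runs.set_seq (v := n) (by simp [hm0]) (by simp [gm0]) (T₂ := 5000 * d * lg + 220)
    ?_ (by simp; omega)
  refine Runs.seq (runs_searchProg (i := i) (a := 2 * d + 4 + n * d) (b := b) (n := n + 1)
    (pts := pts) (q := pts n) (l := l₁) hd hi1 hi (by simp [g0]) (by simp) (by simp)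
    (by simp [hlen₁]) gm1 ?_ ?_ ?_ (by omega) (fun x hx => hS.lt_of_mem (hsub₁.subset hx)) hnb
    (hS.pairwise.sublist hsub₁) (by omega) (by omega)) ?_ (T₂ := 200) (by rw [← hlg]; omega)
  · simp only [Store.setReg_mem]; rw [hW₂.mem, Function.update_self]
  · intro k hk j hj
    simp only [Store.setReg_mem]
    rw [hW₂.mem, Function.update_of_ne (by omega)]
    exact hpts k hk j hj
  · intro j hj
    simp only [Store.setReg_mem]
    rw [hW₂.mem, Function.update_of_ne (by omega)]
    exact hpts n (by omega) j hj
  rintro s₃ ⟨hF₃, k', hk', h23', hL1', hL2'⟩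
  have hF₃' : Frame 13 s₂ s₃ := Frame.trans ((((Frame.refl 13 s₂).setReg (by omega) _).setReg
      (by omega) _).setReg (by omega) _) (hF₃.mono (by omega))
  have f0 : s₃.reg 0 = d := by rw [hF₃'.reg 0 (by omega), g0]
  have f11 : s₃.reg 11 = σ := by rw [hF₃'.reg 11 (by omega)]; exact e11
  have f12 : s₃.reg 12 = i := by rw [hF₃'.reg 12 (by omega), g12]
  have t12' : (Term.reg 12).eval s₃ = i := f12
  have fL : (Term.listCell (.reg 12)).eval s₃ = (Nat.ofDigits (2 ^ b) l₁ : ℕ) := by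
    rw [Term.eval_listCell f0 t12', hF₃'.mem, hW₂.mem, Function.update_self]
  have fn : (Term.mem 0 - 1).eval s₃ = n := by simp [hF₃'.mem, gm0]
  have fb : s₃.mem 1 = b := by rw [hF₃'.mem, gm1]
  have hval : (Term.replaceDigit (.listCell (.reg 12)) (.reg 23) (.reg 11) (.mem 0 - 1)).eval s₃ =
      (Nat.ofDigits (2 ^ b) (l₁.map fun x => if x = n then σ else x) : ℕ) := by
    have hmapid : ∀ l' : List ℕ, (∀ x ∈ l', x ≠ n) →
        l'.map (fun x => if x = n then σ else x) = l' := fun l' h =>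
      (List.map_congr_left fun x hx => if_neg (h x hx)).trans (List.map_id' l')
    rcases Nat.eq_or_lt_of_le hσ with rfl | hσn
    · rw [hmapid l₁ fun x hx => ((hmem₁ x).1 hx).2, Term.replaceDigit, Term.eval_add, Term.eval_mul, Term.eval_sub, fL, fn, Term.eval_reg, f11,
        sub_self, zero_mul, add_zero]
    · have hn₁ : n ∈ l₁ := (hmem₁ n).2 ⟨(hS.mem_iff n).2 (by omega), by omega⟩
      obtain ⟨hk₁, hkn⟩ := getElem_eq_of_split (hS.pairwise.sublist hsub₁) hn₁ hL1' hL2'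
      have hnd : l₁.Nodup := hS.nodup.sublist hsub₁
      rw [Term.eval_replaceDigit fb fL (by simp [h23']) (x := σ) (y := n) (by simp [f11]) fn hk₁ hkn]
      have e : l₁ = l₁.take k' ++ n :: l₁.drop (k' + 1) := by
        rw [← hkn, ← List.drop_eq_getElem_cons hk₁, List.take_append_drop]
      have hne : ∀ x ∈ l₁.take k' ++ l₁.drop (k' + 1), x ≠ n := fun x hx => by
        rw [hnd.mem_take_append_drop_succ hk₁, hkn] at hx
        exact hx.2
      congr 2
      conv_rhs => rw [e]
      rw [List.map_append, List.map_cons, if_pos rfl,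
        hmapid (l₁.take k') fun x hx => hne x (List.mem_append_left _ hx),
        hmapid (l₁.drop (k' + 1)) fun x hx => hne x (List.mem_append_right _ hx)]
  refine Runs.store (k := d + 2 + i) (by simp)
    (Term.fits_replaceDigit (by omega) (Term.fits_listCell f0 t12' (by omega) (by simp)) (by simp)
      (by simp) (by simp [hm0])) (by simp [f0, f12]) hval (by omega) (by decide)
    ⟨_, hS.remove hσ hsub₁ hmem₁, ?_⟩
  have := (hW₂.frame hF₃').setMem (d + 2 + i)
    ((Nat.ofDigits (2 ^ b) (l₁.map fun x => if x = n then σ else x) : ℕ) : ℝ)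
  rwa [Function.update_idem] at this

theorem runs_removeProg {M d n b σ : ℕ} (hd : 1 ≤ d) {s : Store} {pts : ℕ → HPoint d}
    {ls : ℕ → List ℕ} (h0 : s.reg 0 = d) (h11 : s.reg 11 = σ) (hσ : σ ≤ n)
    (hRep : Represents d (n + 1) b pts ls s.mem) (hp : HoldsPoint s.mem 2 (pts σ))
    (hM : 2 * d + 4 + (n + 1) * d ≤ M) :
    Runs M removeProg s (22000 * d ^ 2 * Nat.log 2 (n + 1 + 2)) (fun s' => ∃ m ls',
      Writes 12 m s s' ∧ Represents d n b (Function.update pts σ (pts n)) ls' m) := by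
  have hM' : 2 * d + 4 + n * d + d ≤ M := by rw [add_one_mul] at hM; omega
  have hm0 : ∀ s' : Store, (Term.mem 0).Fits M s' := fun s' => Term.fits_mem_zero (by omega)
  have hσd : σ * d ≤ n * d := Nat.mul_le_mul_right d hσ
  obtain ⟨lg, hlg⟩ : ∃ lg, lg = Nat.log 2 (n + 1 + 2) := ⟨_, rfl⟩
  have hlg1 : 1 ≤ lg := hlg ▸ Nat.log_pos one_lt_two (by omega)
  have hd2 : d ≤ d ^ 2 := Nat.le_self_pow two_ne_zero d
  have hdl : d ^ 2 ≤ d ^ 2 * lg := Nat.le_mul_of_pos_right _ hlg1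
  have hTot : (d + 1) * (10000 * d * lg + 400 + 10) + 8 + (d * 100 + 40) ≤
      22000 * d ^ 2 * lg := by
    have h1 : (d + 1) * (10000 * d * lg + 400 + 10) = 10000 * (d ^ 2 * lg) + 10000 * (d * lg) +
      410 * d + 410 := by ring
    have h2 : d * lg ≤ d ^ 2 * lg := Nat.mul_le_mul_right _ hd2
    have h3 : 22000 * d ^ 2 * lg = 22000 * (d ^ 2 * lg) := by ring
    omega
  rw [← hlg]
  unfold removeProg
  refine Runs.seq (runs_forOrders_update (d := d) (T := 10000 * d * lg + 400)
    (P := fun i v => ∃ l, v = (Nat.ofDigits (2 ^ b) l : ℕ) ∧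
      SortedList i n (Function.update pts σ (pts n)) l) (by omega) h0 ?_) ?_
    (T₂ := d * 100 + 40) hTot
  · intro i hi1 hi s₁ m hm hW hr
    refine (runs_removeProg_body (b := b) (l := ls i) (pts := pts) hd
      (by rw [hW.reg 0 (by omega), h0]) (by rw [hW.reg 11 (by omega), h11]) hσ hi1 hi hr ?_ ?_ ?_
      (hRep.sorted i hi1 hi) (fun k hk j hj => ?_) hRep.n_le (fun j hj => ?_) hM).mono
      (by rw [hlg]) ?_
    · rw [hW.mem, hm.other 0 (by omega), hRep.size]
    · rw [hW.mem, hm.other 1 (by omega), hRep.bits]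
    · rw [hW.mem, hm.old i hi1 hi le_rfl, hRep.lists i hi1 hi]
    · rw [hW.mem, hm.other _ (by omega)]; exact hRep.points k hk j hj
    · rw [hW.mem, hm.other _ (by omega)]; exact hp j hj
    · rintro s₂ ⟨l', hl', hW'⟩
      rw [hW.mem] at hW'
      exact ⟨_, ⟨l', rfl, hl'⟩, hW'⟩
  · rintro s₁ ⟨m, hm, hW⟩
    have m0 : m 0 = n + 1 := by rw [hm.other 0 (by omega), hRep.size]; push_cast; rfl
    have e0 : s₁.reg 0 = d := by rw [hW.reg 0 (by omega), h0]
    have e11 : s₁.reg 11 = σ := by rw [hW.reg 11 (by omega), h11]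
    -- the last point is copied to its new place
    refine Runs.seq (runs_storeLoop (d := d) (a := 2 * d + 4 + σ * d) (v := (pts n).coord)
      (by omega) e0 (by omega) ?_) ?_ (T₂ := d * 40 + 30) ?_
    · intro j hj s₂ hW₂ hrj
      have g0 : s₂.reg 0 = d := by rw [hW₂.reg 0 (by omega), e0]
      have gn : (Term.mem 0 - 1).eval s₂ = n := by
        simp [hW₂.mem, writeBlock_of_lt, hW.mem, m0]
      have ha : (Term.pointAddr (.mem 0 - 1) + .reg 13).eval s₂ = (2 * d + 4 + n * d + j : ℕ) := by
        rw [Term.eval_add, Term.eval_pointAddr g0 gn, Term.eval_reg, hrj]; push_cast; rfl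
      refine ⟨⟨Term.fits_pointAddr (by simp), Term.eval_pointAddr g0 ?_⟩,
        Term.fits_mem_of ha (by omega) ?_, ?_⟩
      · rw [Term.eval_reg, hW₂.reg 11 (by omega), e11]
      · rw [Term.fits_add]
        exact ⟨Term.fits_pointAddr (by simp [hm0]), by simp⟩
      · rw [Term.eval_mem_of ha, hW₂.mem, writeBlock_of_ge (by omega), hW.mem,
          hm.other _ (by omega)]
        exact hRep.points n (by omega) j hj
    swap
    · have h1 : (Term.pointAddr (.reg 11)).cost ≤ 10 := by decide
      have h2 : (Term.mem (.pointAddr (.mem 0 - 1) + .reg 13)).cost ≤ 16 := by decide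
      have h3 := Nat.mul_le_mul_left d (show (Term.pointAddr (.reg 11)).cost +
        (Term.mem (.pointAddr (.mem 0 - 1) + .reg 13)).cost + 11 ≤ 50 by omega)
      omega
    rintro s₂ hW₂
    rw [hW.mem] at hW₂
    have f0 : s₂.reg 0 = d := by rw [hW₂.reg 0 (by omega), e0]
    refine Runs.seq (runs_storeLoop (d := d) (a := 2 * d + 4 + n * d) (v := fun _ => 0)
      (by omega) f0 (by omega) ?_) ?_ (T₂ := 20) ?_
    · intro j hj s₃ hW₃ hrj
      refine ⟨⟨Term.fits_pointAddr (by simp [hm0]), Term.eval_pointAddr ?_ ?_⟩, by simp, by simp⟩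
      · rw [hW₃.reg 0 (by omega), f0]
      · simp [hW₃.mem, writeBlock_of_lt, hW₂.mem, m0]
    swap
    · have h1 : (Term.pointAddr (.mem 0 - 1)).cost ≤ 13 := by decide
      have h3 := Nat.mul_le_mul_left d (show (Term.pointAddr (.mem 0 - 1)).cost +
        (0 : Term).cost + 11 ≤ 30 by simp only [Term.cost_ofNat]; omega)
      omega
    rintro s₃ hW₃
    rw [hW₂.mem] at hW₃
    choose! ls' hls' using hm.new
    have hlow : ∀ a < 2 * d + 4, writeBlock (writeBlock m (2 * d + 4 + σ * d) d (pts n).coord)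
        (2 * d + 4 + n * d) d (fun _ => 0) a = m a := fun a ha => by
      rw [writeBlock_of_lt (by omega), writeBlock_of_lt (by omega)]
    refine Runs.store (k := 0) (v := n) (by simp) (by simp [hm0]) (by simp) ?_ (by omega)
      (by decide) ⟨_, ls', ((hW.trans (hW₂.mono (by omega))).trans
        (hW₃.mono (by omega))).setMem 0 _, ⟨?_, ?_, hRep.b_pos, by have := hRep.n_le; omega,
        ?_, ?_, ?_, ?_⟩⟩
    · simp [hW₃.mem, hlow, m0]
    · rw [Function.update_self]
    · rw [Function.update_of_ne (by omega), hlow _ (by omega), hm.other 1 (by omega), hRep.bits]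
    · intro i hi1 hi
      rw [Function.update_of_ne (by omega), hlow _ (by omega)]
      exact (hls' i hi1 hi (by omega)).1
    · exact fun i hi1 hi => (hls' i hi1 hi (by omega)).2
    · intro k hk j hj
      have hkd : (k + 1) * d ≤ n * d := Nat.mul_le_mul_right d hk
      rw [add_one_mul] at hkd
      rw [Function.update_of_ne (by omega), writeBlock_of_lt (by omega)]
      rcases lt_trichotomy k σ with h | rfl | h
      · have : (k + 1) * d ≤ σ * d := Nat.mul_le_mul_right d h
        rw [add_one_mul] at this
        rw [writeBlock_of_lt (by omega), hm.other _ (by omega), Function.update_of_ne h.ne]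
        exact hRep.points k (by omega) j hj
      · rw [writeBlock_add hj, Function.update_self]
      · have : (σ + 1) * d ≤ k * d := Nat.mul_le_mul_right d h
        rw [add_one_mul] at this
        rw [writeBlock_of_ge (by omega), hm.other _ (by omega), Function.update_of_ne h.ne']
        exact hRep.points k (by omega) j hj
    · intro a ha
      rw [Function.update_of_ne (by omega)]
      rcases lt_or_ge a (2 * d + 4 + n * d + d) with h | h
      · rw [writeBlock, if_pos (by omega)]
      · rw [writeBlock_of_ge h, writeBlock_of_ge (by omega), hm.other _ (by omega)]
        exact hRep.zero a (by rw [add_one_mul]; omega)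

/-- Deletes the point in the buffer. -/
def deleteProg : Prog :=
  .seq findProg <| .ite (.eq (.reg 10) 1) removeProg .skip

theorem runs_deleteProg {M d n b : ℕ} (hd : 1 ≤ d) {s : Store} {pts : ℕ → HPoint d}
    {ls : ℕ → List ℕ} {p : HPoint d} (h0 : s.reg 0 = d) (hRep : Represents d n b pts ls s.mem)
    (hp : HoldsPoint s.mem 2 p) (hM : 2 * d + 4 + n * d ≤ M) :
    Runs M deleteProg s (31000 * d ^ 2 * Nat.log 2 (n + 2)) (fun s' =>
      ((∀ k < n, pts k ≠ p) ∧ s'.mem = s.mem) ∨ ∃ σ n', n = n' + 1 ∧ σ < n ∧ pts σ = p ∧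
        ∃ ls', Represents d n' b (Function.update pts σ (pts n')) ls' s'.mem) := by
  obtain ⟨lg, hlg⟩ : ∃ lg, lg = Nat.log 2 (n + 2) := ⟨_, rfl⟩
  have hlg1 : 1 ≤ lg := hlg ▸ Nat.log_pos one_lt_two (by omega)
  have hd2 : d ≤ d ^ 2 := Nat.le_self_pow two_ne_zero d
  have hdl : d ^ 2 ≤ d ^ 2 * lg := Nat.le_mul_of_pos_right _ hlg1
  have hdl2 : d * lg ≤ d ^ 2 * lg := Nat.mul_le_mul_right _ hd2
  have h1 : 31000 * d ^ 2 * lg = 31000 * (d ^ 2 * lg) := by ring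
  have h2 : 22000 * d ^ 2 * lg = 22000 * (d ^ 2 * lg) := by ring
  have h3 : 8000 * d * lg = 8000 * (d * lg) := by ring
  unfold deleteProg
  refine Runs.seq (runs_findProg hd h0 hRep hp (by omega)) ?_
    (T₂ := 22000 * d ^ 2 * lg + 4) (by rw [← hlg]; omega)
  rintro s₁ ⟨hF, hcase⟩
  refine Runs.ite (T₁ := 22000 * d ^ 2 * lg) (by simp [Test.Fits]) (fun h10 => ?_)
    (fun h10 => ?_) (by simp [Test.cost]; omega)
  · replace h10 : s₁.reg 10 = 1 := by simpa [Test.Holds] using h10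
    rcases hcase with ⟨-, σ, hσ, h11, rfl⟩ | ⟨h, -⟩
    · obtain ⟨n', rfl⟩ : ∃ n', n = n' + 1 := ⟨n - 1, by omega⟩
      refine (runs_removeProg hd (by rw [hF.reg 0 (by omega), h0]) h11 (by omega)
        (by rw [hF.mem]; exact hRep) (by rw [hF.mem]; exact hp) hM).mono (by rw [hlg]) ?_
      rintro s' ⟨m, ls', hW, hR⟩
      exact .inr ⟨σ, n', rfl, hσ, rfl, ls', by rw [hW.mem]; exact hR⟩
    · norm_num [h10] at h
  · replace h10 : s₁.reg 10 ≠ 1 := by simpa [Test.Holds] using h10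
    refine Runs.skip (by omega) (.inl ⟨?_, hF.mem⟩)
    rcases hcase with ⟨h, -⟩ | ⟨-, h⟩
    · exact absurd h h10
    · exact h

/-! ### Queries -/

/-- Copies the `d` input numbers from address `off` on into the buffer. -/
def loadProg (off : Term) : Prog := storeLoop 13 2 (.inp (off + .reg 13))

theorem runs_loadProg {M d c : ℕ} {s : Store} {off : Term} {p : HPoint d} (h0 : s.reg 0 = d)
    (hoff : ∀ m s', Writes 13 m s s' → off.Fits M s' ∧ off.eval s' = c)
    (hp : ∀ j < d, s.inp (c + j) = p.coord j) (hM : d + 2 ≤ M) :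
    Runs M (loadProg off) s (d * (off.cost + 20) + 6)
      (Writes 13 (writeBlock s.mem 2 d p.coord) s) := by
  have hc : (2 : Term).cost + (Term.inp (off + .reg 13)).cost + 11 ≤ off.cost + 20 := by
    simp; omega
  refine Runs.mono (runs_storeLoop (d := d) (a := 2) (v := p.coord) (by omega) h0 (by omega) ?_)
    (Nat.add_le_add_right (Nat.mul_le_mul_left d hc) 6) fun _ h => h
  intro j hj s₁ hW hr
  obtain ⟨h1, h2⟩ := hoff _ _ hW
  refine ⟨by simp, by simp [h1], ?_⟩
  rw [Term.eval_inp_of (k := c + j) (by simp [h2, hr]), hW.inp, hp j hj]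

theorem holdsPoint_writeBlock {d : ℕ} (m : ℕ → ℝ) (p : HPoint d) :
    HoldsPoint (writeBlock m 2 d p.coord) 2 p := fun _ hj => writeBlock_add hj

theorem Represents.writeBlock {d n b : ℕ} {pts : ℕ → HPoint d} {ls : ℕ → List ℕ} {m : ℕ → ℝ}
    (h : Represents d n b pts ls m) (v : ℕ → ℝ) :
    Represents d n b pts ls (writeBlock m 2 d v) := by
  refine ⟨?_, ?_, h.b_pos, h.n_le, fun i h1 h2 => ?_, h.sorted, fun k hk j hj => ?_,
    fun a ha => ?_⟩
  · rw [writeBlock_of_lt (by omega), h.size]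
  · rw [writeBlock_of_lt (by omega), h.bits]
  · rw [writeBlock_of_ge (by omega), h.lists i h1 h2]
  · rw [writeBlock_of_ge (by omega)]; exact h.points k hk j hj
  · rw [writeBlock_of_ge (by omega), h.zero a ha]

/-- Computes `sqRatio` of the points stored at the addresses in the registers `30` and `31` into
register `32`. -/
def sqRatioProg : Prog :=
  .seq (.set 32 0) <| .seq (.set 33 0) <|
  .seq (forLoop 33 (.reg 0) <| .set 32 (.reg 32 +
    (.mem (.reg 30 + .reg 33) - .mem (.reg 31 + .reg 33)) *
    (.mem (.reg 30 + .reg 33) - .mem (.reg 31 + .reg 33)))) <|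
  .set 32 (.reg 32 / (.mem (.reg 30 + .reg 0 - 1) * .mem (.reg 31 + .reg 0 - 1)))

theorem runs_sqRatioProg {M d a b : ℕ} (hd : 1 ≤ d) {s : Store} {p q : HPoint d}
    (h0 : s.reg 0 = d) (ha : s.reg 30 = a) (hb : s.reg 31 = b) (hp : HoldsPoint s.mem a p)
    (hq : HoldsPoint s.mem b q) (haM : a + d ≤ M) (hbM : b + d ≤ M) :
    Runs M sqRatioProg s (60 * d) (fun s' => Frame 32 s s' ∧ s'.reg 32 = sqRatio p q) := by
  unfold sqRatioProg
  refine Runs.set_seq (v := 0) (by simp) (by simp) (T₂ := 30 * d + 25) ?_ (by simp; omega)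
  refine Runs.set_seq (v := 0) (by simp) (by simp) (T₂ := 30 * d + 22) ?_ (by simp; omega)
  refine Runs.seq (T₁ := 30 * d + 4) (T₂ := 18)
    ((Runs.forLoop (T := 22) (N := d) (a := 0) (fun k s' => Frame 32 s s' ∧ s'.reg 33 = k ∧
    s'.reg 32 = ∑ j ∈ Finset.range k, (p.coord j - q.coord j) * (p.coord j - q.coord j))
    ?_ ?_ ?_ (by omega)).mono ?_ fun _ h => h) ?_ (by omega)
  · rintro k s₁ ⟨hF, hk, -⟩
    exact ⟨hk, by simp, by simp [hF.reg 0 (by omega), h0]⟩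
  · rintro k s₁ hk ⟨hF, h33, h32⟩
    have ea : (Term.reg 30 + .reg 33).eval s₁ = (a + k : ℕ) := by
      simp [hF.reg 30 (by omega), ha, h33]
    have eb : (Term.reg 31 + .reg 33).eval s₁ = (b + k : ℕ) := by
      simp [hF.reg 31 (by omega), hb, h33]
    have fa : (Term.mem (.reg 30 + .reg 33)).Fits M s₁ := Term.fits_mem_of ea (by omega) (by simp)
    have fb : (Term.mem (.reg 31 + .reg 33)).Fits M s₁ := Term.fits_mem_of eb (by omega) (by simp)
    refine Runs.set (by simp [fa, fb]) (by decide) ⟨by simp [h33],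
      (hF.setReg (by omega) _).setReg (by omega) _, by simp, ?_⟩
    rw [Finset.sum_range_succ, ← h32]
    simp [Term.eval_mem_of ea, Term.eval_mem_of eb, hF.mem, hp k hk, hq k hk]
  · exact ⟨((Frame.refl _ _).setReg (by omega) _).setReg (by omega) _, by simp, by simp⟩
  · simp only [Term.cost_reg]; omega
  · rintro s₁ ⟨hF, -, h32⟩
    have ea : (Term.reg 30 + .reg 0 - 1).eval s₁ = (a + (d - 1) : ℕ) := by
      simp [hF.reg 30 (by omega), hF.reg 0 (by omega), ha, h0, Nat.cast_sub hd]; ring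
    have eb : (Term.reg 31 + .reg 0 - 1).eval s₁ = (b + (d - 1) : ℕ) := by
      simp [hF.reg 31 (by omega), hF.reg 0 (by omega), hb, h0, Nat.cast_sub hd]; ring
    have fa := Term.fits_mem_of (M := M) ea (by omega) (by simp)
    have fb := Term.fits_mem_of (M := M) eb (by omega) (by simp)
    refine Runs.set (by simp [fa, fb]) (by decide) ⟨hF.setReg (by omega) _, ?_⟩
    simp [Term.eval_mem_of ea, Term.eval_mem_of eb, hF.mem, hp (d - 1) (by omega),
      hq (d - 1) (by omega), HPoint.coord_last, h32, sqRatio]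

/-- The registers `14` to `17` hold an element of `A` that minimizes `f`: register `14` tells
whether there is one, register `15` holds the minimum, and the registers `16` and `17` hold the
element. -/
def HoldsBest (f : ℕ × ℕ → ℝ) (A : Set (ℕ × ℕ)) (s : Store) : Prop :=
  (s.reg 14 = 0 ∧ A = ∅) ∨ (s.reg 14 = 1 ∧ ∃ x ∈ A, s.reg 15 = f x ∧ s.reg 16 = x.1 ∧
    s.reg 17 = x.2 ∧ ∀ y ∈ A, f x ≤ f y)

theorem HoldsBest.congr {f : ℕ × ℕ → ℝ} {A : Set (ℕ × ℕ)} {s s' : Store} (h : HoldsBest f A s)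
    (hs : ∀ r, 14 ≤ r → r ≤ 17 → s'.reg r = s.reg r) : HoldsBest f A s' := by
  unfold HoldsBest
  rwa [hs 14 (by omega) (by omega), hs 15 (by omega) (by omega), hs 16 (by omega) (by omega),
    hs 17 (by omega) (by omega)]

/-- Compares the pair of points stored at the addresses in the registers `30` and `31` with the best
pair so far; the registers `18` and `19` hold the labels of the points. If there is no pair so far,
register `15` is first set to a value that the new pair improves on. -/
def improveProg : Prog :=
  .seq sqRatioProg <|
  .seq (.ite (.eq (.reg 14) 0) (.set 15 (.reg 32 + 1)) .skip) <|
  .ite (.lt (.reg 32) (.reg 15))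
    (.seq (.set 14 1) <| .seq (.set 15 (.reg 32)) <| .seq (.set 16 (.reg 18)) <|
      .set 17 (.reg 19))
    .skip

theorem runs_improveProg {M d a b : ℕ} (hd : 1 ≤ d) {s : Store} {p q : HPoint d} {u v : ℕ}
    {f : ℕ × ℕ → ℝ} {A : Set (ℕ × ℕ)} (h0 : s.reg 0 = d) (ha : s.reg 30 = a) (hb : s.reg 31 = b)
    (hu : s.reg 18 = u) (hv : s.reg 19 = v) (hp : HoldsPoint s.mem a p)
    (hq : HoldsPoint s.mem b q) (haM : a + d ≤ M) (hbM : b + d ≤ M)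
    (hf : f (u, v) = sqRatio p q) (hA : HoldsBest f A s) :
    Runs M improveProg s (100 * d)
      (fun s' => Frame 14 s s' ∧ HoldsBest f (insert (u, v) A) s') := by
  unfold improveProg
  refine Runs.seq (runs_sqRatioProg hd h0 ha hb hp hq haM hbM) ?_ (T₂ := 40) (by omega)
  rintro s₁ ⟨hF, h32⟩
  rw [← hf] at h32
  replace hA : HoldsBest f A s₁ := hA.congr fun r _ _ => hF.reg r (by omega)
  have hF' : Frame 14 s s₁ := hF.mono (by omega)
  refine Runs.seq (R := fun s' => Frame 14 s s' ∧ s'.reg 32 = f (u, v) ∧ s'.reg 18 = u ∧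
      s'.reg 19 = v ∧ ((f (u, v) < s'.reg 15 ∧ ∀ y ∈ A, f (u, v) ≤ f y) ∨
      (s'.reg 15 ≤ f (u, v) ∧ HoldsBest f A s' ∧ A.Nonempty))) (T₁ := 10)
    (Runs.ite (T₁ := 5) (by simp [Test.Fits]) (fun h14 => ?_) (fun h14 => ?_) (by decide)) ?_
    (T₂ := 20) (by omega)
  · replace h14 : s₁.reg 14 = 0 := by simpa [Test.Holds] using h14
    rcases hA with ⟨-, rfl⟩ | ⟨h, -⟩
    · refine Runs.set (by simp) (by decide) ⟨hF'.setReg (by omega) _, by simp [h32],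
        by simp [hF.reg 18 (by omega), hu], by simp [hF.reg 19 (by omega), hv], .inl ?_⟩
      simp [h32]
    · norm_num [h] at h14
  · replace h14 : s₁.reg 14 ≠ 0 := by simpa [Test.Holds] using h14
    refine Runs.skip (by omega) ⟨hF', h32, by rw [hF.reg 18 (by omega), hu],
      by rw [hF.reg 19 (by omega), hv], ?_⟩
    have hA' := hA
    rcases hA' with ⟨h, -⟩ | ⟨-, x, hx, h15, -, -, hmin⟩
    · exact absurd h h14
    · rcases lt_or_ge (f (u, v)) (s₁.reg 15) with h | h
      · exact .inl ⟨h, fun y hy => h.le.trans (h15 ▸ hmin y hy)⟩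
      · exact .inr ⟨h, hA, x, hx⟩
  · rintro s₂ ⟨hF₂, g32, g18, g19, hcase⟩
    refine Runs.ite (T₁ := 15) (by simp [Test.Fits]) (fun hlt => ?_) (fun hlt => ?_) (by decide)
    · replace hlt : f (u, v) < s₂.reg 15 := by simpa [Test.Holds, g32] using hlt
      have hmin : ∀ y ∈ A, f (u, v) ≤ f y :=
        hcase.elim (fun h => h.2) fun h => absurd h.1 (not_le.2 hlt)
      refine Runs.set_seq (v := 1) (by simp) (by simp) (T₂ := 9) ?_ (by decide)
      refine Runs.set_seq (v := f (u, v)) (by simp) (by simp [g32]) (T₂ := 6) ?_ (by decide)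
      refine Runs.set_seq (v := u) (by simp) (by simp [g18]) (T₂ := 3) ?_ (by decide)
      refine Runs.set (by simp) (by decide) ⟨(((hF₂.setReg (by omega) _).setReg (by omega)
        _).setReg (by omega) _).setReg (by omega) _, .inr ⟨by simp, (u, v), by simp, by simp,
        by simp, by simp [g19], ?_⟩⟩
      rintro y (rfl | hy)
      · exact le_rfl
      · exact hmin y hy
    · replace hlt : s₂.reg 15 ≤ f (u, v) := by simpa [Test.Holds, g32] using hlt
      refine Runs.skip (by omega) ⟨hF₂, ?_⟩
      rcases hcase with ⟨h, -⟩ | ⟨-, hA₂, hne⟩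
      · exact absurd h (not_lt.2 hlt)
      · rcases hA₂ with ⟨-, h⟩ | ⟨h14, x, hx, h15, h16, h17, hmin⟩
        · exact absurd h hne.ne_empty
        · refine .inr ⟨h14, x, .inr hx, h15, h16, h17, ?_⟩
          rintro y (rfl | hy)
          · rwa [← h15]
          · exact hmin y hy

/-- Tries the point at position `k` of the list of the order in register `12` as neighbour of the
point in the buffer. -/
def tryProg (k : Term) : Prog :=
  .seq (.set 18 (.digit (.listCell (.reg 12)) k)) <| .seq (.set 19 0) <| .seq (.set 30 2) <|
  .seq (.set 31 (.pointAddr (.reg 18))) improveProg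

theorem runs_tryProg {M d n b i k : ℕ} (hd : 1 ≤ d) {s : Store} {pts : ℕ → HPoint d}
    {ls : ℕ → List ℕ} {q : HPoint d} {tk : Term} {A : Set (ℕ × ℕ)} (h0 : s.reg 0 = d)
    (h12 : s.reg 12 = i) (hi1 : 1 ≤ i) (hi : i ≤ d + 1) (hRep : Represents d n b pts ls s.mem)
    (hq : HoldsPoint s.mem 2 q) (hM : 2 * d + 4 + n * d ≤ M) (htk : tk.Fits M s)
    (hk : tk.eval s = k) (hkn : k < (ls i).length) (hc : tk.cost ≤ 5)
    (hA : HoldsBest (fun x => sqRatio q (pts x.1)) A s) :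
    Runs M (tryProg tk) s (100 * d + 100) (fun s' => Frame 14 s s' ∧
      HoldsBest (fun x => sqRatio q (pts x.1)) (insert ((ls i)[k], 0) A) s') := by
  have hS := hRep.sorted i hi1 hi
  have hx : (ls i)[k] < n := hS.lt_of_mem (List.getElem_mem hkn)
  have hxd : ((ls i)[k] + 1) * d ≤ n * d := Nat.mul_le_mul_right d hx
  rw [add_one_mul] at hxd
  have t12 : (Term.reg 12).eval s = i := h12
  unfold tryProg
  refine Runs.set_seq (v := (ls i)[k]) (Term.fits_digit (by omega)
    (Term.fits_listCell h0 t12 (by omega) (by simp)) htk) ?_ (T₂ := 100 * d + 30) ?_ ?_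
  · rw [Term.eval_digit (b := b) (k := k) (l := ls i) hRep.bits
      (by rw [Term.eval_listCell h0 t12, hRep.lists i hi1 hi]) hk
      (fun x hx => (hS.lt_of_mem hx).trans_le hRep.n_le), List.getD_eq_getElem _ _ hkn]
  swap
  · simp only [Term.digit, Term.listCell, Term.cost_sub, Term.cost_floor, Term.cost_div,
      Term.cost_mem, Term.cost_pow2, Term.cost_mul, Term.cost_add, Term.cost_reg, Term.cost_ofNat]
    have : Term.cost 0 = 1 := rfl
    have : Term.cost 1 = 1 := rfl
    omega
  refine Runs.set_seq (v := (0 : ℕ)) (by simp) (by simp) (T₂ := 100 * d + 28) ?_ (by simp; omega)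
  refine Runs.set_seq (v := (2 : ℕ)) (by simp) (by simp) (T₂ := 100 * d + 26) ?_ (by simp; omega)
  refine Runs.set_seq (v := (2 * d + 4 + (ls i)[k] * d : ℕ)) (Term.fits_pointAddr (by simp))
    (Term.eval_pointAddr (by simp [h0]) (by simp)) (T₂ := 100 * d) ?_ ?_
  swap
  · have : (Term.pointAddr (.reg 18)).cost ≤ 15 := by decide
    omega
  refine Runs.mono (runs_improveProg (a := 2) (b := 2 * d + 4 + (ls i)[k] * d) (u := (ls i)[k]) (v := 0)
    (p := q) (q := pts (ls i)[k]) hd (by simp [h0]) (by simp) (by simp) (by simp) (by simp) hq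
    (hRep.points _ hx) (by omega) (by omega) rfl (hA.congr fun r h1 h2 => ?_)) le_rfl ?_
  · simp [show r ≠ 18 by omega, show r ≠ 19 by omega, show r ≠ 30 by omega,
      show r ≠ 31 by omega]
  · rintro s' ⟨hF, hA'⟩
    exact ⟨Frame.trans (((((Frame.refl _ s).setReg (by omega) _).setReg (by omega) _).setReg
      (by omega) _).setReg (by omega) _) hF, hA'⟩

/-- Tries the neighbours of the point in the buffer in the list of the order in register `12`. -/
def neighboursProg : Prog :=
  .seq (.set 20 (.reg 12)) <| .seq (.set 21 2) <| .seq (.set 22 (.mem 0)) <| .seq searchProg <|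
  .seq (.set 13 (.reg 23)) <|
  .seq (.ite (.lt 0 (.reg 13)) (tryProg (.reg 13 - 1)) .skip) <|
  .ite (.lt (.reg 13) (.mem 0)) (tryProg (.reg 13)) .skip

/-- The point `u` is one of the points `a` and `q`, or it lies between them in the `i`-th order. -/
def HBetween {d : ℕ} (i : ℕ) (q u a : HPoint d) : Prop :=
  u = a ∨ u = q ∨ (HLt i a u ∧ HLt i u q) ∨ (HLt i q u ∧ HLt i u a)

/-- Every other stored point is separated from the query point by one of its two neighbours. -/
theorem runs_neighboursProg {M d n b i : ℕ} (hd : 1 ≤ d) {s : Store} {pts : ℕ → HPoint d}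
    {ls : ℕ → List ℕ} {q : HPoint d} {A : Set (ℕ × ℕ)} (h0 : s.reg 0 = d)
    (h12 : s.reg 12 = i) (hi1 : 1 ≤ i) (hi : i ≤ d + 1) (hRep : Represents d n b pts ls s.mem)
    (hq : HoldsPoint s.mem 2 q) (hM : 2 * d + 4 + n * d ≤ M) (hAn : ∀ x ∈ A, x.1 < n)
    (hA : HoldsBest (fun x => sqRatio q (pts x.1)) A s) :
    Runs M neighboursProg s (5600 * d * Nat.log 2 (n + 2)) (fun s' => Frame 13 s s' ∧
      ∃ A', A ⊆ A' ∧ (∀ x ∈ A', x.1 < n) ∧ HoldsBest (fun x => sqRatio q (pts x.1)) A' s' ∧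
        ∀ a < n, ∃ x ∈ A', HBetween i q (pts x.1) (pts a)) := by
  have hS := hRep.sorted i hi1 hi
  have hlen := hS.length_eq
  have hm0 : ∀ s' : Store, (Term.mem 0).Fits M s' := fun s' => Term.fits_mem_zero (by omega)
  obtain ⟨lg, hlg⟩ : ∃ lg, lg = Nat.log 2 (n + 2) := ⟨_, rfl⟩
  have hlg1 : 1 ≤ lg := hlg ▸ Nat.log_pos one_lt_two (by omega)
  have hdl : d ≤ d * lg := Nat.le_mul_of_pos_right d hlg1
  have e1 : 5600 * d * lg = 5600 * (d * lg) := by ring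
  have e2 : 5000 * d * lg = 5000 * (d * lg) := by ring
  rw [← hlg]
  unfold neighboursProg
  refine Runs.set_seq (v := i) (by simp) (by simp [h12])
    (T₂ := 5000 * d * lg + 200 * d + 300) ?_ (by simp; omega)
  refine Runs.set_seq (v := 2) (by simp) (by simp)
    (T₂ := 5000 * d * lg + 200 * d + 290) ?_ (by simp; omega)
  refine Runs.set_seq (v := n) (hm0 _) (by simp [hRep.size])
    (T₂ := 5000 * d * lg + 200 * d + 280) ?_ (by simp; omega)
  refine Runs.seq (runs_searchProg (i := i) (a := 2) (b := b) (n := n) (pts := pts)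
    (q := q) (l := ls i) hd hi1 hi (by simp [h0]) (by simp) (by simp) (by simp [hlen])
    hRep.bits (hRep.lists i hi1 hi) hRep.points hq hlen.le (fun x hx => hS.lt_of_mem hx)
    hRep.n_le hS.pairwise hM (by omega)) ?_ (T₂ := 200 * d + 270) (by rw [← hlg]; omega)
  rintro s₁ ⟨hF, k, hk, h23, hL1, hL2⟩
  refine Runs.set_seq (v := k) (by simp) (by simp [h23]) (T₂ := 200 * d + 260) ?_ (by simp; omega)
  have hF₁ : Frame 13 s (s₁.setReg 13 k) := (Frame.trans ((((Frame.refl 13 s).setReg (by omega)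
    _).setReg (by omega) _).setReg (by omega) _) (hF.mono (by omega))).setReg le_rfl _
  have h13 : (s₁.setReg 13 (k : ℝ)).reg 13 = k := by simp
  replace hA : HoldsBest (fun x => sqRatio q (pts x.1)) A (s₁.setReg 13 k) :=
    hA.congr fun r h1 h2 => by
      simp [show r ≠ 13 by omega, hF.reg r (by omega), show r ≠ 20 by omega, show r ≠ 21 by omega,
        show r ≠ 22 by omega]
  generalize s₁.setReg 13 (k : ℝ) = s₂ at hF₁ h13 hA
  have hpos : ∀ a < n, ∃ j, ∃ hj : j < (ls i).length, (ls i)[j] = a := fun a ha =>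
    List.mem_iff_getElem.1 ((hS.mem_iff a).2 ha)
  have hpw := List.pairwise_iff_getElem.1 hS.pairwise
  -- the predecessor
  refine Runs.seq (R := fun s' => Frame 13 s s' ∧ s'.reg 13 = k ∧ ∃ A', A ⊆ A' ∧
      (∀ x ∈ A', x.1 < n) ∧ HoldsBest (fun x => sqRatio q (pts x.1)) A' s' ∧
      ∀ a < n, HLt i (pts a) q → ∃ x ∈ A', HBetween i q (pts x.1) (pts a))
    (T₁ := 100 * d + 120) (T₂ := 100 * d + 120)
    (Runs.ite (T₁ := 100 * d + 110) (by simp [Test.Fits]) (fun hlt => ?_) (fun hlt => ?_)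
      (by simp [Test.cost]; omega)) ?_ (by omega)
  · replace hlt : 0 < k := by simpa [Test.Holds, h13] using hlt
    have hkl : k - 1 < (ls i).length := by omega
    refine Runs.mono (runs_tryProg (k := k - 1) hd (by rw [hF₁.reg 0 (by omega), h0])
      (by rw [hF₁.reg 12 (by omega), h12]) hi1 hi (by rw [hF₁.mem]; exact hRep)
      (by rw [hF₁.mem]; exact hq) hM (by simp) (by simp [h13, Nat.cast_sub hlt]) hkl
      (by decide) hA) (by omega) ?_
    rintro s₃ ⟨hF₃, hA₃⟩
    refine ⟨hF₁.trans (hF₃.mono (by omega)), by rw [hF₃.reg 13 (by omega), h13], _,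
      Set.subset_insert _ _, ?_, hA₃, fun a ha haq => ⟨_, Set.mem_insert _ _, ?_⟩⟩
    · rintro x (rfl | hx)
      · exact hS.lt_of_mem (List.getElem_mem hkl)
      · exact hAn x hx
    · obtain ⟨j, hj, rfl⟩ := hpos a ha
      have hjk : j < k := by
        by_contra hcon
        exact hL2 _ (List.mem_drop_iff_getElem.2 ⟨j - k, by omega,
          by simp [show k + (j - k) = j by omega]⟩) haq
      rcases Nat.eq_or_lt_of_le (show j ≤ k - 1 by omega) with rfl | h
      · exact .inl rfl
      · exact .inr (.inr (.inl ⟨hpw _ _ hj hkl h,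
          hL1 _ (List.mem_take_iff_getElem.2 ⟨k - 1, by omega, rfl⟩)⟩))
  · replace hlt : k = 0 := by simpa [Test.Holds, h13] using hlt
    refine Runs.skip (by omega) ⟨hF₁, h13, A, subset_rfl, hAn, hA, fun a ha haq => ?_⟩
    obtain ⟨j, hj, rfl⟩ := hpos a ha
    exact absurd haq (hL2 _ (by rw [hlt, List.drop_zero]; exact List.getElem_mem hj))
  rintro s₃ ⟨hF₃, g13, A₃, hAA₃, hAn₃, hA₃, hpred⟩
  -- the first point that is not smaller
  refine Runs.ite (T₁ := 100 * d + 110) ⟨by simp, hm0 _⟩ (fun hlt => ?_) (fun hlt => ?_)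
    (by simp [Test.cost]; omega)
  · replace hlt : k < n := by simpa [Test.Holds, g13, hF₃.mem, hRep.size] using hlt
    have hkl : k < (ls i).length := by omega
    refine Runs.mono (runs_tryProg (k := k) hd (by rw [hF₃.reg 0 (by omega), h0])
      (by rw [hF₃.reg 12 (by omega), h12]) hi1 hi (by rw [hF₃.mem]; exact hRep)
      (by rw [hF₃.mem]; exact hq) hM (by simp) (by simp [g13]) hkl
      (by decide) hA₃) (by omega) ?_
    rintro s₄ ⟨hF₄, hA₄⟩
    refine ⟨hF₃.trans (hF₄.mono (by omega)), _, hAA₃.trans (Set.subset_insert _ _), ?_, hA₄,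
      fun a ha => ?_⟩
    · rintro x (rfl | hx)
      · exact hS.lt_of_mem (List.getElem_mem hkl)
      · exact hAn₃ x hx
    · by_cases haq : HLt i (pts a) q
      · obtain ⟨x, hx, h⟩ := hpred a ha haq
        exact ⟨x, .inr hx, h⟩
      refine ⟨_, Set.mem_insert _ _, ?_⟩
      obtain ⟨j, hj, rfl⟩ := hpos a ha
      have hjk : k ≤ j := by
        by_contra hcon
        exact haq (hL1 _ (List.mem_take_iff_getElem.2 ⟨j, by omega, rfl⟩))
      rcases Nat.eq_or_lt_of_le hjk with rfl | h
      · exact .inl rfl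
      · have hx := hL2 (ls i)[k] (List.mem_drop_iff_getElem.2 ⟨0, by omega, by simp⟩)
        rcases HLt.trichotomy hd hi1 hi (pts (ls i)[k]) q with h' | h' | h'
        · exact .inr (.inl h')
        · exact absurd h' hx
        · exact .inr (.inr (.inr ⟨h', hpw _ _ hkl hj h⟩))
  · replace hlt : n ≤ k := by simpa [Test.Holds, g13, hF₃.mem, hRep.size] using hlt
    refine Runs.skip (by omega) ⟨hF₃, A₃, hAA₃, hAn₃, hA₃, fun a ha => hpred a ha ?_⟩
    rw [List.take_of_length_le (by omega)] at hL1
    exact hL1 a ((hS.mem_iff a).2 ha)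

/-- Outputs the point whose number is in register `16`. -/
def outputProg : Prog :=
  .seq (.set 13 0) (forLoop 13 (.reg 0) (.output (.reg 13) (.mem (.pointAddr (.reg 16) + .reg 13))))

theorem runs_outputProg {M d k : ℕ} {s : Store} {p : HPoint d} (h0 : s.reg 0 = d)
    (h16 : s.reg 16 = k) (hp : HoldsPoint s.mem (2 * d + 4 + k * d) p)
    (hM : 2 * d + 4 + k * d + d ≤ M) :
    Runs M outputProg s (50 * d + 10) (fun s' => s'.mem = s.mem ∧ OutputsPoint s' p) := by
  unfold outputProg
  refine Runs.set_seq (v := 0) (by simp) (by simp) (T₂ := 50 * d + 5) ?_ (by simp; omega)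
  refine Runs.mono (Runs.forLoop (T := 30) (N := d) (a := 0) (fun j s' => s'.mem = s.mem ∧
    s'.reg 0 = d ∧ s'.reg 16 = k ∧ s'.reg 13 = j ∧ ∀ c < j, s'.out c = p.coord c) ?_ ?_ ?_
    (by omega)) (by simp only [Term.cost_reg]; omega) ?_
  · rintro j s₁ ⟨-, g0, -, g13, -⟩
    exact ⟨g13, by simp, by simp [g0]⟩
  · rintro j s₁ hj ⟨gm, g0, g16, g13, hout⟩
    have ha : (Term.pointAddr (.reg 16) + .reg 13).eval s₁ = (2 * d + 4 + k * d + j : ℕ) := by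
      rw [Term.eval_add, Term.eval_pointAddr g0 (k := k) (by simp [g16]), Term.eval_reg, g13]
      push_cast; rfl
    refine Runs.output (k := j) (v := p.coord j) (by simp)
      (Term.fits_mem_of ha (by omega) ⟨Term.fits_pointAddr (by simp), trivial⟩) (by simp [g13])
      (by rw [Term.eval_mem_of ha, gm, hp j hj]) (by decide)
      ⟨by simp [g13], by simp [gm], by simp [g0], by simp [g16], by simp, fun c hc => ?_⟩
    simp only [Store.setReg_out, Store.setOut_out]
    split_ifs with h
    · rw [h]
    · exact hout c (by omega)
  · exact ⟨rfl, by simp [h0], by simp [h16], by simp, by omega⟩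
  · rintro s' ⟨gm, -, -, -, hout⟩
    exact ⟨gm, hout⟩

/-- Answers a query for the point in the input: the best of the neighbours of this point in the
`d + 1` orders. -/
def queryProg : Prog :=
  .seq (loadProg 0) <| .seq (.set 14 0) <| .seq (forOrders 12 neighboursProg) outputProg

/-- In a suitable order, the neighbour of `q` that separates it from `a` lies in a cell of size
proportional to the distance of `q` and `a`. -/
theorem exists_hdist_le_of_hBetween {d n : ℕ} (hd : 1 ≤ d) {pts : ℕ → HPoint d} {q : HPoint d}
    {A : Set (ℕ × ℕ)} {a : ℕ} (ha : a < n) (hA : ∀ i, 1 ≤ i → i ≤ d + 1 → ∀ a < n, ∃ x ∈ A,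
      HBetween i q (pts x.1) (pts a)) :
    ∃ x ∈ A, hdist q (pts x.1) ≤ 160 * (d * Real.sqrt d) * hdist q (pts a) := by
  have hnn : 0 ≤ 160 * (d * Real.sqrt d) * hdist q (pts a) :=
    mul_nonneg (by positivity) (hdist_nonneg _ _)
  by_cases hqa : q = pts a
  · obtain ⟨x, hx, h⟩ := hA 1 le_rfl (by omega) a ha
    refine ⟨x, hx, ?_⟩
    have hxq : pts x.1 = q := by
      rw [← hqa] at h
      rcases h with h | h | ⟨h, h'⟩ | ⟨h, h'⟩
      · exact h
      · exact h
      · exact absurd h' (h.asymm hd le_rfl (by omega))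
      · exact absurd h' (h.asymm hd le_rfl (by omega))
    rwa [hxq, hdist_self]
  · obtain ⟨i, hi1, hi, m, hm, hr⟩ := exists_shift hd hqa
    obtain ⟨x, hx, h⟩ := hA i hi1 hi a ha
    refine ⟨x, hx, ?_⟩
    rcases h with h | h | ⟨h, h'⟩ | ⟨h, h'⟩
    · exact hr _ (h ▸ hm)
    · rwa [h, hdist_self]
    · exact hr _ ((SameCell.of_between hd hi1 hi h h' (hm.symm hd hi1 hi)).2.symm hd hi1 hi)
    · exact hr _ (SameCell.of_between hd hi1 hi h h' hm).1

theorem runs_queryProg {M d n b : ℕ} (hd : 1 ≤ d) (hn : 1 ≤ n) {s : Store} {pts : ℕ → HPoint d}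
    {ls : ℕ → List ℕ} {q : HPoint d} (h0 : s.reg 0 = d) (hRep : Represents d n b pts ls s.mem)
    (hq : ∀ j < d, s.inp j = q.coord j) (hM : 2 * d + 4 + n * d ≤ M) :
    Runs M queryProg s (12000 * d ^ 2 * Nat.log 2 (n + 2)) (fun s' =>
      Represents d n b pts ls s'.mem ∧ ∃ k < n, OutputsPoint s' (pts k) ∧
        ∀ a < n, hdist q (pts k) ≤ 160 * (d * Real.sqrt d) * hdist q (pts a)) := by
  obtain ⟨lg, hlg⟩ : ∃ lg, lg = Nat.log 2 (n + 2) := ⟨_, rfl⟩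
  have hlg1 : 1 ≤ lg := hlg ▸ Nat.log_pos one_lt_two (by omega)
  have hd2 : d ≤ d ^ 2 := Nat.le_self_pow two_ne_zero d
  have hdl : d ^ 2 ≤ d ^ 2 * lg := Nat.le_mul_of_pos_right _ hlg1
  have hdl2 : d * lg ≤ d ^ 2 * lg := Nat.mul_le_mul_right _ hd2
  have e1 : 12000 * d ^ 2 * lg = 12000 * (d ^ 2 * lg) := by ring
  have e2 : (d + 1) * (5600 * d * lg + 10) + 8 = 5600 * (d ^ 2 * lg) + 5600 * (d * lg) + 10 * d
      + 18 := by ring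
  rw [← hlg]
  unfold queryProg
  refine Runs.seq (runs_loadProg (c := 0) (p := q) h0 (fun _ _ _ => by simp)
    (by simpa using hq) (by omega)) ?_
    (T₂ := (d + 1) * (5600 * d * lg + 10) + 8 + (50 * d + 20))
    (by rw [show (0 : Term).cost = 1 from rfl]; omega)
  intro s₁ hW
  refine Runs.set_seq (v := 0) (by simp) (by simp)
    (T₂ := (d + 1) * (5600 * d * lg + 10) + 8 + (50 * d + 10)) ?_
    (by rw [show (0 : Term).cost = 1 from rfl]; omega)
  set f : ℕ × ℕ → ℝ := fun x => sqRatio q (pts x.1) with hf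
  set m := writeBlock s.mem 2 d q.coord with hm
  have hRm : Represents d n b pts ls m := hRep.writeBlock _
  have hqm : HoldsPoint m 2 q := holdsPoint_writeBlock _ _
  refine Runs.seq (runs_forOrders (d := d) (T := 5600 * d * lg) (fun i s' => s'.mem = m ∧
    s'.reg 0 = d ∧ ∃ A, (∀ x ∈ A, x.1 < n) ∧ HoldsBest f A s' ∧ ∀ j, 1 ≤ j → j < i → ∀ a < n,
      ∃ x ∈ A, HBetween j q (pts x.1) (pts a)) (fun _ _ h => h.2.1) ?_ ?_ ?_) ?_ le_rfl
  · rintro i s' v ⟨gm, g0, A, hAn, hA, hAB⟩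
    exact ⟨gm, by simp [g0], A, hAn, hA.congr fun r _ _ => by simp [show r ≠ 12 by omega], hAB⟩
  · exact ⟨hW.mem, by simp [hW.reg 0 (by omega), h0], ∅, by simp, .inl ⟨by simp, rfl⟩, by omega⟩
  · rintro i hi1 hi s₂ ⟨gm, g0, A, hAn, hA, hAB⟩ h12
    refine (runs_neighboursProg hd g0 h12 hi1 hi (by rw [gm]; exact hRm) (by rw [gm]; exact hqm) hM
      hAn hA).mono (by rw [hlg]) ?_
    rintro s₃ ⟨hF, A', hAA', hAn', hA', hB⟩
    refine ⟨by rw [hF.reg 12 (by omega), h12], by rw [hF.mem, gm], by rw [hF.reg 0 (by omega), g0],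
      A', hAn', hA', fun j hj1 hj a ha => ?_⟩
    rcases Nat.lt_succ_iff_lt_or_eq.1 hj with h | rfl
    · obtain ⟨x, hx, h'⟩ := hAB j hj1 h a ha
      exact ⟨x, hAA' hx, h'⟩
    · exact hB a ha
  · rintro s₂ ⟨gm, g0, A, hAn, hA, hAB⟩
    rcases hA with ⟨-, rfl⟩ | ⟨-, x, hx, -, h16, -, hmin⟩
    · obtain ⟨x, hx, -⟩ := hAB 1 le_rfl (by omega) 0 (by omega)
      exact absurd hx (Set.notMem_empty x)
    · have hxn := hAn x hx
      have hxd : (x.1 + 1) * d ≤ n * d := Nat.mul_le_mul_right d hxn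
      rw [add_one_mul] at hxd
      refine Runs.mono (runs_outputProg (k := x.1) (p := pts x.1) g0 h16
        (by rw [gm]; exact hRm.points _ hxn) (by omega)) le_rfl ?_
      rintro s₃ ⟨gm', hout⟩
      refine ⟨by rw [gm', gm]; exact hRm, x.1, hxn, hout, fun a ha => ?_⟩
      obtain ⟨y, hy, h⟩ := exists_hdist_le_of_hBetween hd ha
        fun i hi1 hi => hAB i hi1 (by omega)
      exact (hdist_le_hdist_of_sqRatio_le hd (hmin y hy)).trans h

/-! ### Construction and closest pairs -/

theorem encodePoints_mul_add {d n : ℕ} (P : Fin n → HPoint d) {k j : ℕ} (hk : k < n) (hj : j < d) :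
    encodePoints P (k * d + j) = (P ⟨k, hk⟩).coord j := by
  have h1 : (k * d + j) / d = k := by
    rw [mul_comm, Nat.mul_add_div (by omega), Nat.div_eq_of_lt hj, add_zero]
  have h2 : (k * d + j) % d = j := by
    rw [mul_comm, Nat.mul_add_mod, Nat.mod_eq_of_lt hj]
  rw [encodePoints, dif_pos (by rw [h1]; exact hk)]
  simp only [h1, h2]

theorem represents_empty {d : ℕ} (pts : ℕ → HPoint d) :
    Represents d 0 1 pts (fun _ => []) (Function.update (fun _ => 0) 1 1) := by
  refine ⟨by simp, by simp, le_rfl, by simp, fun i _ _ => ?_, fun i _ _ => ⟨by simp, by simp⟩,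
    fun k hk => by omega, fun a ha => ?_⟩
  · rw [Function.update_of_ne (by omega)]; simp
  · rw [Function.update_of_ne (by omega)]

/-- Inserts the points of the input one after the other into the empty structure. -/
def buildProg : Prog :=
  .seq (.store 1 1) <| .seq (.set 5 0) <|
  forLoop 5 (.reg 1) (.seq (loadProg (.reg 5 * .reg 0)) insertProg)

theorem runs_buildProg {M d n : ℕ} (hd : 1 ≤ d) {P : Fin n → HPoint d}
    (hP : Function.Injective P) {s : Store} (h0 : s.reg 0 = d) (h1 : s.reg 1 = n)
    (hmem : s.mem = fun _ => 0) (hinp : s.inp = encodePoints P) (hM : 2 * d + 4 + n * d ≤ M) :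
    Runs M buildProg s (26000 * d ^ 2 * (n + 1) * Nat.log 2 (n + 2)) (fun s' => s'.reg 0 = d ∧
      ∃ b pts ls, Represents d n b pts ls s'.mem ∧ ∀ k (hk : k < n), pts k = P ⟨k, hk⟩) := by
  obtain ⟨lg, hlg⟩ : ∃ lg, lg = Nat.log 2 (n + 2) := ⟨_, rfl⟩
  have hlg1 : 1 ≤ lg := hlg ▸ Nat.log_pos one_lt_two (by omega)
  have hd2 : d ≤ d ^ 2 := Nat.le_self_pow two_ne_zero d
  have hdl : d ^ 2 ≤ d ^ 2 * lg := Nat.le_mul_of_pos_right _ hlg1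
  have e1 : 26000 * d ^ 2 * (n + 1) * lg = n * (26000 * (d ^ 2 * lg)) + 26000 * (d ^ 2 * lg) := by
    ring
  have e2 : 25000 * d ^ 2 * lg = 25000 * (d ^ 2 * lg) := by ring
  have hstep : n * (25000 * d ^ 2 * lg + 23 * d + 6 + 8) ≤ n * (26000 * (d ^ 2 * lg)) :=
    Nat.mul_le_mul_left n (by omega)
  rw [← hlg]
  unfold buildProg
  refine Runs.store_seq (k := 1) (v := 1) (by simp) (by simp) (by simp) (by simp) (by omega)
    (T₂ := n * (25000 * d ^ 2 * lg + 23 * d + 6 + 8) + 10) ?_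
    (by rw [show (1 : Term).cost = 1 from rfl]; omega)
  refine Runs.set_seq (v := 0) (by simp) (by simp)
    (T₂ := n * (25000 * d ^ 2 * lg + 23 * d + 6 + 8) + 5) ?_
    (by rw [show (0 : Term).cost = 1 from rfl]; omega)
  refine Runs.mono (Runs.forLoop (T := 25000 * d ^ 2 * lg + 23 * d + 6) (N := n) (a := 0)
    (fun k s' => s'.reg 0 = d ∧ s'.reg 1 = n ∧ s'.reg 5 = k ∧ s'.inp = encodePoints P ∧
      ∃ b pts ls, Represents d k b pts ls s'.mem ∧ ∀ j (hj : j < n), j < k → pts j = P ⟨j, hj⟩)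
    ?_ ?_ ?_ (by omega)) (by simp only [Term.cost_reg, Nat.sub_zero, add_assoc, Nat.reduceAdd]; omega) ?_
  · rintro k s₁ ⟨-, g1, g5, -⟩
    exact ⟨g5, by simp, by simp [g1]⟩
  · rintro k s₁ hk ⟨g0, g1, g5, gi, b, pts, ls, hRep, hpts⟩
    have hkd : (k + 1) * d ≤ n * d := Nat.mul_le_mul_right d hk
    have hklg : 25000 * d ^ 2 * Nat.log 2 (k + 2) ≤ 25000 * d ^ 2 * lg := by
      rw [hlg]; exact Nat.mul_le_mul_left _ (Nat.log_mono_right (by omega))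
    refine Runs.seq (runs_loadProg (c := k * d) (p := P ⟨k, hk⟩) g0 (fun m s' hW => ⟨by simp, ?_⟩)
      (fun j hj => ?_) (by omega)) ?_ (T₂ := 25000 * d ^ 2 * lg)
      (by simp only [Term.cost_mul, Term.cost_reg]; omega)
    · simp [hW.reg 5 (by omega), hW.reg 0 (by omega), g0, g5]
    · rw [gi, encodePoints_mul_add P hk hj]
    · intro s₂ hW
      refine (runs_insertProg (p := P ⟨k, hk⟩) hd (by rw [hW.reg 0 (by omega), g0])
        (by rw [hW.mem]; exact hRep.writeBlock _) (by rw [hW.mem]; exact holdsPoint_writeBlock _ _)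
        (by omega)).mono hklg ?_
      rintro s₃ ⟨m, hW₃, hcase⟩
      have hW' := hW.mono (show 10 ≤ 13 by omega) |>.trans hW₃
      refine ⟨by rw [hW'.reg 5 (by omega), g5], by simp [hW'.reg 0 (by omega), g0],
        by simp [hW'.reg 1 (by omega), g1], by simp, by simp [hW'.inp, gi], ?_⟩
      rcases hcase with ⟨⟨j, hj, hjk⟩, -⟩ | ⟨-, b', ls', hRep'⟩
      · rw [hpts j (by omega) hj] at hjk
        have := Fin.mk.inj_iff.1 (hP hjk)
        omega
      · refine ⟨b', _, ls', by rw [Store.setReg_mem, hW'.mem]; exact hRep', fun j hj hjk => ?_⟩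
        rcases Nat.lt_succ_iff_lt_or_eq.1 hjk with h | rfl
        · rw [Function.update_of_ne h.ne, hpts j hj h]
        · rw [Function.update_self]
  · refine ⟨by simp [h0], by simp [h1], by simp, by simp [hinp], 1, fun _ => ⟨0, 1, one_pos⟩,
      fun _ => [], ?_, by omega⟩
    have := represents_empty fun _ => (⟨0, 1, one_pos⟩ : HPoint d)
    rw [← hmem] at this
    simpa [Store.setMem] using this
  · rintro s' ⟨g0, -, -, -, b, pts, ls, hRep, hpts⟩
    exact ⟨g0, b, pts, ls, hRep, fun k hk => hpts k hk hk⟩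

/-- Tries the pair of points at the positions `r` and `r + 1` of the list of the order in register
`12`, where register `13` holds `r`. -/
def pairProg : Prog :=
  .seq (.set 18 (.digit (.listCell (.reg 12)) (.reg 13))) <|
  .seq (.set 19 (.digit (.listCell (.reg 12)) (.reg 13 + 1))) <|
  .seq (.set 30 (.pointAddr (.reg 18))) <| .seq (.set 31 (.pointAddr (.reg 19))) improveProg

theorem runs_pairProg {M d n b i k : ℕ} (hd : 1 ≤ d) {s : Store} {pts : ℕ → HPoint d}
    {ls : ℕ → List ℕ} {A : Set (ℕ × ℕ)} (h0 : s.reg 0 = d) (h12 : s.reg 12 = i) (hi1 : 1 ≤ i)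
    (hi : i ≤ d + 1) (hRep : Represents d n b pts ls s.mem) (hM : 2 * d + 4 + n * d ≤ M)
    (h13 : s.reg 13 = k) (hk : k + 1 < (ls i).length)
    (hA : HoldsBest (fun x => sqRatio (pts x.1) (pts x.2)) A s) :
    Runs M pairProg s (100 * d + 150) (fun s' => Frame 14 s s' ∧
      HoldsBest (fun x => sqRatio (pts x.1) (pts x.2)) (insert ((ls i)[k], (ls i)[k + 1]) A) s') := by
  have hS := hRep.sorted i hi1 hi
  have hx : (ls i)[k] < n := hS.lt_of_mem (List.getElem_mem (by omega))
  have hy : (ls i)[k + 1] < n := hS.lt_of_mem (List.getElem_mem hk)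
  have hxd : ((ls i)[k] + 1) * d ≤ n * d := Nat.mul_le_mul_right d hx
  have hyd : ((ls i)[k + 1] + 1) * d ≤ n * d := Nat.mul_le_mul_right d hy
  rw [add_one_mul] at hxd hyd
  have hlt : ∀ x ∈ ls i, x < 2 ^ b := fun x hx => (hS.lt_of_mem hx).trans_le hRep.n_le
  have t12 : (Term.reg 12).eval s = i := h12
  have hL := hRep.lists i hi1 hi
  unfold pairProg
  refine Runs.set_seq (v := (ls i)[k]) (Term.fits_digit (by omega)
    (Term.fits_listCell h0 t12 (by omega) (by simp)) (by simp)) ?_ (T₂ := 100 * d + 90) ?_ ?_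
  · rw [Term.eval_digit (b := b) (k := k) (l := ls i) hRep.bits
      (by rw [Term.eval_listCell h0 t12, hL]) (by simp [h13]) hlt, List.getD_eq_getElem]
  swap
  · have : (Term.digit (.listCell (.reg 12)) (.reg 13)).cost ≤ 50 := by decide
    omega
  have t12' : (Term.reg 12).eval (s.setReg 18 ((ls i)[k] : ℕ)) = i := by simp [h12]
  have h0' : (s.setReg 18 ((ls i)[k] : ℕ)).reg 0 = d := by simp [h0]
  refine Runs.set_seq (v := (ls i)[k + 1]) (Term.fits_digit (by omega)
    (Term.fits_listCell h0' t12' (by omega) (by simp)) (by simp)) ?_ (T₂ := 100 * d + 35) ?_ ?_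
  · rw [Term.eval_digit (b := b) (k := k + 1) (l := ls i) (by simp [hRep.bits])
      (by rw [Term.eval_listCell h0' t12', Store.setReg_mem, hL]) (by simp [h13]) hlt,
      List.getD_eq_getElem]
  swap
  · have : (Term.digit (.listCell (.reg 12)) (.reg 13 + 1)).cost ≤ 50 := by decide
    omega
  refine Runs.set_seq (v := (2 * d + 4 + (ls i)[k] * d : ℕ)) (Term.fits_pointAddr (by simp))
    (Term.eval_pointAddr (by simp [h0]) (by simp)) (T₂ := 100 * d + 17) ?_ ?_
  swap
  · have : (Term.pointAddr (.reg 18)).cost ≤ 15 := by decide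
    omega
  refine Runs.set_seq (v := (2 * d + 4 + (ls i)[k + 1] * d : ℕ)) (Term.fits_pointAddr (by simp))
    (Term.eval_pointAddr (by simp [h0]) (by simp)) (T₂ := 100 * d) ?_ ?_
  swap
  · have : (Term.pointAddr (.reg 19)).cost ≤ 15 := by decide
    omega
  refine Runs.mono (runs_improveProg (a := 2 * d + 4 + (ls i)[k] * d)
    (b := 2 * d + 4 + (ls i)[k + 1] * d) (u := (ls i)[k]) (v := (ls i)[k + 1])
    (p := pts (ls i)[k]) (q := pts (ls i)[k + 1]) hd (by simp [h0]) (by simp) (by simp) (by simp)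
    (by simp) (hRep.points _ hx) (hRep.points _ hy) (by omega) (by omega) rfl
    (hA.congr fun r h1 h2 => ?_)) le_rfl ?_
  · simp [show r ≠ 18 by omega, show r ≠ 19 by omega, show r ≠ 30 by omega,
      show r ≠ 31 by omega]
  · rintro s' ⟨hF, hA'⟩
    exact ⟨Frame.trans (((((Frame.refl _ s).setReg (by omega) _).setReg (by omega) _).setReg
      (by omega) _).setReg (by omega) _) hF, hA'⟩

/-- Tries all pairs of consecutive points of the list of the order in register `12`. -/
def adjacentProg : Prog := .seq (.set 13 0) (forLoop 13 (.mem 0 - 1) pairProg)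

theorem runs_adjacentProg {M d n b i : ℕ} (hd : 1 ≤ d) (hn : 1 ≤ n) {s : Store}
    {pts : ℕ → HPoint d} {ls : ℕ → List ℕ} {A : Set (ℕ × ℕ)} (h0 : s.reg 0 = d)
    (h12 : s.reg 12 = i) (hi1 : 1 ≤ i) (hi : i ≤ d + 1) (hRep : Represents d n b pts ls s.mem)
    (hM : 2 * d + 4 + n * d ≤ M) (hAn : ∀ x ∈ A, x.1 < n ∧ x.2 < n ∧ x.1 ≠ x.2)
    (hA : HoldsBest (fun x => sqRatio (pts x.1) (pts x.2)) A s) :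
    Runs M adjacentProg s (300 * d * n) (fun s' => Frame 13 s s' ∧
      ∃ A', A ⊆ A' ∧ (∀ x ∈ A', x.1 < n ∧ x.2 < n ∧ x.1 ≠ x.2) ∧
        HoldsBest (fun x => sqRatio (pts x.1) (pts x.2)) A' s' ∧
        ∀ j (hj : j + 1 < (ls i).length), ((ls i)[j], (ls i)[j + 1]) ∈ A') := by
  have hS := hRep.sorted i hi1 hi
  have hlen := hS.length_eq
  have hm0 : ∀ s' : Store, (Term.mem 0).Fits M s' := fun s' => Term.fits_mem_zero (by omega)
  have hdn : n ≤ d * n := Nat.le_mul_of_pos_left n hd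
  have hT : (n - 1) * (100 * d + 150 + 4 + 7) + 20 ≤ 300 * d * n := by
    obtain ⟨n', rfl⟩ : ∃ n', n = n' + 1 := ⟨n - 1, by omega⟩
    have e1 : n' * (100 * d + 150 + 4 + 7) = 100 * (d * n') + 161 * n' := by ring
    have e2 : 300 * d * (n' + 1) = 300 * (d * n') + 300 * d := by ring
    have e3 : n' ≤ d * n' := Nat.le_mul_of_pos_left n' hd
    rw [Nat.add_sub_cancel]
    omega
  unfold adjacentProg
  refine Runs.set_seq (v := 0) (by simp) (by simp)
    (T₂ := (n - 1) * (100 * d + 150 + 4 + 7) + 10) ?_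
    (by rw [show (0 : Term).cost = 1 from rfl]; omega)
  refine Runs.mono (Runs.forLoop (T := 100 * d + 150) (N := n - 1) (a := 0) (fun k s' =>
    Frame 13 s s' ∧ s'.reg 13 = k ∧ ∃ A', A ⊆ A' ∧ (∀ x ∈ A', x.1 < n ∧ x.2 < n ∧ x.1 ≠ x.2) ∧
      HoldsBest (fun x => sqRatio (pts x.1) (pts x.2)) A' s' ∧
      ∀ j (hj : j + 1 < (ls i).length), j < k → ((ls i)[j], (ls i)[j + 1]) ∈ A')
    ?_ ?_ ?_ (by omega)) ?_ ?_
  · rintro k s₁ ⟨hF, h13, -⟩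
    exact ⟨h13, by simp [hm0], by simp [hF.mem, hRep.size, Nat.cast_sub hn]⟩
  · rintro k s₁ hk ⟨hF, h13, A', hAA', hAn', hA', hj⟩
    have hkl : k + 1 < (ls i).length := by omega
    refine Runs.mono (runs_pairProg hd (by rw [hF.reg 0 (by omega), h0])
      (by rw [hF.reg 12 (by omega), h12]) hi1 hi (by rw [hF.mem]; exact hRep) hM h13 hkl hA')
      le_rfl ?_
    rintro s₂ ⟨hF₂, hA₂⟩
    refine ⟨by rw [hF₂.reg 13 (by omega), h13], (hF.trans (hF₂.mono (by omega))).setReg le_rfl _,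
      by simp, _, hAA'.trans (Set.subset_insert _ _), ?_, hA₂.congr fun r _ _ =>
        by simp [show r ≠ 13 by omega], fun j hjl hjk => ?_⟩
    · rintro x (rfl | hx)
      · refine ⟨hS.lt_of_mem (List.getElem_mem _), hS.lt_of_mem (List.getElem_mem _), fun h => ?_⟩
        have := (hS.nodup.getElem_inj_iff).1 h
        omega
      · exact hAn' x hx
    · rcases Nat.lt_succ_iff_lt_or_eq.1 hjk with h | rfl
      · exact .inr (hj j hjl h)
      · exact Set.mem_insert _ _
  · exact ⟨(Frame.refl _ _).setReg le_rfl _, by simp, A, subset_rfl, hAn,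
      hA.congr fun r _ _ => by simp [show r ≠ 13 by omega], by omega⟩
  · have : (Term.mem 0 - 1).cost = 4 := by decide
    rw [this, Nat.sub_zero]; omega
  · rintro s' ⟨hF, -, A', hAA', hAn', hA', hj⟩
    exact ⟨hF, A', hAA', hAn', hA', fun j hjl => hj j hjl (by omega)⟩

/-- The closest pair among the consecutive pairs of the `d + 1` lists is output. -/
def closestPairProg : Prog :=
  .seq buildProg <| .seq (.set 14 0) <| .seq (forOrders 12 adjacentProg) <|
  .seq (.output 0 (.reg 16)) (.output 1 (.reg 17))

/-- In a suitable order, one of two given points is adjacent to a point that lies between them, or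
the points are adjacent themselves, and a cell of size proportional to their distance contains
them. -/
theorem exists_adjacent_hdist_le {d n : ℕ} (hd : 1 ≤ d) {pts : ℕ → HPoint d} {ls : ℕ → List ℕ}
    (hS : ∀ i, 1 ≤ i → i ≤ d + 1 → SortedList i n pts (ls i)) {A : Set (ℕ × ℕ)}
    (hA : ∀ i, 1 ≤ i → i ≤ d + 1 → ∀ j (hj : j + 1 < (ls i).length),
      ((ls i)[j], (ls i)[j + 1]) ∈ A) {a a' : ℕ} (ha : a < n) (ha' : a' < n)
    (hne : pts a ≠ pts a') :
    ∃ x ∈ A, hdist (pts x.1) (pts x.2) ≤ 160 * (d * Real.sqrt d) * hdist (pts a) (pts a') := by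
  obtain ⟨i, hi1, hi, m, hm, hr⟩ := exists_shift hd hne
  have hpw := List.pairwise_iff_getElem.1 (hS i hi1 hi).pairwise
  obtain ⟨j, hj, rfl⟩ := List.mem_iff_getElem.1 (((hS i hi1 hi).mem_iff a).2 ha)
  obtain ⟨j', hj', rfl⟩ := List.mem_iff_getElem.1 (((hS i hi1 hi).mem_iff a').2 ha')
  rcases lt_trichotomy j j' with h | rfl | h
  · refine ⟨_, hA i hi1 hi j (by omega), hr _ ?_⟩
    rcases Nat.eq_or_lt_of_le (show j + 1 ≤ j' by omega) with rfl | h'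
    · exact hm
    · exact (SameCell.of_between hd hi1 hi (hpw _ _ hj (by omega) (Nat.lt_succ_self j))
        (hpw _ _ (by omega) hj' h') hm).1
  · exact absurd rfl hne
  · obtain _ | j := j
    · omega
    refine ⟨_, hA i hi1 hi j (by omega), ?_⟩
    rw [hdist_comm]
    refine hr _ ?_
    rcases Nat.eq_or_lt_of_le (show j' ≤ j by omega) with rfl | h'
    · exact hm
    · exact (SameCell.of_between hd hi1 hi (hpw _ _ hj' (by omega) h')
        (hpw _ _ (by omega) hj (Nat.lt_succ_self j)) (hm.symm hd hi1 hi)).2.symm hd hi1 hi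

theorem runs_closestPairProg {M d n : ℕ} (hd : 1 ≤ d) (hn : 2 ≤ n) {P : Fin n → HPoint d}
    (hP : Function.Injective P) {s : Store} (h0 : s.reg 0 = d) (h1 : s.reg 1 = n)
    (hmem : s.mem = fun _ => 0) (hinp : s.inp = encodePoints P) (hM : 2 * d + 4 + n * d ≤ M) :
    Runs M closestPairProg s (27000 * d ^ 2 * (n + 1) * Nat.log 2 (n + 2)) (fun s' =>
      ∃ i j : Fin n, s'.out 0 = (i : ℕ) ∧ s'.out 1 = (j : ℕ) ∧ i ≠ j ∧ ∀ a a' : Fin n, a ≠ a' →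
        hdist (P i) (P j) ≤ 160 * (d * Real.sqrt d) * hdist (P a) (P a')) := by
  obtain ⟨lg, hlg⟩ : ∃ lg, lg = Nat.log 2 (n + 2) := ⟨_, rfl⟩
  have hlg1 : 1 ≤ lg := hlg ▸ Nat.log_pos one_lt_two (by omega)
  have hd2 : d ≤ d ^ 2 := Nat.le_self_pow two_ne_zero d
  have hT : (d + 1) * (300 * d * n + 10) + 8 + 20 ≤ 1000 * d ^ 2 * (n + 1) * lg := by
    have e1 : (d + 1) * (300 * d * n + 10) + 8 + 20 = 300 * (d ^ 2 * n) + 300 * (d * n) + 10 * d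
      + 38 := by ring
    have e2 : 1000 * d ^ 2 * (n + 1) = 1000 * (d ^ 2 * n) + 1000 * d ^ 2 := by ring
    have e3 : d * n ≤ d ^ 2 * n := Nat.mul_le_mul_right n hd2
    have e4 : 1000 * d ^ 2 * (n + 1) ≤ 1000 * d ^ 2 * (n + 1) * lg :=
      Nat.le_mul_of_pos_right _ hlg1
    omega
  have e1 : 27000 * d ^ 2 * (n + 1) * lg = 26000 * d ^ 2 * (n + 1) * lg +
    1000 * d ^ 2 * (n + 1) * lg := by ring
  unfold closestPairProg
  rw [← hlg]
  refine Runs.seq (runs_buildProg hd hP h0 h1 hmem hinp hM) ?_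
    (T₂ := (d + 1) * (300 * d * n + 10) + 8 + 20) (by rw [← hlg]; omega)
  rintro s₁ ⟨g0, b, pts, ls, hRep, hpts⟩
  refine Runs.set_seq (v := 0) (by simp) (by simp) (T₂ := (d + 1) * (300 * d * n + 10) + 8 + 10) ?_
    (by rw [show (0 : Term).cost = 1 from rfl]; omega)
  set f : ℕ × ℕ → ℝ := fun x => sqRatio (pts x.1) (pts x.2) with hf
  refine Runs.seq (runs_forOrders (d := d) (T := 300 * d * n) (fun i s' => s'.mem = s₁.mem ∧
    s'.reg 0 = d ∧ ∃ A, (∀ x ∈ A, x.1 < n ∧ x.2 < n ∧ x.1 ≠ x.2) ∧ HoldsBest f A s' ∧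
      ∀ k, 1 ≤ k → k < i → ∀ j (hj : j + 1 < (ls k).length), ((ls k)[j], (ls k)[j + 1]) ∈ A)
    (fun _ _ h => h.2.1) ?_ ?_ ?_) ?_ le_rfl
  · rintro i s' v ⟨gm, g0, A, hAn, hA, hAB⟩
    exact ⟨gm, by simp [g0], A, hAn, hA.congr fun r _ _ => by simp [show r ≠ 12 by omega], hAB⟩
  · exact ⟨rfl, by simp [g0], ∅, by simp, .inl ⟨by simp, rfl⟩, by omega⟩
  · rintro i hi1 hi s₂ ⟨gm, g0, A, hAn, hA, hAB⟩ h12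
    refine Runs.mono (runs_adjacentProg hd (by omega) g0 h12 hi1 hi (by rw [gm]; exact hRep) hM
      hAn hA) le_rfl ?_
    rintro s₃ ⟨hF, A', hAA', hAn', hA', hB⟩
    refine ⟨by rw [hF.reg 12 (by omega), h12], by rw [hF.mem, gm], by rw [hF.reg 0 (by omega), g0],
      A', hAn', hA', fun k hk1 hk j hj => ?_⟩
    rcases Nat.lt_succ_iff_lt_or_eq.1 hk with h | rfl
    · exact hAA' (hAB k hk1 h j hj)
    · exact hB j hj
  · rintro s₂ ⟨-, -, A, hAn, hA, hAB⟩
    have hkey : ∀ a a' : Fin n, a ≠ a' → ∃ x ∈ A, hdist (pts x.1) (pts x.2) ≤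
        160 * (d * Real.sqrt d) * hdist (P a) (P a') := fun a a' hne => by
      have ea := hpts a a.2
      have ea' := hpts a' a'.2
      rw [Fin.eta] at ea ea'
      rw [← ea, ← ea']
      exact exists_adjacent_hdist_le hd hRep.sorted (fun i h1 h2 => hAB i h1 (by omega)) a.2 a'.2
        (by rw [ea, ea']; exact fun h => hne (hP h))
    rcases hA with ⟨-, rfl⟩ | ⟨-, x, hx, -, h16, h17, hmin⟩
    · obtain ⟨x, hx, -⟩ := hkey ⟨0, by omega⟩ ⟨1, by omega⟩ (by simp)
      exact absurd hx (Set.notMem_empty x)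
    · obtain ⟨hx1, hx2, hxne⟩ := hAn x hx
      refine Runs.seq (R := fun s' => s' = s₂.setOut 0 (x.1 : ℕ)) (T₁ := 5) (T₂ := 5)
        (Runs.output (k := 0) (v := (x.1 : ℕ)) (by simp) (by simp) (by simp) (by simp [h16])
          (by decide) rfl) ?_ le_rfl
      rintro _ rfl
      refine Runs.output (k := 1) (v := (x.2 : ℕ)) (by simp) (by simp) (by simp) (by simp [h17])
        (by decide) ⟨⟨x.1, hx1⟩, ⟨x.2, hx2⟩, by simp, by simp, by simpa using hxne,
          fun a a' hne => ?_⟩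
      obtain ⟨y, hy, h⟩ := hkey a a' hne
      rw [← hpts x.1 hx1, ← hpts x.2 hx2]
      exact (hdist_le_hdist_of_sqRatio_le hd (hmin y hy)).trans h

/-! ### Operations on the data structure -/

/-- The memory contents represent the finite set `S`. -/
def Stores (d : ℕ) (S : Finset (HPoint d)) (mem : ℕ → ℝ) : Prop :=
  ∃ b pts ls, Represents d S.card b pts ls mem ∧ S = (Finset.range S.card).image pts

/-- The approximate nearest neighbour data structure. -/
def shiftedOrders : DynProgs where
  build := buildProg
  query := queryProg
  insert := .seq (loadProg 0) insertProg
  delete := .seq (loadProg 0) deleteProg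

theorem startStore_inp {d : ℕ} (mem : ℕ → ℝ) (p : HPoint d) {j : ℕ} (hj : j < d) :
    (startStore mem ![p]).inp j = p.coord j := by
  have := encodePoints_mul_add ![p] (k := 0) one_pos hj
  rwa [zero_mul, zero_add] at this

theorem Represents.stores {d n b : ℕ} {pts : ℕ → HPoint d} {ls : ℕ → List ℕ} {m : ℕ → ℝ}
    {S : Finset (HPoint d)} (h : Represents d n b pts ls m)
    (hS : S = (Finset.range n).image pts) (hc : S.card = n) : Stores d S m :=
  ⟨b, pts, ls, by rwa [hc], by rwa [hc]⟩

namespace Stores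

variable {d : ℕ} {S : Finset (HPoint d)} {mem : ℕ → ℝ} {M : ℕ}

/-- An operation starts with loading its input point into the buffer. -/
theorem runs_load (hd : 1 ≤ d) (p : HPoint d) {op : Prog} {T T' : ℕ} {Q : Store → Prop}
    (hop : ∀ s : Store, s.reg 0 = d → s.mem = writeBlock mem 2 d p.coord → Runs M op s T Q)
    (hM : 2 * d + 4 ≤ M) (hT : 27 * d + T ≤ T') :
    Runs M (.seq (loadProg 0) op) (startStore mem ![p]) T' Q := by
  have h0 : (startStore mem ![p]).reg 0 = d := by simp [startStore]
  refine Runs.seq (runs_loadProg (c := 0) (p := p) h0 (fun _ _ _ => by simp)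
    (fun j hj => by rw [zero_add, startStore_inp mem p hj]) (by omega))
    (fun s₁ hW => hop s₁ (by rw [hW.reg 0 (by omega), h0]) hW.mem)
    (by rw [show (0 : Term).cost = 1 from rfl]; omega)

theorem runs_build (hd : 1 ≤ d) {n : ℕ} {P : Fin n → HPoint d} (hP : Function.Injective P)
    (hM : 2 * d + 4 + n * d ≤ M) : Runs M buildProg (startStore (fun _ => 0) P)
      (26000 * d ^ 2 * (n + 1) * Nat.log 2 (n + 2)) (fun s => Stores d (pointSet P) s.mem) := by
  refine Runs.mono (runs_buildProg hd hP (by simp [startStore]) (by simp [startStore]) rfl rfl hM)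
    le_rfl ?_
  rintro s ⟨-, b, pts, ls, hRep, hpts⟩
  refine hRep.stores ?_ (by rw [pointSet, Finset.card_image_of_injective _ hP]; simp)
  ext p
  simp only [pointSet, Finset.mem_image, Finset.mem_univ, true_and, Finset.mem_range]
  constructor
  · rintro ⟨i, rfl⟩
    exact ⟨i, i.2, hpts i i.2⟩
  · rintro ⟨k, hk, rfl⟩
    exact ⟨⟨k, hk⟩, (hpts k hk).symm⟩

theorem runs_query (hd : 1 ≤ d) (h : Stores d S mem) (hS : S.Nonempty) (q : HPoint d)
    (hM : 2 * d + 4 + S.card * d ≤ M) : Runs M queryProg (startStore mem ![q])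
      (12000 * d ^ 2 * Nat.log 2 (S.card + 2)) (fun s => Stores d S s.mem ∧ ∃ p,
        OutputsPoint s p ∧ IsApproxNearest (160 * (d * Real.sqrt d)) S q p) := by
  obtain ⟨b, pts, ls, hRep, hSp⟩ := h
  refine Runs.mono (runs_queryProg hd hS.card_pos (by simp [startStore]) hRep
    (fun j hj => startStore_inp mem q hj) hM) le_rfl ?_
  rintro s ⟨hRep', k, hk, hout, hmin⟩
  refine ⟨⟨b, pts, ls, hRep', hSp⟩, pts k, hout, ?_, fun a ha => ?_⟩
  · rw [hSp]; exact Finset.mem_image_of_mem _ (Finset.mem_range.2 hk)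
  · rw [hSp] at ha
    obtain ⟨j, hj, rfl⟩ := Finset.mem_image.1 ha
    exact hmin j (Finset.mem_range.1 hj)

theorem runs_insert (hd : 1 ≤ d) (h : Stores d S mem) (p : HPoint d)
    (hM : 2 * d + 4 + (S.card + 1) * d ≤ M) :
    Runs M shiftedOrders.insert (startStore mem ![p]) (26000 * d ^ 2 * Nat.log 2 (S.card + 2))
      (fun s => Stores d (Insert.insert p S) s.mem) := by
  obtain ⟨b, pts, ls, hRep, hSp⟩ := h
  set n := S.card with hn
  obtain ⟨lg, hlg⟩ : ∃ lg, lg = Nat.log 2 (n + 2) := ⟨_, rfl⟩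
  have hlg1 : 1 ≤ lg := hlg ▸ Nat.log_pos one_lt_two (by omega)
  have hd2 : d ≤ d ^ 2 := Nat.le_self_pow two_ne_zero d
  have hdl : d ^ 2 ≤ d ^ 2 * lg := Nat.le_mul_of_pos_right _ hlg1
  have e1 : 26000 * d ^ 2 * lg = 26000 * (d ^ 2 * lg) := by ring
  have e2 : 25000 * d ^ 2 * lg = 25000 * (d ^ 2 * lg) := by ring
  rw [← hlg]
  refine runs_load hd p (T := 25000 * d ^ 2 * lg) (fun s h0 hm => ?_) (by omega) (by omega)
  refine Runs.mono (runs_insertProg hd h0 (by rw [hm]; exact hRep.writeBlock _)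
    (by rw [hm]; exact holdsPoint_writeBlock _ _) hM) (by rw [hlg]) ?_
  rintro s' ⟨m, hW, ⟨⟨k, hk, rfl⟩, rfl⟩ | ⟨hne, b', ls', hRep'⟩⟩
  · have hmem : pts k ∈ S := by
      rw [hSp]; exact Finset.mem_image_of_mem _ (Finset.mem_range.2 hk)
    rw [Finset.insert_eq_of_mem hmem, hW.mem, hm]
    exact ⟨b, pts, ls, hRep.writeBlock _, hSp⟩
  · have hnot : p ∉ S := fun hp => by
      rw [hSp] at hp
      obtain ⟨k, hk, h⟩ := Finset.mem_image.1 hp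
      exact hne k (Finset.mem_range.1 hk) h
    rw [hW.mem]
    refine hRep'.stores ?_ (by rw [Finset.card_insert_of_notMem hnot])
    rw [Finset.range_add_one, Finset.image_insert, Function.update_self]
    congr 1
    rw [hSp]
    refine Finset.image_congr fun k hk => ?_
    rw [Function.update_of_ne (Finset.mem_range.1 (Finset.mem_coe.1 hk)).ne]

theorem runs_delete (hd : 1 ≤ d) (h : Stores d S mem) (p : HPoint d)
    (hM : 2 * d + 4 + S.card * d ≤ M) :
    Runs M shiftedOrders.delete (startStore mem ![p]) (32000 * d ^ 2 * Nat.log 2 (S.card + 2))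
      (fun s => Stores d (S.erase p) s.mem) := by
  obtain ⟨b, pts, ls, hRep, hSp⟩ := h
  have hinj : Set.InjOn pts (Finset.range S.card) :=
    Finset.injOn_of_card_image_eq (by rw [← hSp, Finset.card_range])
  obtain ⟨n, hn⟩ : ∃ n, n = S.card := ⟨_, rfl⟩
  rw [← hn] at hM hRep hSp hinj ⊢
  obtain ⟨lg, hlg⟩ : ∃ lg, lg = Nat.log 2 (n + 2) := ⟨_, rfl⟩
  have hlg1 : 1 ≤ lg := hlg ▸ Nat.log_pos one_lt_two (by omega)
  have hd2 : d ≤ d ^ 2 := Nat.le_self_pow two_ne_zero d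
  have hdl : d ^ 2 ≤ d ^ 2 * lg := Nat.le_mul_of_pos_right _ hlg1
  have e1 : 32000 * d ^ 2 * lg = 32000 * (d ^ 2 * lg) := by ring
  have e2 : 31000 * d ^ 2 * lg = 31000 * (d ^ 2 * lg) := by ring
  rw [← hlg]
  refine runs_load hd p (T := 31000 * d ^ 2 * lg) (fun s h0 hm => ?_) (by omega) (by omega)
  refine Runs.mono (runs_deleteProg hd h0 (by rw [hm]; exact hRep.writeBlock _)
    (by rw [hm]; exact holdsPoint_writeBlock _ _) hM) (by rw [hlg]) ?_
  rintro s' (⟨hne, hm'⟩ | ⟨σ, n', hn', hσ, rfl, ls', hRep'⟩)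
  · have hnot : p ∉ S := fun hp => by
      rw [hSp] at hp
      obtain ⟨k, hk, h⟩ := Finset.mem_image.1 hp
      exact hne k (Finset.mem_range.1 hk) h
    rw [Finset.erase_eq_of_notMem hnot, hm', hm]
    exact (hRep.writeBlock _).stores hSp hn.symm
  · subst hn'
    have hmem : pts σ ∈ S := by
      rw [hSp]; exact Finset.mem_image_of_mem _ (Finset.mem_range.2 hσ)
    refine hRep'.stores ?_ (by rw [Finset.card_erase_of_mem hmem, ← hn, Nat.add_sub_cancel])
    have hinj' : ∀ k ≤ n', ∀ l ≤ n', pts k = pts l → k = l := fun k hk l hl h =>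
      hinj (by simpa using Nat.lt_succ_of_le hk) (by simpa using Nat.lt_succ_of_le hl) h
    ext q
    rw [hSp]
    simp only [Finset.mem_erase, Finset.mem_image, Finset.mem_range]
    constructor
    · rintro ⟨hne, k, hk, rfl⟩
      have hkσ : k ≠ σ := fun h => hne (by rw [h])
      by_cases hkn : k = n'
      · exact ⟨σ, by omega, by rw [Function.update_self, hkn]⟩
      · exact ⟨k, by omega, by rw [Function.update_of_ne hkσ]⟩
    · rintro ⟨k, hk, rfl⟩
      by_cases hkσ : k = σ
      · subst hkσ
        rw [Function.update_self]
        exact ⟨fun h => hk.ne' (hinj' _ le_rfl _ (by omega) h), n', by omega, rfl⟩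
      · rw [Function.update_of_ne hkσ]
        exact ⟨fun h => hkσ (hinj' _ (by omega) _ (by omega) h), k, by omega, rfl⟩

end Stores

theorem Runs.of_exec {M M' : ℕ} {p : Prog} {s s' : Store} {t T : ℕ} {Q : Store → Prop}
    (h : Runs M p s T Q) (h' : Exec M' p s t s') : Q s' := by
  obtain ⟨_, _, he, -, hQ⟩ := h
  obtain ⟨-, rfl⟩ := he.det h'
  exact hQ

theorem Reach.stores {d : ℕ} (hd : 1 ≤ d) {S : Finset (HPoint d)} {mem : ℕ → ℝ}
    (h : Reach shiftedOrders d S mem) : Stores d S mem := by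
  induction h with
  | build P hP h => exact (Stores.runs_build hd hP le_rfl).of_exec h
  | query _ hne q h ih => exact ((Stores.runs_query hd ih hne q le_rfl).of_exec h).1
  | insert _ p h ih => exact (Stores.runs_insert hd ih p le_rfl).of_exec h
  | delete _ p h ih => exact (Stores.runs_delete hd ih p le_rfl).of_exec h

theorem natLog_le_logb_add_two (n : ℕ) : (Nat.log 2 (n + 2) : ℝ) ≤ Real.logb 2 (n + 2) := by
  have := Real.natLog_le_logb (n + 2) 2
  push_cast at this
  exact this

theorem logb_add_two_le {n : ℕ} (hn : 2 ≤ n) : Real.logb 2 (n + 2) ≤ 2 * Real.logb 2 n := by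
  have h2 : (2 : ℝ) ≤ n := by exact_mod_cast hn
  rw [← Real.logb_rpow_eq_mul_logb_of_pos (by linarith)]
  refine Real.logb_le_logb_of_le (by norm_num) (by linarith) ?_
  rw [Real.rpow_two]
  nlinarith

theorem theorem2 :
    ∃ C : ℕ,
      -- approximate closest pair
      (∃ closestPair : Prog,
        ∀ d : ℕ, 1 ≤ d → ∀ n : ℕ, 2 ≤ n →
        ∀ P : Fin n → HPoint d, Function.Injective P →
          ∃ (M t : ℕ) (s : Store),
            Exec M closestPair (startStore (fun _ => 0) P) t s ∧
            (t : ℝ) ≤ C * (d : ℝ) ^ 2 * n * Real.logb 2 n ∧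
            ∃ i j : Fin n, s.out 0 = ((i : ℕ) : ℝ) ∧ s.out 1 = ((j : ℕ) : ℝ) ∧
              IsApproxClosestPair (C * (d * Real.sqrt d)) (pointSet P) (P i) (P j)) ∧
      -- dynamic approximate nearest neighbours
      (∃ D : DynProgs,
        ∀ d : ℕ, 1 ≤ d →
          -- construction
          (∀ (n : ℕ) (P : Fin n → HPoint d), Function.Injective P →
            ∃ (t : ℕ) (s : Store),
              Exec (C * d ^ 2 * (n + 1)) D.build (startStore (fun _ => 0) P) t s ∧
              (t : ℝ) ≤ C * (d : ℝ) ^ 2 * (n + 1) * Real.logb 2 (n + 2)) ∧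
          -- at any time after the construction
          (∀ (S : Finset (HPoint d)) (mem : ℕ → ℝ), Reach D d S mem →
            -- space
            (∀ a : ℕ, C * d ^ 2 * (S.card + 1) ≤ a → mem a = 0) ∧
            -- queries
            (S.Nonempty → ∀ q : HPoint d, ∃ (t : ℕ) (s : Store),
              Exec (C * d ^ 2 * (S.card + 1)) D.query (startStore mem ![q]) t s ∧
              (t : ℝ) ≤ C * (d : ℝ) ^ 2 * Real.logb 2 (S.card + 2) ∧
              ∃ p : HPoint d, OutputsPoint s p ∧
                IsApproxNearest (C * (d * Real.sqrt d)) S q p) ∧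
            -- insertions
            (∀ p : HPoint d, ∃ (t : ℕ) (s : Store),
              Exec (C * d ^ 2 * (S.card + 1)) D.insert (startStore mem ![p]) t s ∧
              (t : ℝ) ≤ C * (d : ℝ) ^ 2 * Real.logb 2 (S.card + 2)) ∧
            -- deletions
            (∀ p : HPoint d, ∃ (t : ℕ) (s : Store),
              Exec (C * d ^ 2 * (S.card + 1)) D.delete (startStore mem ![p]) t s ∧
              (t : ℝ) ≤ C * (d : ℝ) ^ 2 * Real.logb 2 (S.card + 2)))) := by
  have addr : ∀ {d n : ℕ}, 1 ≤ d → 2 * d + 4 + (n + 1) * d ≤ 200000 * d ^ 2 * (n + 1) := by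
    intro d n hd
    have h1 : d * (n + 1) ≤ d ^ 2 * (n + 1) :=
      Nat.mul_le_mul_right _ (Nat.le_self_pow two_ne_zero d)
    have h2 : d ≤ d * (n + 1) := Nat.le_mul_of_pos_right d n.succ_pos
    have e1 : 200000 * d ^ 2 * (n + 1) = 200000 * (d ^ 2 * (n + 1)) := by ring
    have e2 : (n + 1) * d = d * (n + 1) := by ring
    omega
  have time : ∀ {d n t K : ℕ}, K ≤ 200000 → t ≤ K * d ^ 2 * Nat.log 2 (n + 2) →
      (t : ℝ) ≤ (200000 : ℕ) * (d : ℝ) ^ 2 * Real.logb 2 (n + 2) := by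
    intro d n t K hK ht
    have h1 : (t : ℝ) ≤ K * d ^ 2 * Nat.log 2 (n + 2) := by exact_mod_cast ht
    refine h1.trans ?_
    gcongr
    exact natLog_le_logb_add_two n
  have weaken : ∀ {d : ℕ} {x y : ℝ}, 0 ≤ y → x ≤ 160 * (d * Real.sqrt d) * y →
      x ≤ (200000 : ℕ) * (d * Real.sqrt d) * y := by
    intro d x y hy h
    refine h.trans ?_
    gcongr
    norm_num
  refine ⟨200000, ⟨closestPairProg, fun d hd n hn P hP => ?_⟩, shiftedOrders, fun d hd =>
    ⟨fun n P hP => ?_, fun S mem hS => ?_⟩⟩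
  · obtain ⟨t, s, he, ht, i, j, hi, hj, hij, hmin⟩ := runs_closestPairProg hd hn hP
      (s := startStore (fun _ => 0) P) (by simp [startStore]) (by simp [startStore]) rfl rfl le_rfl
    refine ⟨_, t, s, he, ?_, i, j, hi, hj, Finset.mem_image_of_mem _ (Finset.mem_univ i),
      Finset.mem_image_of_mem _ (Finset.mem_univ j), fun h => hij (hP h), ?_⟩
    · have h1 : (t : ℝ) ≤ 27000 * d ^ 2 * (n + 1) * Nat.log 2 (n + 2) := by exact_mod_cast ht
      have h2 : (Nat.log 2 (n + 2) : ℝ) ≤ 2 * Real.logb 2 n :=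
        (natLog_le_logb_add_two n).trans (logb_add_two_le hn)
      have h3 : (n : ℝ) + 1 ≤ 2 * n := by
        have : (2 : ℝ) ≤ n := by exact_mod_cast hn
        linarith
      have h4 : 0 ≤ Real.logb 2 n :=
        Real.logb_nonneg (by norm_num) (by exact_mod_cast (by omega : 1 ≤ n))
      calc (t : ℝ) ≤ 27000 * d ^ 2 * (n + 1) * Nat.log 2 (n + 2) := h1
        _ ≤ 27000 * d ^ 2 * (2 * n) * (2 * Real.logb 2 n) := by gcongr
        _ = 108000 * (d ^ 2 * n * Real.logb 2 n) := by ring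
        _ ≤ 200000 * (d ^ 2 * n * Real.logb 2 n) := by gcongr; norm_num
        _ = (200000 : ℕ) * (d : ℝ) ^ 2 * n * Real.logb 2 n := by push_cast; ring
    · intro a ha a' ha' hne
      obtain ⟨k, -, rfl⟩ := Finset.mem_image.1 ha
      obtain ⟨k', -, rfl⟩ := Finset.mem_image.1 ha'
      exact weaken (hdist_nonneg _ _) (hmin k k' fun h => hne (by rw [h]))
  · have hM := addr (n := n) hd
    rw [add_one_mul] at hM
    obtain ⟨t, s, he, ht, -⟩ := Stores.runs_build hd hP (show _ ≤ 200000 * d ^ 2 * (n + 1) by omega)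
    refine ⟨t, s, he, ?_⟩
    have h1 : (t : ℝ) ≤ 26000 * d ^ 2 * (n + 1) * Nat.log 2 (n + 2) := by exact_mod_cast ht
    refine h1.trans ?_
    gcongr
    · norm_num
    · exact natLog_le_logb_add_two n
  · have hSt := hS.stores hd
    have hM := addr (n := S.card) hd
    have hM' : 2 * d + 4 + S.card * d ≤ 200000 * d ^ 2 * (S.card + 1) := by
      rw [add_one_mul] at hM; omega
    refine ⟨fun a ha => ?_, fun hne q => ?_, fun p => ?_, fun p => ?_⟩
    · obtain ⟨b, pts, ls, hRep, -⟩ := hSt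
      exact hRep.zero a (hM'.trans ha)
    · obtain ⟨t, s, he, ht, -, p, hp, hpS, hmin⟩ := hSt.runs_query hd hne q hM'
      exact ⟨t, s, he, time (by norm_num) ht, p, hp, hpS,
        fun a ha => weaken (hdist_nonneg _ _) (hmin a ha)⟩
    · obtain ⟨t, s, he, ht, -⟩ := hSt.runs_insert hd p hM
      exact ⟨t, s, he, time (by norm_num) ht⟩
    · obtain ⟨t, s, he, ht, -⟩ := hSt.runs_delete hd p hM'
      exact ⟨t, s, he, time (by norm_num) ht⟩
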